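/- Let $G$ be a finite directed graph drawn in the plane, with source $s$ and sink $t$, such that $t$ is on the unbounded face, no directed cycle of the drawing is clockwise, $s$ has no incoming arc and exactly one outgoing arc, and every vertex other than $s,t$ has degree (indegree plus outdegree) three. An arc is useful if some simple $s,t$-path contains it, and useless otherwise; a path is useful if some simple $s,t$-path contains it as a subpath. Let $C$ be a strongly connected component of $G$ with at least one arc such that $t\notin V(C)$ and $s$ lies in the unbounded face of the drawing of $C$. An entrance of $C$ is a vertex $v\in V(C)$ for which there is a simple path $P$ from $s$ to $v$ with $V(P)\cap V(C)=\{v\}$; an exit is a vertex $v\in V(C)$ for which there is a simple path $P$ from $v$ to $t$ with $V(P)\cap V(C)=\{v\}$. Then the arcs of $C$ on the unbounded face of the drawing of $C$ form a directed cycle $Q$, and either all arcs of $C$ are useless, or there are nontrivial paths $Q_1$ and $Q_2$ (each with at least one arc) such that 1. $Q$ is the concatenation of $Q_1$ and $Q_2$; in particular $E(Q)=E(Q_1)\cup E(Q_2)$; 2. $Q_1$ is a useful path; 3. all arcs of $Q_2$ are useless; 4. $Q_1$ starts at an entrance and ends at an exit of $C$, it contains all entrances and all exits of $C$, and on $Q_1$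 every entrance precedes every exit. Moreover, there is an algorithm that, given the tails and heads of the arcs of $G$, the cyclic order of the arcs around each vertex, the vertices $s$ and $t$, and a vertex of $C$, decides which of the two cases holds and in the second case computes $Q_1$ and $Q_2$, in time $O(|V(G)|+|E(G)|)$ on a random access machine whose words hold numbers of size $O(|V(G)|+|E(G)|)$. -/

import Mathlib

/-! ### Directed graphs drawn in the plane -/

/-- A directed (multi)graph on the vertices `V` with arcs `A`, together with a rotation system and
marked outer darts. A dart is an end of an arc: `(a, true)` is the end of `a` at its tail `src a`,
and `(a, false)` the end of `a` at its head `tgt a`; we think of a dart as pointing away from its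
vertex along the arc. `rot` sends a dart to the next one in counterclockwise order around its
vertex, and `outer` is the set of darts that have the unbounded face on their left. -/
structure EmbeddedDigraph (V A : Type*) where
  src : A → V
  tgt : A → V
  rot : Equiv.Perm (A × Bool)
  outer : Set (A × Bool)

namespace EmbeddedDigraph

variable {V A : Type*} (G : EmbeddedDigraph V A)

/-- The vertex at which a dart is attached. -/
def vert (d : A × Bool) : V := if d.2 then G.src d.1 else G.tgt d.1

/-- The other end of the same arc. -/
def flip : Equiv.Perm (A × Bool) where
  toFun d := (d.1, !d.2)
  invFun d := (d.1, !d.2)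
  left_inv d := by simp
  right_inv d := by simp

/-- Traversal of the face on the left of a dart: go along the dart to the other end of the arc and
continue with the dart that is next there in clockwise order. -/
def faceNext : Equiv.Perm (A × Bool) := flip.trans G.rot.symm

/-- Two darts are adjacent if they are consecutive at a vertex or are the two ends of an arc. -/
def DartAdj (d d' : A × Bool) : Prop := d' = G.rot d ∨ d' = flip d

/-- Two darts lie in the same connected component of the underlying undirected graph. -/
def Connected (d d' : A × Bool) : Prop := Relation.EqvGen G.DartAdj d d'

/-- The rotation system is one of a drawing in the plane. Isolated vertices have no darts and play
no role. In the Euler formula, the classes of `rot` are the vertices that are not isolated, the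
classes of `faceNext` are the faces (of each connected component), and the classes of `DartAdj` are
the connected components (other than isolated vertices). -/
structure IsPlane : Prop where
  /-- `rot` permutes the darts at each vertex cyclically. -/
  rot_sameCycle : ∀ d d', G.rot.SameCycle d d' ↔ G.vert d = G.vert d'
  /-- Euler's formula: every connected component has genus zero. -/
  euler : Nat.card (Quot fun d d' => d' = G.rot d) + Nat.card (Quot fun d d' => d' = G.faceNext d) =
    Nat.card A + 2 * Nat.card (Quot G.DartAdj)
  /-- In every connected component exactly one face is the unbounded one. -/
  outer_faceNext : ∀ d, G.faceNext d ∈ G.outer ↔ d ∈ G.outer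
  exists_outer : ∀ d, ∃ d' ∈ G.outer, G.Connected d d'
  outer_unique : ∀ d ∈ G.outer, ∀ d' ∈ G.outer, G.Connected d d' → G.faceNext.SameCycle d d'

/-- For a set `S` of arcs, `G.Outside S d` says that the left side of the dart `d` lies in the
unbounded face of the drawing of `S`: it can be reached from an unbounded face of `G` by moving
within faces of `G` and by crossing arcs that are not in `S`. -/
inductive Outside (S : Set A) : A × Bool → Prop
  | outer {d : A × Bool} (h : d ∈ G.outer) : Outside S d
  | face {d : A × Bool} (h : Outside S d) : Outside S (G.faceNext d)
  | cross {d : A × Bool} (h : Outside S d) (hd : d.1 ∉ S) : Outside S (flip d)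

/-! ### Walks, paths and cycles, as lists of arcs -/

/-- The arcs of the list form a directed walk from `u` to `v`. -/
def IsWalk : V → List A → V → Prop
  | u, [], v => u = v
  | u, a :: l, v => G.src a = u ∧ IsWalk (G.tgt a) l v

/-- The sequence of vertices of a walk that starts at `u`. -/
def support (u : V) (l : List A) : List V := u :: l.map G.tgt

/-- A simple directed path from `u` to `v`. -/
def IsPath (u : V) (l : List A) (v : V) : Prop := G.IsWalk u l v ∧ (G.support u l).Nodup

/-- A directed cycle: a nonempty closed walk in which no vertex repeats. -/
def IsCycle (l : List A) : Prop := l ≠ [] ∧ (∃ u, G.IsWalk u l u) ∧ (l.map G.tgt).Nodup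

/-- A directed cycle is clockwise if the unbounded face of its drawing is on the left side of one
(equivalently, of each) of its arcs. -/
def IsClockwise (l : List A) : Prop := G.IsCycle l ∧ ∃ a ∈ l, G.Outside {b | b ∈ l} (a, true)

/-- There is a simple path from `s` to `t` that contains the arc `a`. -/
def UsefulArc (s t : V) (a : A) : Prop := ∃ l, G.IsPath s l t ∧ a ∈ l

/-- There is a simple path from `s` to `t` that contains the path `p`. -/
def UsefulPath (s t : V) (p : List A) : Prop := ∃ l, G.IsPath s l t ∧ p <:+: l

/-! ### Strongly connected components -/

def Reachable (u v : V) : Prop := ∃ l, G.IsWalk u l v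

/-- `C` is the vertex set of a strongly connected component. -/
def IsSCC (C : Set V) : Prop := ∃ c, C = {v | G.Reachable c v ∧ G.Reachable v c}

/-- The arcs of the subgraph induced by `C`. -/
def arcsOf (C : Set V) : Set A := {a | G.src a ∈ C ∧ G.tgt a ∈ C}

/-- The boundary arcs: the arcs of `C` that lie on the unbounded face of the drawing of `C`. -/
def boundary (C : Set V) : Set A :=
  {a ∈ G.arcsOf C | ∃ b : Bool, G.Outside (G.arcsOf C) (a, b)}

/-- `Q` is a directed cycle that forms the boundary of `C`. -/
def IsBoundaryCycle (C : Set V) (Q : List A) : Prop :=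
  G.IsCycle Q ∧ ∀ a, a ∈ Q ↔ a ∈ G.boundary C

/-- The vertex `v` lies in the unbounded face of the drawing of `C`. -/
def InUnboundedFace (C : Set V) (v : V) : Prop :=
  v ∉ C ∧ ∃ d, G.vert d = v ∧ G.Outside (G.arcsOf C) d

/-- `v ∈ C` can be reached from `s` by a path that meets `C` only in `v`. -/
def IsEntrance (s : V) (C : Set V) (v : V) : Prop :=
  v ∈ C ∧ ∃ l, G.IsPath s l v ∧ ∀ w ∈ G.support s l, w ∈ C → w = v

/-- `t` can be reached from `v ∈ C` by a path that meets `C` only in `v`. -/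
def IsExit (t : V) (C : Set V) (v : V) : Prop :=
  v ∈ C ∧ ∃ l, G.IsPath v l t ∧ ∀ w ∈ G.support v l, w ∈ C → w = v

/-- A plane flow network with source `s` and sink `t` that is in the normal form: the sink is on
the unbounded face (no condition if `t` is isolated), there is no clockwise cycle, the source has
no incoming arc and exactly one outgoing arc, and all other vertices except `t` have degree three. -/
structure IsNormalNetwork (s t : V) : Prop where
  plane : G.IsPlane
  sink_outer : (∃ d, G.vert d = t) → ∃ d ∈ G.outer, G.vert d = t
  no_clockwise : ∀ l, ¬ G.IsClockwise l
  source_in : ∀ a, G.tgt a ≠ s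
  source_out : ∃! a, G.src a = s
  degree_three : ∀ v, v ≠ s → v ≠ t → Nat.card {d // G.vert d = v} = 3

/-- `C` is a strongly connected component with at least one arc, `t` is not in `C`, and `s` is in
the unbounded face of `C`. -/
structure IsOutsideComponent (s t : V) (C : Set V) : Prop where
  scc : G.IsSCC C
  nontrivial : (G.arcsOf C).Nonempty
  sink_notMem : t ∉ C
  source_outside : G.InUnboundedFace C s

/-- No arc of `C` is useful. -/
def AllUseless (s t : V) (C : Set V) : Prop := ∀ a ∈ G.arcsOf C, ¬ G.UsefulArc s t a

/-- The cycle `Q` splits into a nontrivial path `Q₁` from an entrance `u` to an exit `v` and a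
nontrivial path `Q₂` from `v` back to `u`, where `Q₁` is useful, all arcs of `Q₂` are useless, and
`Q₁` contains all entrances and exits, every entrance before every exit. -/
def Splits (s t : V) (C : Set V) (Q Q₁ Q₂ : List A) : Prop :=
  Q ~r Q₁ ++ Q₂ ∧ Q₁ ≠ [] ∧ Q₂ ≠ [] ∧ ∃ u v, G.IsEntrance s C u ∧ G.IsExit t C v ∧
    G.IsPath u Q₁ v ∧ G.IsPath v Q₂ u ∧
    G.UsefulPath s t Q₁ ∧ (∀ a ∈ Q₂, ¬ G.UsefulArc s t a) ∧
    ∀ e x, G.IsEntrance s C e → G.IsExit t C x → [e, x].Sublist (G.support u Q₁)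

end EmbeddedDigraph

/-! ### A random access machine with unit cost

Programs of a structured language over numbered registers and numbered arrays. Every node of an
expression and every command costs one step. All numbers that occur have to be at most a word bound
`W`; a run that exceeds it gets stuck. -/

namespace RAM

structure State where
  reg : ℕ → ℕ
  mem : ℕ → ℕ → ℕ

inductive Op
  | add | sub | mul | div | mod | lt | eq

/-- `sub` is truncated; comparisons return `1` or `0`. -/
def Op.eval : Op → ℕ → ℕ → ℕ
  | .add, x, y => x + y
  | .sub, x, y => x - y
  | .mul, x, y => x * y
  | .div, x, y => x / y
  | .mod, x, y => x % y
  | .lt, x, y => if x < y then 1 else 0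
  | .eq, x, y => if x = y then 1 else 0

inductive Expr
  | lit (k : ℕ)
  | reg (i : ℕ)
  | mem (k : ℕ) (e : Expr)
  | op (o : Op) (e₁ e₂ : Expr)

namespace Expr

def eval (σ : State) : Expr → ℕ
  | lit k => k
  | reg i => σ.reg i
  | mem k e => σ.mem k (e.eval σ)
  | op o e₁ e₂ => o.eval (e₁.eval σ) (e₂.eval σ)

def cost : Expr → ℕ
  | lit _ => 1
  | reg _ => 1
  | mem _ e => e.cost + 1
  | op _ e₁ e₂ => e₁.cost + e₂.cost + 1

/-- The values of the expression and of all its subexpressions respect the word bound. -/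
def Fits (W : ℕ) (σ : State) : Expr → Prop
  | lit k => k ≤ W
  | reg i => σ.reg i ≤ W
  | mem k e => e.Fits W σ ∧ σ.mem k (e.eval σ) ≤ W
  | op o e₁ e₂ => e₁.Fits W σ ∧ e₂.Fits W σ ∧ o.eval (e₁.eval σ) (e₂.eval σ) ≤ W

end Expr

/-- `set i e` writes `e` to register `i`; `store k e₁ e₂` writes `e₂` to cell `e₁` of array `k`;
the conditions of `ite` and `loop` (a while loop) are true when nonzero. -/
inductive Program
  | skip
  | set (i : ℕ) (e : Expr)
  | store (k : ℕ) (e₁ e₂ : Expr)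
  | seq (p q : Program)
  | ite (e : Expr) (p q : Program)
  | loop (e : Expr) (p : Program)

def State.setReg (σ : State) (i x : ℕ) : State :=
  { σ with reg := Function.update σ.reg i x }

def State.setMem (σ : State) (k j x : ℕ) : State :=
  { σ with mem := Function.update σ.mem k (Function.update (σ.mem k) j x) }

/-- `Exec W p σ T σ'`: with word bound `W`, the program `p` started in the state `σ` halts after
exactly `T` steps in the state `σ'`. -/
inductive Exec (W : ℕ) : Program → State → ℕ → State → Prop
  | skip (σ : State) : Exec W .skip σ 1 σ
  | set (σ : State) (i : ℕ) (e : Expr) (h : e.Fits W σ) :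
      Exec W (.set i e) σ (e.cost + 1) (σ.setReg i (e.eval σ))
  | store (σ : State) (k : ℕ) (e₁ e₂ : Expr) (h₁ : e₁.Fits W σ) (h₂ : e₂.Fits W σ) :
      Exec W (.store k e₁ e₂) σ (e₁.cost + e₂.cost + 1) (σ.setMem k (e₁.eval σ) (e₂.eval σ))
  | seq {p q : Program} {σ σ₁ σ₂ : State} {T₁ T₂ : ℕ} (h₁ : Exec W p σ T₁ σ₁)
      (h₂ : Exec W q σ₁ T₂ σ₂) : Exec W (.seq p q) σ (T₁ + T₂ + 1) σ₂
  | ite_true {e : Expr} {p q : Program} {σ σ' : State} {T : ℕ} (he : e.Fits W σ)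
      (hc : e.eval σ ≠ 0) (h : Exec W p σ T σ') : Exec W (.ite e p q) σ (e.cost + T + 1) σ'
  | ite_false {e : Expr} {p q : Program} {σ σ' : State} {T : ℕ} (he : e.Fits W σ)
      (hc : e.eval σ = 0) (h : Exec W q σ T σ') : Exec W (.ite e p q) σ (e.cost + T + 1) σ'
  | loop_done {e : Expr} {p : Program} {σ : State} (he : e.Fits W σ) (hc : e.eval σ = 0) :
      Exec W (.loop e p) σ (e.cost + 1) σ
  | loop_step {e : Expr} {p : Program} {σ σ₁ σ₂ : State} {T₁ T₂ : ℕ} (he : e.Fits W σ)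
      (hc : e.eval σ ≠ 0) (h₁ : Exec W p σ T₁ σ₁) (h₂ : Exec W (.loop e p) σ₁ T₂ σ₂) :
      Exec W (.loop e p) σ (e.cost + T₁ + T₂ + 1) σ₂

/-- The number of a dart: `2 a` for the tail end of the arc `a`, and `2 a + 1` for its head end. -/
def dartIndex {m : ℕ} (d : Fin m × Bool) : ℕ := 2 * (d.1 : ℕ) + if d.2 then 0 else 1

/-- The state `σ` holds the input `(G, s, t, c)` and is zero elsewhere. Registers `0` to `4` contain
the number `n` of vertices, the number `m` of arcs, `s`, `t` and `c`. Arrays `0` and `1` contain the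
tails and heads of the arcs; arrays `2` and `3` contain the next dart in counterclockwise and in
clockwise order around the vertex, for each dart; array `4` contains, for each vertex, some dart at
that vertex, or `2 m` if the vertex is isolated. -/
structure IsInput {n m : ℕ} (G : EmbeddedDigraph (Fin n) (Fin m)) (s t c : Fin n) (σ : State) :
    Prop where
  reg_n : σ.reg 0 = n
  reg_m : σ.reg 1 = m
  reg_s : σ.reg 2 = s
  reg_t : σ.reg 3 = t
  reg_c : σ.reg 4 = c
  reg_zero : ∀ i, 5 ≤ i → σ.reg i = 0
  src : ∀ a : Fin m, σ.mem 0 a = G.src a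
  src_zero : ∀ j, m ≤ j → σ.mem 0 j = 0
  tgt : ∀ a : Fin m, σ.mem 1 a = G.tgt a
  tgt_zero : ∀ j, m ≤ j → σ.mem 1 j = 0
  next : ∀ d, σ.mem 2 (dartIndex d) = dartIndex (G.rot d)
  next_zero : ∀ j, 2 * m ≤ j → σ.mem 2 j = 0
  prev : ∀ d, σ.mem 3 (dartIndex d) = dartIndex (G.rot.symm d)
  prev_zero : ∀ j, 2 * m ≤ j → σ.mem 3 j = 0
  first : ∀ v : Fin n, (∃ d, G.vert d = v) → ∃ d, G.vert d = v ∧ σ.mem 4 v = dartIndex d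
  first_isolated : ∀ v : Fin n, (¬ ∃ d, G.vert d = v) → σ.mem 4 v = 2 * m
  first_zero : ∀ j, n ≤ j → σ.mem 4 j = 0
  mem_zero : ∀ k j, 5 ≤ k → σ.mem k j = 0

/-- Register `i` contains the length of the list `l` of arcs, and array `k` its entries. -/
def Holds {m : ℕ} (σ : State) (i k : ℕ) (l : List (Fin m)) : Prop :=
  σ.reg i = l.length ∧ ∀ (j : ℕ) (hj : j < l.length), σ.mem k j = (l[j] : ℕ)

end RAM

/-!
Homology modulo 2 replaces the Jordan curve theorem: by Euler's formula, every circulation modulo 2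
on the arcs of a plane rotation system is the coboundary of a function on the faces. For a closed
curve this function tells its two sides apart.

The arcs of a cubic strongly connected component `C` on its outer face form a directed cycle, since
no cycle is clockwise. A vertex of this cycle has only one further arc, so it is not both an
entrance and an exit, and a path from the source to an entrance never meets a path from an exit to
the sink, as `C` is strongly connected. Two entrances therefore do not separate two exits on the
cycle: both exits are joined to the sink without crossing the closed curve through the source and
the two entrances. So we may cut the cycle at the last exit before some entrance. A path `P` through
`C` from an entrance to an exit starts with an arc of the cycle; let `L` be the stretch of the cycle
between its ends. The left side of `P` then lies outside the closed curve `P + L` all along, hence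
an arc of `P` on the outer face that is not in `L` would have the outside on both of its sides. Thus
no useful path uses an arc between the last exit and the entrance.

In linear time, four graph searches determine `C`, its entrances and its exits. Following the cycle
from any exit to the first entrance, and from there back to the start, passes the last exit before
that entrance.
-/

namespace EmbeddedDigraph

variable {V A : Type*} {G : EmbeddedDigraph V A} {d d' : A × Bool}

@[simp] lemma flip_mk (a : A) (b : Bool) : flip (a, b) = (a, !b) := rfl

@[simp] lemma flip_fst (d : A × Bool) : (flip d).1 = d.1 := rfl

@[simp] lemma flip_flip (d : A × Bool) : flip (flip d) = d := flip.left_inv d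

lemma faceNext_flip (d : A × Bool) : G.faceNext (flip d) = G.rot.symm d := by
  simp [faceNext]

@[simp] lemma vert_true (a : A) : G.vert (a, true) = G.src a := rfl

@[simp] lemma vert_false (a : A) : G.vert (a, false) = G.tgt a := rfl

/-! ### Orbits of the rotation -/

section Orbits

lemma apply_eq_of_sameCycle {α β : Type*} {σ : Equiv.Perm α} {f : α → β}
    (hf : ∀ a, f (σ a) = f a) {a b : α} (h : σ.SameCycle a b) : f a = f b := by
  have zpow_invariant : ∀ (i : ℤ) (a : α), f ((σ ^ i) a) = f a := by
    intro i
    induction i with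
    | zero => exact fun _ => rfl
    | succ i ih => intro a; rw [zpow_add_one, Equiv.Perm.mul_apply, ih, hf]
    | pred i ih =>
      intro a
      rw [zpow_sub_one, Equiv.Perm.mul_apply, ih, ← hf, Equiv.Perm.inv_def,
        Equiv.apply_symm_apply]
  obtain ⟨i, rfl⟩ := h
  exact (zpow_invariant i a).symm

lemma quot_mk_eq_iff_sameCycle {α : Type*} (σ : Equiv.Perm α) {a b : α} :
    Quot.mk (fun a b => b = σ a) a = Quot.mk _ b ↔ σ.SameCycle a b := by
  refine ⟨fun h => ?_, apply_eq_of_sameCycle fun a =>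
    (Quot.sound (r := fun a b => b = σ a) rfl).symm⟩
  refine (Equiv.Perm.SameCycle.equivalence σ).eqvGen_iff.1
    (Relation.EqvGen.mono (p := σ.SameCycle) ?_ _ _ (Quot.eqvGen_exact h))
  rintro a _ rfl
  exact Equiv.Perm.sameCycle_apply_right.2 (.refl _ _)

lemma IsPlane.vert_rot (hG : G.IsPlane) (d : A × Bool) : G.vert (G.rot d) = G.vert d :=
  ((hG.rot_sameCycle _ _).1 (Equiv.Perm.sameCycle_apply_right.2 (.refl _ _))).symm

lemma IsPlane.vert_rot_symm (hG : G.IsPlane) (d : A × Bool) :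
    G.vert (G.rot.symm d) = G.vert d := by
  rw [← hG.vert_rot (G.rot.symm d), Equiv.apply_symm_apply]

lemma IsPlane.apply_eq_of_vert_eq {β : Type*} (hG : G.IsPlane) {f : A × Bool → β}
    (hf : ∀ d, G.vert d = G.vert d' → f (G.rot d) = f d) (hd : G.vert d = G.vert d') :
    f d = f d' := by
  classical
  have h := apply_eq_of_sameCycle (f := fun d => if G.vert d = G.vert d' then some (f d) else none)
    (fun d => by rw [hG.vert_rot]; split_ifs with h <;> simp [hf, h]) ((hG.rot_sameCycle d d').2 hd)
  simpa [hd] using h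

end Orbits

/-! ### Connectedness -/

section Connected

lemma Connected.symm (h : G.Connected d d') : G.Connected d' d := Relation.EqvGen.symm _ _ h

lemma Connected.trans {d'' : A × Bool} (h : G.Connected d d') (h' : G.Connected d' d'') :
    G.Connected d d'' := Relation.EqvGen.trans _ _ _ h h'

lemma connected_flip (d : A × Bool) : G.Connected d (flip d) := .rel _ _ (.inr rfl)

lemma connected_rot (d : A × Bool) : G.Connected d (G.rot d) := .rel _ _ (.inl rfl)

lemma connected_faceNext (d : A × Bool) : G.Connected d (G.faceNext d) := by
  refine (connected_flip d).trans (Connected.symm ?_)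
  simpa [faceNext] using connected_rot (G := G) (G.rot.symm (flip d))

lemma Connected.apply_eq {β : Type*} {f : A × Bool → β} (hrot : ∀ d, f (G.rot d) = f d)
    (hflip : ∀ d, f (flip d) = f d) (h : G.Connected d d') : f d = f d' := by
  induction h with
  | rel d d' h =>
    rcases h with rfl | rfl
    exacts [(hrot _).symm, (hflip _).symm]
  | refl => rfl
  | symm _ _ _ ih => exact ih.symm
  | trans _ _ _ _ _ ih₁ ih₂ => exact ih₁.trans ih₂

lemma IsPlane.connected_of_vert_eq (hG : G.IsPlane) (h : G.vert d = G.vert d') :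
    G.Connected d d' := by
  refine (hG.apply_eq_of_vert_eq (f := fun x => G.Connected x d') (fun x _ => ?_) h).mpr (.refl _)
  exact propext ⟨(connected_rot x).trans, (connected_rot x).symm.trans⟩

end Connected

/-! ### Potentials of circulations -/

section Incidence

open Matrix

variable {X : Type*} [DecidableEq X] (q : A × Bool → X)

/-- The incidence matrix over `ZMod 2` between the arcs and the labels of the darts; an arc with
the label `x` at both ends contributes `0` to the column of `x`. It is used with the vertices and
with the faces of a drawing as labels. -/
def incidence : Matrix A X (ZMod 2) :=
  fun a x => ∑ b, if q (a, b) = x then 1 else 0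

lemma incidence_mulVec [Fintype X] (φ : X → ZMod 2) (d : A × Bool) :
    (incidence q *ᵥ φ) d.1 = φ (q d) + φ (q (flip d)) := by
  rcases d with ⟨a, _ | _⟩ <;>
    simp [mulVec, dotProduct, incidence, -Finset.sum_boole, add_mul,
      Finset.sum_add_distrib, add_comm]

lemma incidence_transpose_mulVec [Fintype A] (h : A → ZMod 2) (x : X) :
    ((incidence q)ᵀ *ᵥ h) x = ∑ d, if q d = x then h d.1 else 0 := by
  simp [mulVec, dotProduct, incidence, -Finset.sum_boole, add_mul,
    Fintype.sum_prod_type]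

variable {q} {Y : Type*} [DecidableEq Y] {r : A × Bool → Y}

lemma incidence_transpose_mulVec_incidence_mulVec [Fintype A] [Fintype Y]
    (hq : ∀ d, q (G.rot d) = q d)
    (hr : ∀ d, r (G.faceNext d) = r d) (φ : Y → ZMod 2) :
    (incidence q)ᵀ *ᵥ (incidence r *ᵥ φ) = 0 := by
  funext x
  have reindex : ∑ d, (if q d = x then φ (r (flip d)) else 0) =
      ∑ d, if q d = x then φ (r d) else 0 := by
    rw [← Equiv.sum_comp G.rot]
    refine Finset.sum_congr rfl fun d _ => ?_
    rw [hq, ← hr (flip (G.rot d)), faceNext_flip, Equiv.symm_apply_apply]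
  rw [incidence_transpose_mulVec, Pi.zero_apply]
  simp only [incidence_mulVec, ite_add_zero, Finset.sum_add_distrib, reindex,
    CharTwo.add_self_eq_zero]

variable [Fintype X]

lemma finrank_ker_incidence_le [Finite A] (hq : Function.Surjective q)
    (hrot : ∀ φ : X → ZMod 2, (∀ d, φ (q (flip d)) = φ (q d)) → ∀ d, φ (q (G.rot d)) = φ (q d)) :
    Module.finrank (ZMod 2) (incidence q).mulVecLin.ker ≤ Nat.card (Quot G.DartAdj) := by
  have : Finite (Quot G.DartAdj) := Quot.finite _
  have := Fintype.ofFinite (Quot G.DartAdj)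
  let restrict : (incidence q).mulVecLin.ker →ₗ[ZMod 2] (Quot G.DartAdj → ZMod 2) :=
    (LinearMap.funLeft (ZMod 2) (ZMod 2) fun c : Quot G.DartAdj => q c.out).comp
      (Submodule.subtype _)
  have restrict_injective : Function.Injective restrict := by
    rw [← LinearMap.ker_eq_bot, LinearMap.ker_eq_bot']
    rintro ⟨φ, hφ⟩ h0
    have hflip (d : A × Bool) : φ (q (flip d)) = φ (q d) := by
      rw [eq_comm, ← CharTwo.add_eq_zero, ← incidence_mulVec]
      exact congrFun hφ d.1
    suffices φ = 0 by simpa using this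
    funext x
    obtain ⟨d, rfl⟩ := hq x
    have hconn : G.Connected d (Quot.mk G.DartAdj d).out :=
      Quot.eqvGen_exact (Quot.out_eq _).symm
    exact (hconn.apply_eq (f := fun d => φ (q d)) (hrot φ hflip) hflip).trans (congrFun h0 _)
  simpa [Nat.card_eq_fintype_card] using
    LinearMap.finrank_le_finrank_of_injective restrict_injective

lemma card_le_rank_incidence_add [Finite A] (hq : Function.Surjective q)
    (hrot : ∀ φ : X → ZMod 2, (∀ d, φ (q (flip d)) = φ (q d)) → ∀ d, φ (q (G.rot d)) = φ (q d)) :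
    Fintype.card X ≤ (incidence q).rank + Nat.card (Quot G.DartAdj) := by
  have rank_nullity := LinearMap.finrank_range_add_finrank_ker (incidence q).mulVecLin
  rw [Module.finrank_fintype_fun_eq_card] at rank_nullity
  have := finrank_ker_incidence_le hq hrot
  rw [Matrix.rank]
  lia

/-- Exactness in the middle for a drawing of genus zero. The inclusion is elementary, and by
Euler's formula the dimensions agree. -/
lemma range_incidence_eq_ker [Fintype A] [Fintype Y] (hq : Function.Surjective q)
    (hr : Function.Surjective r)
    (hrot : ∀ d, q (G.rot d) = q d) (hface : ∀ d, r (G.faceNext d) = r d)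
    (euler : Fintype.card X + Fintype.card Y =
      Fintype.card A + 2 * Nat.card (Quot G.DartAdj)) :
    (incidence r).mulVecLin.range = (incidence q)ᵀ.mulVecLin.ker := by
  have card_vertices := card_le_rank_incidence_add (G := G) hq fun φ _ d => by rw [hrot]
  have card_faces := card_le_rank_incidence_add (G := G) hr fun φ hφ d => by
    rw [← hφ, ← hface, faceNext_flip, Equiv.symm_apply_apply]
  have rank_nullity := LinearMap.finrank_range_add_finrank_ker (incidence q)ᵀ.mulVecLin
  have rank_transpose := Matrix.rank_transpose (incidence q)
  refine Submodule.eq_of_le_of_finrank_le ?_ ?_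
  · rintro _ ⟨φ, rfl⟩
    exact incidence_transpose_mulVec_incidence_mulVec hrot hface φ
  · rw [Module.finrank_fintype_fun_eq_card] at rank_nullity
    simp only [Matrix.rank] at card_vertices card_faces rank_transpose
    lia

end Incidence

section Potential

open Matrix

variable {φ : A × Bool → ZMod 2} {h : A → ZMod 2}

/-- The boundary over `ZMod 2` of a chain of arcs: at every vertex, the sum over the attached
darts. -/
def divergence [Fintype A] [DecidableEq V] (G : EmbeddedDigraph V A) (h : A → ZMod 2) (v : V) :
    ZMod 2 :=
  ∑ d, if G.vert d = v then h d.1 else 0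

/-- `φ` is a potential of the chain `h` over `ZMod 2`: a function on the faces, given on the darts
to the left of which they lie, that changes by `h a` when the arc `a` is crossed. -/
structure IsPotential (G : EmbeddedDigraph V A) (φ : A × Bool → ZMod 2) (h : A → ZMod 2) :
    Prop where
  faceNext : ∀ d, φ (G.faceNext d) = φ d
  add_flip : ∀ d, φ d + φ (flip d) = h d.1

theorem IsPlane.exists_isPotential [Fintype A] [DecidableEq V] (hG : G.IsPlane)
    (hdiv : G.divergence h = 0) : ∃ φ, G.IsPotential φ h := by
  classical
  let vertexOf : A × Bool → Quot fun d d' => d' = G.rot d := Quot.mk _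
  let faceOf : A × Bool → Quot fun d d' => d' = G.faceNext d := Quot.mk _
  have vertexOf_rot (d : A × Bool) : vertexOf (G.rot d) = vertexOf d :=
    (Quot.sound (r := fun d d' => d' = G.rot d) rfl).symm
  have faceOf_faceNext (d : A × Bool) : faceOf (G.faceNext d) = faceOf d :=
    (Quot.sound (r := fun d d' => d' = G.faceNext d) rfl).symm
  have : Finite (Quot fun d d' => d' = G.rot d) := Quot.finite _
  have : Finite (Quot fun d d' => d' = G.faceNext d) := Quot.finite _
  have := Fintype.ofFinite (Quot fun d d' => d' = G.rot d)
  have := Fintype.ofFinite (Quot fun d d' => d' = G.faceNext d)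
  have h_mem_ker : h ∈ (incidence vertexOf)ᵀ.mulVecLin.ker := by
    rw [LinearMap.mem_ker]
    funext x
    obtain ⟨d, rfl⟩ := Quot.mk_surjective x
    rw [mulVecLin_apply, incidence_transpose_mulVec]
    simp only [vertexOf, quot_mk_eq_iff_sameCycle, hG.rot_sameCycle]
    exact congrFun hdiv _
  rw [← range_incidence_eq_ker Quot.mk_surjective Quot.mk_surjective vertexOf_rot faceOf_faceNext
    (by simpa only [Nat.card_eq_fintype_card] using hG.euler)] at h_mem_ker
  obtain ⟨φ, hφ⟩ := h_mem_ker
  refine ⟨fun d => φ (faceOf d), fun d => congrArg φ (faceOf_faceNext d), fun d => ?_⟩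
  rw [← incidence_mulVec, ← mulVecLin_apply, hφ]

lemma IsPotential.apply_flip (hφ : G.IsPotential φ h) (hd : h d.1 = 0) : φ (flip d) = φ d := by
  rw [eq_comm, ← CharTwo.add_eq_zero, hφ.add_flip, hd]

lemma IsPotential.apply_rot_symm (hφ : G.IsPotential φ h) (d : A × Bool) :
    φ (G.rot.symm d) = φ (flip d) := by
  rw [← faceNext_flip, hφ.faceNext]

lemma IsPotential.apply_flip_rot (hφ : G.IsPotential φ h) (d : A × Bool) :
    φ (flip (G.rot d)) = φ d := by
  rw [← hφ.apply_rot_symm, Equiv.symm_apply_apply]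

lemma IsPotential.apply_eq_of_vert_eq (hφ : G.IsPotential φ h) (hG : G.IsPlane)
    (h0 : ∀ d, G.vert d = G.vert d' → h d.1 = 0) (hd : G.vert d = G.vert d') : φ d = φ d' :=
  hG.apply_eq_of_vert_eq (fun d hd => by
    rw [← hφ.apply_flip (h0 _ ((hG.vert_rot d).trans hd)), hφ.apply_flip_rot]) hd

end Potential

section Walk

variable {u v w : V} {l l₁ l₂ : List A}

@[simp] lemma isWalk_nil : G.IsWalk u [] v ↔ u = v := Iff.rfl

@[simp] lemma isWalk_cons {a : A} :
    G.IsWalk u (a :: l) v ↔ G.src a = u ∧ G.IsWalk (G.tgt a) l v := Iff.rfl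

lemma isWalk_append : G.IsWalk u (l₁ ++ l₂) w ↔ ∃ v, G.IsWalk u l₁ v ∧ G.IsWalk v l₂ w := by
  induction l₁ generalizing u with
  | nil => simp
  | cons a l ih => simp [ih, and_assoc]

lemma IsWalk.append (h₁ : G.IsWalk u l₁ v) (h₂ : G.IsWalk v l₂ w) : G.IsWalk u (l₁ ++ l₂) w :=
  isWalk_append.2 ⟨v, h₁, h₂⟩

lemma IsWalk.unique (h₁ : G.IsWalk u l v) (h₂ : G.IsWalk u l w) : v = w := by
  induction l generalizing u with
  | nil => simp_all
  | cons a l ih => exact ih h₁.2 h₂.2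

lemma mem_support : w ∈ G.support u l ↔ w = u ∨ ∃ a ∈ l, G.tgt a = w := by
  simp [support]

lemma support_append : G.support u (l₁ ++ l₂) = G.support u l₁ ++ l₂.map G.tgt := by
  simp [support]

lemma support_cons (a : A) : G.support u (a :: l) = u :: G.support (G.tgt a) l := by
  simp [support]

lemma start_mem_support : u ∈ G.support u l := by simp [support]

lemma tgt_mem_support {a : A} (ha : a ∈ l) : G.tgt a ∈ G.support u l :=
  mem_support.2 (.inr ⟨a, ha, rfl⟩)

lemma IsWalk.mem_support_iff (h : G.IsWalk u l v) :
    w ∈ G.support u l ↔ w = v ∨ ∃ a ∈ l, G.src a = w := by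
  induction l generalizing u with
  | nil => simp_all [support]
  | cons a l ih =>
    rw [support_cons, List.mem_cons, ih h.2, ← h.1]
    simp only [List.mem_cons, exists_eq_or_imp, eq_comm (a := w) (b := G.src a)]
    tauto

lemma IsWalk.end_mem_support (h : G.IsWalk u l v) : v ∈ G.support u l :=
  h.mem_support_iff.2 (.inl rfl)

lemma IsWalk.src_mem_support (h : G.IsWalk u l v) {a : A} (ha : a ∈ l) :
    G.src a ∈ G.support u l :=
  h.mem_support_iff.2 (.inr ⟨a, ha, rfl⟩)

lemma IsWalk.vert_mem_support (h : G.IsWalk u l v) {d : A × Bool} (hd : d.1 ∈ l) :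
    G.vert d ∈ G.support u l := by
  obtain ⟨a, _ | _⟩ := d
  exacts [tgt_mem_support hd, h.src_mem_support hd]

lemma IsWalk.exists_tgt_eq_end (h : G.IsWalk u l v) (hne : u ≠ v) : ∃ a ∈ l, G.tgt a = v :=
  (mem_support.1 h.end_mem_support).resolve_left hne.symm

lemma IsWalk.exists_split_arc (h : G.IsWalk u l v) {a : A} (ha : a ∈ l) :
    ∃ l₁ l₂, l = l₁ ++ a :: l₂ ∧ G.IsWalk u l₁ (G.src a) ∧ G.IsWalk (G.tgt a) l₂ v := by
  obtain ⟨l₁, l₂, rfl⟩ := List.append_of_mem ha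
  obtain ⟨x, h₁, h₂⟩ := isWalk_append.1 h
  obtain rfl := h₂.1
  exact ⟨l₁, l₂, rfl, h₁, h₂.2⟩

lemma IsWalk.exists_split_first (P : V → Prop) (h : G.IsWalk u l v)
    (hw : ∃ w ∈ G.support u l, P w) :
    ∃ l₁ l₂ w, l = l₁ ++ l₂ ∧ G.IsWalk u l₁ w ∧ G.IsWalk w l₂ v ∧ P w ∧
      ∀ a ∈ l₁, ¬ P (G.src a) := by
  induction l generalizing u with
  | nil =>
    obtain ⟨w, hw, hP⟩ := hw
    obtain rfl : w = u := by simpa [support] using hw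
    exact ⟨[], [], w, rfl, rfl, h, hP, by simp⟩
  | cons a l ih =>
    by_cases hu : P u
    · exact ⟨[], a :: l, u, rfl, rfl, h, hu, by simp⟩
    obtain ⟨w, hw, hP⟩ := hw
    rw [support_cons, List.mem_cons] at hw
    rcases hw with rfl | hw
    · exact absurd hP hu
    · obtain ⟨l₁, l₂, x, rfl, h₁, h₂, hx, h₃⟩ := ih h.2 ⟨w, hw, hP⟩
      refine ⟨a :: l₁, l₂, x, rfl, ⟨h.1, h₁⟩, h₂, hx, ?_⟩
      simp only [List.mem_cons, forall_eq_or_imp, h.1]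
      exact ⟨hu, h₃⟩

lemma IsWalk.exists_split_of_mem (h : G.IsWalk u l v) (hw : w ∈ G.support u l) :
    ∃ l₁ l₂, l = l₁ ++ l₂ ∧ G.IsWalk u l₁ w ∧ G.IsWalk w l₂ v := by
  obtain ⟨l₁, l₂, _, hl, h₁, h₂, rfl, -⟩ := h.exists_split_first (· = w) ⟨w, hw, rfl⟩
  exact ⟨l₁, l₂, hl, h₁, h₂⟩

lemma IsWalk.exists_split_last (P : V → Prop) (h : G.IsWalk u l v)
    (hw : ∃ w ∈ G.support u l, P w) :
    ∃ l₁ l₂ w, l = l₁ ++ l₂ ∧ G.IsWalk u l₁ w ∧ G.IsWalk w l₂ v ∧ P w ∧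
      ∀ a ∈ l₂, ¬ P (G.tgt a) := by
  induction l generalizing u with
  | nil =>
    obtain ⟨w, hw, hP⟩ := hw
    obtain rfl : w = u := by simpa [support] using hw
    exact ⟨[], [], w, rfl, rfl, h, hP, by simp⟩
  | cons a l ih =>
    by_cases hl : ∃ w ∈ G.support (G.tgt a) l, P w
    · obtain ⟨l₁, l₂, x, rfl, h₁, h₂, hx, h₃⟩ := ih h.2 hl
      exact ⟨a :: l₁, l₂, x, rfl, ⟨h.1, h₁⟩, h₂, hx, h₃⟩
    · obtain ⟨w, hw, hP⟩ := hw
      rw [support_cons, List.mem_cons] at hw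
      rcases hw with rfl | hw
      · refine ⟨[], a :: l, w, rfl, rfl, h, hP, ?_⟩
        push Not at hl
        simp only [List.mem_cons, forall_eq_or_imp]
        exact ⟨hl _ start_mem_support, fun b hb => hl _ (tgt_mem_support hb)⟩
      · exact absurd ⟨w, hw, hP⟩ hl

lemma IsPath.start_notMem_map_tgt (h : G.IsPath u l v) : u ∉ l.map G.tgt :=
  (List.nodup_cons.1 h.2).1

lemma IsPath.nodup_map_tgt (h : G.IsPath u l v) : (l.map G.tgt).Nodup :=
  (List.nodup_cons.1 h.2).2

lemma IsPath.left_of_append (h : G.IsPath u (l₁ ++ l₂) w) (h₁ : G.IsWalk u l₁ v) :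
    G.IsPath u l₁ v := by
  have hnodup := h.2
  rw [support_append] at hnodup
  exact ⟨h₁, hnodup.of_append_left⟩

lemma IsPath.right_of_append (h : G.IsPath u (l₁ ++ l₂) w) (h₁ : G.IsWalk u l₁ v) :
    G.IsPath v l₂ w := by
  constructor
  · obtain ⟨x, h₂, h₃⟩ := isWalk_append.1 h.1
    rwa [h₁.unique h₂]
  · have hnodup := h.2
    rw [support_append, List.nodup_append] at hnodup
    exact List.nodup_cons.2 ⟨fun hv => hnodup.2.2 v h₁.end_mem_support v hv rfl, hnodup.2.1⟩

lemma IsPath.append (h₁ : G.IsPath u l₁ v) (h₂ : G.IsPath v l₂ w)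
    (h : ∀ x ∈ G.support u l₁, x ∈ G.support v l₂ → x = v) : G.IsPath u (l₁ ++ l₂) w := by
  refine ⟨h₁.1.append h₂.1, ?_⟩
  rw [support_append, List.nodup_append]
  refine ⟨h₁.2, h₂.nodup_map_tgt, ?_⟩
  rintro x hx _ hy rfl
  obtain rfl := h x hx (List.mem_cons_of_mem _ hy)
  exact h₂.start_notMem_map_tgt hy

lemma IsWalk.exists_path (h : G.IsWalk u l v) : ∃ l', G.IsPath u l' v ∧ l' ⊆ l := by
  induction l generalizing u with
  | nil => exact ⟨[], ⟨h, by simp [support]⟩, by simp⟩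
  | cons a l ih =>
    obtain ⟨l', hl', hsub⟩ := ih h.2
    by_cases hu : u ∈ G.support (G.tgt a) l'
    · obtain ⟨l₁, l₂, rfl, h₁, -⟩ := hl'.1.exists_split_of_mem hu
      refine ⟨l₂, hl'.right_of_append h₁, fun x hx => ?_⟩
      exact List.mem_cons_of_mem _ (hsub (List.mem_append_right _ hx))
    · refine ⟨a :: l', ⟨⟨h.1, hl'.1⟩, ?_⟩, List.cons_subset_cons _ hsub⟩
      rw [support_cons, List.nodup_cons]
      exact ⟨hu, hl'.2⟩

lemma IsPath.nodup (h : G.IsPath u l v) : l.Nodup := h.nodup_map_tgt.of_map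

lemma IsPath.tgt_ne_start (h : G.IsPath u l v) {a : A} (ha : a ∈ l) : G.tgt a ≠ u :=
  fun hu => h.start_notMem_map_tgt (hu ▸ List.mem_map_of_mem ha)

lemma IsPath.tgt_injOn (h : G.IsPath u l v) : Set.InjOn G.tgt {a | a ∈ l} :=
  fun _ ha _ hb hab => List.inj_on_of_nodup_map h.nodup_map_tgt ha hb hab

lemma IsPath.of_cons {a : A} (h : G.IsPath u (a :: l) v) : G.IsPath (G.tgt a) l v :=
  h.right_of_append (l₁ := [a]) ⟨h.1.1, rfl⟩

lemma IsPath.start_notMem_support {a : A} (h : G.IsPath u (a :: l) v) :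
    u ∉ G.support (G.tgt a) l := by
  have hnodup := h.2
  rw [support_cons] at hnodup
  exact (List.nodup_cons.1 hnodup).1

lemma IsPath.src_ne_end (h : G.IsPath u l v) {a : A} (ha : a ∈ l) : G.src a ≠ v := by
  obtain ⟨l₁, l₂, rfl, h₁, h₂⟩ := h.1.exists_split_arc ha
  exact fun hv => (h.right_of_append h₁).start_notMem_support (hv ▸ h₂.end_mem_support)

lemma IsPath.src_injOn (h : G.IsPath u l v) : Set.InjOn G.src {a | a ∈ l} := by
  intro a ha b hb hab
  induction l generalizing u with
  | nil => simp at ha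
  | cons c l ih =>
    have src_ne {x : A} (hx : x ∈ l) : G.src c ≠ G.src x := fun hcx =>
      h.start_notMem_support (h.1.1 ▸ hcx ▸ h.1.2.src_mem_support hx)
    rcases List.mem_cons.1 ha with rfl | ha' <;> rcases List.mem_cons.1 hb with rfl | hb'
    · rfl
    · exact absurd hab (src_ne hb')
    · exact absurd hab.symm (src_ne ha')
    · exact ih h.of_cons ha' hb'

lemma Reachable.trans (h₁ : G.Reachable u v) (h₂ : G.Reachable v w) : G.Reachable u w := by
  obtain ⟨l₁, h₁⟩ := h₁
  obtain ⟨l₂, h₂⟩ := h₂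
  exact ⟨_, h₁.append h₂⟩

lemma IsWalk.reachable_left (h : G.IsWalk u l v) (hw : w ∈ G.support u l) : G.Reachable u w := by
  obtain ⟨l₁, _, _, h₁, _⟩ := h.exists_split_of_mem hw
  exact ⟨_, h₁⟩

lemma IsWalk.reachable_right (h : G.IsWalk u l v) (hw : w ∈ G.support u l) : G.Reachable w v := by
  obtain ⟨_, l₂, _, _, h₂⟩ := h.exists_split_of_mem hw
  exact ⟨_, h₂⟩

lemma IsWalk.forall_mem_of_forall_succ (h : G.IsWalk u l v) {P : A → Prop}
    (hhead : ∀ a ∈ l.head?, P a)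
    (hsucc : ∀ a ∈ l, ∀ b ∈ l, G.src b = G.tgt a → P a → P b) : ∀ a ∈ l, P a := by
  induction l generalizing u with
  | nil => simp
  | cons a l ih =>
    have ha : P a := hhead a (by simp)
    refine List.forall_mem_cons.2 ⟨ha, ih h.2 (fun c hc => ?_) fun c hc d hd => ?_⟩
    · obtain ⟨l, rfl⟩ := List.head?_eq_some_iff.1 hc
      exact hsucc a (by simp) c (by simp) h.2.1 ha
    · exact hsucc c (by simp [hc]) d (by simp [hd])

lemma IsWalk.src_of_mem_head? (h : G.IsWalk u l v) {a : A} (ha : a ∈ l.head?) : G.src a = u := by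
  obtain ⟨l, rfl⟩ := List.head?_eq_some_iff.1 ha
  exact h.1

lemma IsWalk.exists_pred_of_closed (h : G.IsWalk u l u) {a : A} (ha : a ∈ l) :
    ∃ b ∈ l, G.tgt b = G.src a := by
  rcases mem_support.1 (h.src_mem_support ha) with hau | hpred
  · obtain ⟨l, c, rfl⟩ := (List.eq_nil_or_concat' l).resolve_left (List.ne_nil_of_mem ha)
    obtain ⟨w, -, hc⟩ := isWalk_append.1 h
    exact ⟨c, by simp, hc.2.trans hau.symm⟩
  · exact hpred

end Walk

/-! ### Strongly connected components -/

section StronglyConnected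

variable {C : Set V} {u v w : V} {l : List A}

lemma IsSCC.reachable (hC : G.IsSCC C) (hu : u ∈ C) (hv : v ∈ C) : G.Reachable u v := by
  obtain ⟨c, rfl⟩ := hC
  exact hu.2.trans hv.1

lemma IsSCC.mem_of_reachable (hC : G.IsSCC C) (hu : u ∈ C) (hv : v ∈ C) (h₁ : G.Reachable u w)
    (h₂ : G.Reachable w v) : w ∈ C := by
  obtain ⟨c, rfl⟩ := hC
  exact ⟨hu.1.trans h₁, h₂.trans hv.2⟩

lemma IsSCC.eq_of_mem (hC : G.IsSCC C) (hu : u ∈ C) :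
    C = {v | G.Reachable u v ∧ G.Reachable v u} := by
  ext v
  exact ⟨fun hv => ⟨hC.reachable hu hv, hC.reachable hv hu⟩,
    fun hv => hC.mem_of_reachable hu hu hv.1 hv.2⟩

lemma IsSCC.support_subset (hC : G.IsSCC C) (hu : u ∈ C) (hv : v ∈ C) (h : G.IsWalk u l v) :
    ∀ w ∈ G.support u l, w ∈ C :=
  fun _ hw => hC.mem_of_reachable hu hv (h.reachable_left hw) (h.reachable_right hw)

lemma IsSCC.mem_arcsOf (hC : G.IsSCC C) (hu : u ∈ C) (hv : v ∈ C) (h : G.IsWalk u l v) {a : A}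
    (ha : a ∈ l) : a ∈ G.arcsOf C :=
  ⟨hC.support_subset hu hv h _ (h.src_mem_support ha),
    hC.support_subset hu hv h _ (tgt_mem_support ha)⟩

end StronglyConnected

section Chain

variable {u v : V} {l l₁ l₂ : List A}

open Classical in
/-- The chain over `ZMod 2` of a list of arcs, with multiplicities. -/
noncomputable def chain (l : List A) (a : A) : ZMod 2 := l.count a

lemma chain_of_mem (h : l.Nodup) {a : A} (ha : a ∈ l) : chain l a = 1 := by
  classical
  simp [chain, List.count_eq_one_of_mem h ha]

lemma chain_of_notMem {a : A} (ha : a ∉ l) : chain l a = 0 := by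
  classical
  simp [chain, List.count_eq_zero_of_not_mem ha]

lemma chain_cons [DecidableEq A] (b : A) (l : List A) :
    chain (b :: l) = chain l + Pi.single b 1 := by
  funext a
  simp only [chain, List.count_cons, beq_iff_eq, Pi.add_apply, Pi.single_apply, Nat.cast_add,
    Nat.cast_ite, Nat.cast_one, Nat.cast_zero, eq_comm (a := a)]

variable [Fintype A] [DecidableEq V]

lemma divergence_add (h₁ h₂ : A → ZMod 2) :
    G.divergence (h₁ + h₂) = G.divergence h₁ + G.divergence h₂ := by
  funext x
  simp only [divergence, Pi.add_apply, ite_add_zero, Finset.sum_add_distrib]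

lemma divergence_single [DecidableEq A] (b : A) :
    G.divergence (Pi.single b 1) = Pi.single (G.src b) 1 + Pi.single (G.tgt b) 1 := by
  funext x
  rw [divergence, Fintype.sum_prod_type, Fintype.sum_eq_single b fun a hab => by simp [hab]]
  simp only [Pi.single_eq_same, Fintype.sum_bool, vert_true, vert_false, Pi.add_apply,
    Pi.single_apply, eq_comm (a := x)]
  congr!

lemma IsWalk.divergence_chain (h : G.IsWalk u l v) :
    G.divergence (chain l) = Pi.single u 1 + Pi.single v 1 := by
  classical
  induction l generalizing u with
  | nil =>
    obtain rfl := h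
    funext x
    simp [divergence, chain, CharTwo.add_self_eq_zero]
  | cons b l ih =>
    rw [chain_cons, divergence_add, ih h.2, divergence_single, h.1]
    have cancel := ZModModule.add_self (Pi.single (G.tgt b) 1 : V → ZMod 2)
    linear_combination cancel

lemma IsWalk.divergence_chain_closed (h : G.IsWalk u l u) : G.divergence (chain l) = 0 := by
  rw [h.divergence_chain, ZModModule.add_self]

lemma IsWalk.divergence_chain_add_chain (h₁ : G.IsWalk u l₁ v) (h₂ : G.IsWalk u l₂ v) :
    G.divergence (chain l₁ + chain l₂) = 0 := by
  rw [divergence_add, h₁.divergence_chain, h₂.divergence_chain, ZModModule.add_self]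

end Chain

/-! ### Cubic vertices -/

section Cubic

/-- The vertex `v` has degree three. -/
def IsCubicAt (G : EmbeddedDigraph V A) (v : V) : Prop := Nat.card {d // G.vert d = v} = 3

lemma IsPlane.isCycleOn_rot (hG : G.IsPlane) (v : V) : G.rot.IsCycleOn {d | G.vert d = v} := by
  refine ⟨⟨fun d hd => (hG.vert_rot d).trans hd, G.rot.injective.injOn, fun d hd =>
    ⟨G.rot.symm d, (hG.vert_rot_symm d).trans hd, by simp⟩⟩, fun d hd d' hd' => ?_⟩
  exact (hG.rot_sameCycle _ _).2 (hd.trans (Eq.symm hd'))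

lemma IsPlane.exists_isCycleOn_of_isCubicAt (hG : G.IsPlane) {v : V} (hv : G.IsCubicAt v) :
    ∃ S : Finset (A × Bool), S.card = 3 ∧ (∀ d, d ∈ S ↔ G.vert d = v) ∧ G.rot.IsCycleOn S := by
  have hcard : {d | G.vert d = v}.ncard = 3 := hv
  have hfinite := Set.finite_of_ncard_ne_zero (hcard.trans_ne (by decide))
  refine ⟨hfinite.toFinset, ?_, by simp, ?_⟩
  · rw [← hcard, Set.ncard_eq_toFinset_card _ hfinite]
  · rw [hfinite.coe_toFinset]
    exact hG.isCycleOn_rot v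

lemma IsPlane.rot_rot_of_isCubicAt (hG : G.IsPlane) (hd : G.IsCubicAt (G.vert d)) :
    G.rot (G.rot d) = G.rot.symm d := by
  obtain ⟨S, hcard, hmem, hS⟩ := hG.exists_isCycleOn_of_isCubicAt hd
  have hpow := hS.pow_card_apply ((hmem d).2 rfl)
  rw [hcard] at hpow
  exact G.rot.eq_symm_apply.2 hpow

lemma IsPlane.rot_ne_of_isCubicAt (hG : G.IsPlane) (hd : G.IsCubicAt (G.vert d)) :
    G.rot d ≠ d := by
  obtain ⟨S, hcard, hmem, hS⟩ := hG.exists_isCycleOn_of_isCubicAt hd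
  exact hS.apply_ne (Finset.one_lt_card_iff_nontrivial.1 (by simp [hcard])) ((hmem d).2 rfl)

lemma IsPlane.rot_symm_ne_of_isCubicAt (hG : G.IsPlane) (hd : G.IsCubicAt (G.vert d)) :
    G.rot.symm d ≠ d := fun h =>
  hG.rot_ne_of_isCubicAt hd (by nth_rewrite 1 [← h, Equiv.apply_symm_apply]; rfl)

lemma IsPlane.rot_symm_ne_rot_of_isCubicAt (hG : G.IsPlane) (hd : G.IsCubicAt (G.vert d)) :
    G.rot.symm d ≠ G.rot d := by
  rw [← hG.rot_rot_of_isCubicAt hd]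
  exact hG.rot_ne_of_isCubicAt (by rwa [hG.vert_rot])

lemma IsPlane.eq_or_eq_rot_or_eq_rot_symm (hG : G.IsPlane) (hd : G.IsCubicAt (G.vert d))
    (h : G.vert d' = G.vert d) : d' = d ∨ d' = G.rot d ∨ d' = G.rot.symm d := by
  obtain ⟨S, hcard, hmem, hS⟩ := hG.exists_isCycleOn_of_isCubicAt hd
  obtain ⟨n, hn, rfl⟩ := hS.exists_pow_eq ((hmem d).2 rfl) ((hmem d').2 h)
  rw [hcard] at hn
  interval_cases n
  · exact .inl rfl
  · exact .inr (.inl rfl)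
  · exact .inr (.inr (hG.rot_rot_of_isCubicAt hd))

lemma IsPotential.apply_true_eq_of_src_eq_tgt {φ : A × Bool → ZMod 2} {h : A → ZMod 2}
    (hφ : G.IsPotential φ h) (hG : G.IsPlane) {p q : A} (hpq : G.src q = G.tgt p)
    (hp : G.IsCubicAt (G.tgt p))
    (h0 : G.rot.symm (p, false) ≠ (q, true) → h (G.rot.symm (p, false)).1 = 0) :
    φ (p, true) = φ (q, true) := by
  have hleft : φ (G.rot.symm (p, false)) = φ (p, true) := hφ.apply_rot_symm _
  rcases hG.eq_or_eq_rot_or_eq_rot_symm (d := (p, false)) (d' := (q, true)) hp hpq with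
    hq | hq | hq
  · simp at hq
  · rw [← hleft, ← hφ.apply_flip (h0 ?_), ← hφ.apply_rot_symm, hq,
      ← hG.rot_rot_of_isCubicAt (d := (p, false)) hp, Equiv.symm_apply_apply]
    rw [hq]
    exact hG.rot_symm_ne_rot_of_isCubicAt hp
  · rw [hq, hleft]

end Cubic

/-! ### The unbounded face of a set of arcs -/

section Outside

variable {S : Set A}

lemma Outside.mono {S' : Set A} (hS : S' ⊆ S) (h : G.Outside S d) : G.Outside S' d := by
  induction h with
  | outer h => exact .outer h
  | face _ ih => exact .face ih
  | cross _ hd ih => exact .cross ih fun h => hd (hS h)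

lemma outside_faceNext_iff [Finite A] : G.Outside S (G.faceNext d) ↔ G.Outside S d := by
  refine ⟨fun h => ?_, .face⟩
  have hback : G.faceNext.SameCycle (G.faceNext d) d :=
    Equiv.Perm.sameCycle_apply_left.2 (.refl _ _)
  obtain ⟨n, hn⟩ := hback.exists_nat_pow_eq
  have hpow : ∀ n : ℕ, G.Outside S ((G.faceNext ^ n) (G.faceNext d)) := fun n => by
    induction n with
    | zero => exact h
    | succ n ih => exact pow_succ' G.faceNext n ▸ .face ih
  exact hn ▸ hpow n

lemma outside_rot_symm_iff [Finite A] :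
    G.Outside S (G.rot.symm d) ↔ G.Outside S (flip d) := by
  rw [← faceNext_flip, outside_faceNext_iff]

lemma outside_flip_rot_iff [Finite A] : G.Outside S (flip (G.rot d)) ↔ G.Outside S d := by
  rw [← outside_rot_symm_iff, Equiv.symm_apply_apply]

lemma outside_flip_iff (hd : d.1 ∉ S) : G.Outside S (flip d) ↔ G.Outside S d :=
  ⟨fun h => by simpa using h.cross (d := flip d) hd, fun h => h.cross hd⟩

lemma IsPlane.outside_iff_of_vert_eq [Finite A] (hG : G.IsPlane)
    (hS : ∀ d, G.vert d = G.vert d' → d.1 ∉ S) (hd : G.vert d = G.vert d') :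
    G.Outside S d ↔ G.Outside S d' :=
  Eq.to_iff <| hG.apply_eq_of_vert_eq (fun d hd => propext <| by
    rw [← outside_flip_iff (hS _ ((hG.vert_rot d).trans hd)), outside_flip_rot_iff]) hd

lemma IsPotential.apply_eq_of_outside {φ : A × Bool → ZMod 2} {h : A → ZMod 2}
    (hφ : G.IsPotential φ h) (hG : G.IsPlane) (hS : ∀ a ∉ S, h a = 0) (hd : G.Outside S d)
    (hd' : G.Outside S d') (hc : G.Connected d d') : φ d = φ d' := by
  have exists_outer : ∀ d, G.Outside S d → ∃ o ∈ G.outer, G.Connected d o ∧ φ d = φ o := by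
    intro d hd
    induction hd with
    | @outer d h => exact ⟨d, h, .refl _, rfl⟩
    | @face d _ ih =>
      obtain ⟨o, ho, hdo, hφo⟩ := ih
      exact ⟨o, ho, (connected_faceNext d).symm.trans hdo, (hφ.faceNext d).trans hφo⟩
    | @cross d _ hd ih =>
      obtain ⟨o, ho, hdo, hφo⟩ := ih
      exact ⟨o, ho, (connected_flip d).symm.trans hdo, (hφ.apply_flip (hS _ hd)).trans hφo⟩
  obtain ⟨o, ho, hdo, hφo⟩ := exists_outer d hd
  obtain ⟨o', ho', hdo', hφo'⟩ := exists_outer d' hd'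
  rw [hφo, hφo']
  exact apply_eq_of_sameCycle hφ.faceNext
    (hG.outer_unique o ho o' ho' (hdo.symm.trans (hc.trans hdo')))

lemma IsPlane.exists_outside [Finite A] (hG : G.IsPlane) {d : A × Bool} (hd : d.1 ∈ S) :
    ∃ d', d'.1 ∈ S ∧ G.Outside S d' := by
  by_contra! hno
  have hflip (d : A × Bool) : G.Outside S (flip d) = G.Outside S d :=
    propext ⟨fun h => by simpa using h.cross fun hd => hno _ hd h,
      fun h => h.cross fun hd => hno _ hd h⟩
  have hrot (d : A × Bool) : G.Outside S (G.rot d) = G.Outside S d := by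
    rw [← hflip (G.rot d), outside_flip_rot_iff]
  obtain ⟨o, ho, hc⟩ := hG.exists_outer d
  exact hno d hd ((hc.apply_eq hrot hflip).mpr (.outer ho))

end Outside

/-! ### Cubic strongly connected components -/

lemma IsPlane.connected_of_isWalk (hG : G.IsPlane) {u v : V} {l : List A} (h : G.IsWalk u l v)
    {d d' : A × Bool} (hd : G.vert d = u) (hd' : G.vert d' = v) : G.Connected d d' := by
  induction l generalizing u d with
  | nil => exact hG.connected_of_vert_eq (hd.trans ((isWalk_nil.1 h).trans hd'.symm))
  | cons a l ih =>
    refine (hG.connected_of_vert_eq (d' := (a, true)) (hd.trans h.1.symm)).trans ?_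
    exact (connected_flip _).trans (ih h.2 rfl)

/-- `C` is a strongly connected component with at least one arc of a plane directed graph without
clockwise cycles, and all vertices of `C` have degree three. The boundary of `C` is studied under
these assumptions, without reference to a source and a sink. -/
structure IsCubicComponent (G : EmbeddedDigraph V A) (C : Set V) : Prop where
  plane : G.IsPlane
  no_clockwise : ∀ l, ¬ G.IsClockwise l
  scc : G.IsSCC C
  nontrivial : (G.arcsOf C).Nonempty
  isCubicAt : ∀ v ∈ C, G.IsCubicAt v

lemma IsOutsideComponent.source_notMem {s t : V} {C : Set V} (hC : G.IsOutsideComponent s t C) :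
    s ∉ C := hC.source_outside.1

lemma IsOutsideComponent.isCubicComponent {s t : V} {C : Set V}
    (hC : G.IsOutsideComponent s t C) (hN : G.IsNormalNetwork s t) : G.IsCubicComponent C where
  plane := hN.plane
  no_clockwise := hN.no_clockwise
  scc := hC.scc
  nontrivial := hC.nontrivial
  isCubicAt v hv := hN.degree_three v (fun h => hC.source_notMem (h ▸ hv))
    (fun h => hC.sink_notMem (h ▸ hv))

namespace IsCubicComponent

variable {C : Set V} {v : V} {a b : A}

lemma exists_closed_walk (hC : G.IsCubicComponent C) (hv : v ∈ C) :
    ∃ l, l ≠ [] ∧ G.IsWalk v l v := by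
  obtain ⟨a, ha⟩ := hC.nontrivial
  obtain ⟨l₁, h₁⟩ := hC.scc.reachable hv ha.1
  obtain ⟨l₂, h₂⟩ := hC.scc.reachable ha.2 hv
  exact ⟨l₁ ++ a :: l₂, by simp, h₁.append ⟨rfl, h₂⟩⟩

lemma exists_tgt_eq (hC : G.IsCubicComponent C) (hv : v ∈ C) :
    ∃ a ∈ G.arcsOf C, G.tgt a = v := by
  obtain ⟨l, hl, h⟩ := hC.exists_closed_walk hv
  obtain ⟨l, a, rfl⟩ := (List.eq_nil_or_concat' l).resolve_left hl
  obtain ⟨w, -, ha⟩ := isWalk_append.1 h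
  exact ⟨a, hC.scc.mem_arcsOf hv hv h (by simp), ha.2⟩

lemma exists_src_eq (hC : G.IsCubicComponent C) (hv : v ∈ C) :
    ∃ a ∈ G.arcsOf C, G.src a = v := by
  obtain ⟨l, hl, h⟩ := hC.exists_closed_walk hv
  obtain ⟨a, l, rfl⟩ := List.exists_cons_of_ne_nil hl
  exact ⟨a, hC.scc.mem_arcsOf hv hv h (by simp), h.1⟩

lemma exists_src_iff (hC : G.IsCubicComponent C) {P : V → Prop} (hP : ∀ v, P v → v ∈ C) :
    (∃ a, a ∈ G.arcsOf C ∧ P (G.src a)) ↔ ∃ v, P v := by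
  refine ⟨fun ⟨a, _, ha⟩ => ⟨_, ha⟩, fun ⟨v, hv⟩ => ?_⟩
  obtain ⟨a, haC, rfl⟩ := hC.exists_src_eq (hP v hv)
  exact ⟨a, haC, hv⟩

lemma connected (hC : G.IsCubicComponent C) (hd : G.vert d ∈ C) (hd' : G.vert d' ∈ C) :
    G.Connected d d' := by
  obtain ⟨l, hl⟩ := hC.scc.reachable hd hd'
  exact hC.plane.connected_of_isWalk hl rfl rfl

lemma not_outside_true (hC : G.IsCubicComponent C) (ha : a ∈ G.arcsOf C) :
    ¬ G.Outside (G.arcsOf C) (a, true) := by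
  intro h
  obtain ⟨l, hl⟩ := hC.scc.reachable ha.2 ha.1
  obtain ⟨l, hl, -⟩ := hl.exists_path
  refine hC.no_clockwise (a :: l) ⟨⟨by simp, ⟨G.src a, rfl, hl.1⟩, hl.2⟩, a, by simp, ?_⟩
  refine h.mono fun b hb => ?_
  rcases List.mem_cons.1 hb with rfl | hb
  exacts [ha, hC.scc.mem_arcsOf ha.2 ha.1 hl.1 hb]

lemma mem_boundary_iff (hC : G.IsCubicComponent C) :
    a ∈ G.boundary C ↔ a ∈ G.arcsOf C ∧ G.Outside (G.arcsOf C) (a, false) := by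
  refine ⟨?_, fun ⟨ha, h⟩ => ⟨ha, false, h⟩⟩
  rintro ⟨ha, _ | _, h⟩
  exacts [⟨ha, h⟩, absurd h (hC.not_outside_true ha)]

lemma outside_false (hC : G.IsCubicComponent C) (ha : a ∈ G.boundary C) :
    G.Outside (G.arcsOf C) (a, false) := (hC.mem_boundary_iff.1 ha).2

lemma exists_eq_false_of_outside (hC : G.IsCubicComponent C) (hd : d.1 ∈ G.arcsOf C)
    (h : G.Outside (G.arcsOf C) d) : ∃ a ∈ G.boundary C, d = (a, false) := by
  obtain ⟨a, _ | _⟩ := d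
  exacts [⟨a, hC.mem_boundary_iff.2 ⟨hd, h⟩, rfl⟩, absurd h (hC.not_outside_true hd)]

variable [Finite A]

lemma boundary_nonempty (hC : G.IsCubicComponent C) : (G.boundary C).Nonempty := by
  obtain ⟨a, ha⟩ := hC.nontrivial
  obtain ⟨d, hd, hout⟩ := hC.plane.exists_outside (d := (a, true)) ha
  obtain ⟨b, hb, -⟩ := hC.exists_eq_false_of_outside hd hout
  exact ⟨b, hb⟩

lemma rot_of_tgt_eq (hC : G.IsCubicComponent C) (hb : b ∈ G.boundary C) (ha : a ∈ G.arcsOf C)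
    (hab : G.tgt a = G.tgt b) (hne : a ≠ b) : G.rot (a, false) = (b, false) := by
  rcases hC.plane.eq_or_eq_rot_or_eq_rot_symm (d := (b, false)) (d' := (a, false))
    (hC.isCubicAt _ hb.1.2) hab with h | h | h
  · exact absurd (congrArg Prod.fst h) hne
  · have hout := outside_flip_rot_iff.2 (hC.outside_false hb)
    rw [← h] at hout
    exact absurd hout (hC.not_outside_true ha)
  · exact (Equiv.eq_symm_apply _).1 h

lemma rot_of_src_eq (hC : G.IsCubicComponent C) (hb : b ∈ G.boundary C) (ha : a ∈ G.arcsOf C)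
    (hab : G.src a = G.src b) (hne : a ≠ b) : G.rot (b, true) = (a, true) := by
  rcases hC.plane.eq_or_eq_rot_or_eq_rot_symm (d := (b, true)) (d' := (a, true))
    (hC.isCubicAt _ hb.1.1) hab with h | h | h
  · exact absurd (congrArg Prod.fst h) hne
  · exact h.symm
  · have hout := (outside_rot_symm_iff (d := (b, true))).2 (hC.outside_false hb)
    rw [← h] at hout
    exact absurd hout (hC.not_outside_true ha)

lemma tgt_injOn_boundary (hC : G.IsCubicComponent C) : Set.InjOn G.tgt (G.boundary C) := by
  intro a ha b hb hab
  by_contra hne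
  refine hC.plane.rot_symm_ne_rot_of_isCubicAt (d := (a, false)) (hC.isCubicAt _ ha.1.2) ?_
  rw [Equiv.symm_apply_eq, hC.rot_of_tgt_eq hb ha.1 hab hne,
    hC.rot_of_tgt_eq ha hb.1 hab.symm (Ne.symm hne)]

lemma src_injOn_boundary (hC : G.IsCubicComponent C) : Set.InjOn G.src (G.boundary C) := by
  intro a ha b hb hab
  by_contra hne
  refine hC.plane.rot_symm_ne_rot_of_isCubicAt (d := (a, true)) (hC.isCubicAt _ ha.1.1) ?_
  rw [Equiv.symm_apply_eq, hC.rot_of_src_eq ha hb.1 hab.symm (Ne.symm hne),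
    hC.rot_of_src_eq hb ha.1 hab hne]

lemma exists_succ (hC : G.IsCubicComponent C) (hb : b ∈ G.boundary C) :
    ∃ b' ∈ G.boundary C, G.src b' = G.tgt b ∧ (G.rot (b, false) = (b', true) ∨
      (G.rot (b, false)).1 ∉ G.arcsOf C ∧ G.rot (G.rot (b, false)) = (b', true)) := by
  have next_mem {d : A × Bool} (hd : G.Outside (G.arcsOf C) d) (hv : G.vert d = G.tgt b)
      (hdC : (G.rot d).1 ∈ G.arcsOf C) :
      ∃ b' ∈ G.boundary C, G.src b' = G.tgt b ∧ G.rot d = (b', true) := by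
    obtain ⟨b', hb', h⟩ := hC.exists_eq_false_of_outside (by exact hdC)
      (outside_flip_rot_iff.2 hd)
    have hrot : G.rot d = (b', true) := flip.injective h
    exact ⟨b', hb', by rw [← hv, ← hC.plane.vert_rot, hrot, vert_true], hrot⟩
  by_cases hr : (G.rot (b, false)).1 ∈ G.arcsOf C
  · obtain ⟨b', hb', hsrc, h⟩ := next_mem (hC.outside_false hb) rfl hr
    exact ⟨b', hb', hsrc, .inl h⟩
  · obtain ⟨o, hoC, ho⟩ := hC.exists_src_eq hb.1.2
    have rot_rot_mem : (G.rot (G.rot (b, false))).1 ∈ G.arcsOf C := by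
      have hcubic := hC.isCubicAt _ hb.1.2
      rw [hC.plane.rot_rot_of_isCubicAt (d := (b, false)) hcubic]
      rcases hC.plane.eq_or_eq_rot_or_eq_rot_symm (d := (b, false)) (d' := (o, true)) hcubic ho
        with h | h | h
      · simp at h
      · exact absurd (h ▸ hoC) hr
      · exact h ▸ hoC
    obtain ⟨b', hb', hsrc, h⟩ := next_mem
      ((outside_flip_iff hr).1 (outside_flip_rot_iff.2 (hC.outside_false hb)))
      (hC.plane.vert_rot _) rot_rot_mem
    exact ⟨b', hb', hsrc, .inr ⟨hr, h⟩⟩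

lemma exists_bijective_succ (hC : G.IsCubicComponent C) :
    ∃ f : G.boundary C → G.boundary C, Function.Bijective f ∧
      ∀ b, G.src (f b : A) = G.tgt (b : A) := by
  choose! f hf hsrc _ using fun b (hb : b ∈ G.boundary C) => hC.exists_succ hb
  refine ⟨fun b => ⟨f b, hf b b.2⟩, ?_, fun b => hsrc b b.2⟩
  rw [← Finite.injective_iff_bijective]
  intro a b hab
  refine Subtype.ext (hC.tgt_injOn_boundary a.2 b.2 ?_)
  rw [← hsrc a a.2, ← hsrc b b.2]
  exact congrArg (fun c : G.boundary C => G.src c) hab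

lemma exists_pred (hC : G.IsCubicComponent C) (hb : b ∈ G.boundary C) :
    ∃ a ∈ G.boundary C, G.tgt a = G.src b := by
  obtain ⟨f, hf, hsrc⟩ := hC.exists_bijective_succ
  obtain ⟨a, ha⟩ := hf.2 ⟨b, hb⟩
  exact ⟨a, a.2, by rw [← hsrc a, ha]⟩

lemma rot_of_src_eq_tgt (hC : G.IsCubicComponent C) (ha : a ∈ G.boundary C)
    (hb : b ∈ G.boundary C) (hab : G.src b = G.tgt a) :
    G.rot (a, false) = (b, true) ∨
      (G.rot (a, false)).1 ∉ G.arcsOf C ∧ G.rot (G.rot (a, false)) = (b, true) := by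
  obtain ⟨b', hb', hsrc, hrot⟩ := hC.exists_succ ha
  rwa [hC.src_injOn_boundary hb hb' (hab.trans hsrc.symm)]

lemma exists_rot_of_outside (hC : G.IsCubicComponent C) (hd : G.Outside (G.arcsOf C) d)
    (hdC : d.1 ∉ G.arcsOf C) (hv : G.vert d ∈ C) :
    ∃ a ∈ G.boundary C, ∃ b ∈ G.boundary C, G.rot.symm d = (a, false) ∧ G.rot d = (b, true) := by
  have eq_rot_or (d' : A × Bool) (hd' : d'.1 ∈ G.arcsOf C) (h : G.vert d' = G.vert d) :
      d' = G.rot d ∨ d' = G.rot.symm d :=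
    (hC.plane.eq_or_eq_rot_or_eq_rot_symm (hC.isCubicAt _ hv) h).resolve_left
      fun h => hdC (h ▸ hd')
  have outside_rot := (outside_flip_rot_iff (S := G.arcsOf C)).2 hd
  have outside_rot_symm :=
    (outside_rot_symm_iff (S := G.arcsOf C)).2 ((outside_flip_iff hdC).2 hd)
  obtain ⟨i, hiC, hi⟩ := hC.exists_tgt_eq hv
  obtain ⟨o, hoC, ho⟩ := hC.exists_src_eq hv
  have hi' : (i, false) = G.rot.symm d := (eq_rot_or (i, false) hiC hi).resolve_left fun h =>
    hC.not_outside_true hiC (by rwa [← h] at outside_rot)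
  have ho' : (o, true) = G.rot d := (eq_rot_or (o, true) hoC ho).resolve_right fun h => by
    simp [← hi'] at h
  rw [← hi'] at outside_rot_symm
  rw [← ho'] at outside_rot
  exact ⟨i, hC.mem_boundary_iff.2 ⟨hiC, outside_rot_symm⟩, o,
    hC.mem_boundary_iff.2 ⟨hoC, outside_rot⟩, hi'.symm, ho'.symm⟩

end IsCubicComponent

variable {s t : V} {C : Set V}

/-! ### Entrances and exits -/

lemma IsEntrance.exists_path {v : V} (h : G.IsEntrance s C v) :
    ∃ l, G.IsPath s l v ∧ ∀ a ∈ l, G.src a ∉ C := by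
  obtain ⟨-, l, hl, h⟩ := h
  exact ⟨l, hl, fun a ha hC => hl.src_ne_end ha (h _ (hl.1.src_mem_support ha) hC)⟩

lemma IsExit.exists_path {v : V} (h : G.IsExit t C v) :
    ∃ l, G.IsPath v l t ∧ ∀ a ∈ l, G.tgt a ∉ C := by
  obtain ⟨-, l, hl, h⟩ := h
  exact ⟨l, hl, fun a ha hC => hl.tgt_ne_start ha (h _ (tgt_mem_support ha) hC)⟩

lemma isEntrance_of_isWalk {v : V} {l : List A} (hv : v ∈ C) (hl : G.IsWalk s l v)
    (h : ∀ a ∈ l, G.src a ∉ C) : G.IsEntrance s C v := by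
  obtain ⟨l', hl', hsub⟩ := hl.exists_path
  refine ⟨hv, l', hl', fun w hw hwC => ?_⟩
  rcases hl'.1.mem_support_iff.1 hw with rfl | ⟨a, ha, rfl⟩
  · rfl
  · exact absurd hwC (h a (hsub ha))

lemma isExit_of_isWalk {v : V} {l : List A} (hv : v ∈ C) (hl : G.IsWalk v l t)
    (h : ∀ a ∈ l, G.tgt a ∉ C) : G.IsExit t C v := by
  obtain ⟨l', hl', hsub⟩ := hl.exists_path
  refine ⟨hv, l', hl', fun w hw hwC => ?_⟩
  rcases mem_support.1 hw with rfl | ⟨a, ha, rfl⟩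
  · rfl
  · exact absurd hwC (h a (hsub ha))

lemma notMem_arcsOf_of_vert_notMem {d : A × Bool} (hd : G.vert d ∉ C) : d.1 ∉ G.arcsOf C := by
  obtain ⟨a, _ | _⟩ := d
  exacts [fun h => hd h.2, fun h => hd h.1]

section OutsideWalk

variable [Finite A]

lemma IsPlane.outside_arcsOf_iff_of_vert_eq (hG : G.IsPlane) {d d' : A × Bool}
    (hd' : G.vert d' ∉ C) (h : G.vert d = G.vert d') :
    G.Outside (G.arcsOf C) d ↔ G.Outside (G.arcsOf C) d' :=
  hG.outside_iff_of_vert_eq (fun _ h => notMem_arcsOf_of_vert_notMem (h ▸ hd')) h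

lemma IsPlane.outside_of_isWalk_of_inUnboundedFace (hG : G.IsPlane)
    (hs : G.InUnboundedFace C s) {v : V} {l : List A} (hl : G.IsWalk s l v)
    (hlC : ∀ a ∈ l, G.src a ∉ C) {a : A} (ha : a ∈ l) (b : Bool) :
    G.Outside (G.arcsOf C) (a, b) := by
  obtain ⟨hsC, d, rfl, hd⟩ := hs
  have outside_false {a : A} (ha : a ∈ l) (h : G.Outside (G.arcsOf C) (a, true)) :
      G.Outside (G.arcsOf C) (a, false) :=
    (outside_flip_iff (d := (a, true)) fun h => hlC a ha h.1).2 h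
  have outside_true : ∀ a ∈ l, G.Outside (G.arcsOf C) (a, true) := by
    refine hl.forall_mem_of_forall_succ (fun a h => ?_) fun a ha b hb hab h => ?_
    · exact (hG.outside_arcsOf_iff_of_vert_eq (d := (a, true)) hsC (hl.src_of_mem_head? h)).2 hd
    · exact (hG.outside_arcsOf_iff_of_vert_eq (d := (a, false)) (d' := (b, true)) (hlC b hb)
        hab.symm).1 (outside_false ha h)
  cases b
  exacts [outside_false ha (outside_true a ha), outside_true a ha]

lemma IsPlane.outside_of_isWalk_to_outer (hG : G.IsPlane)
    (ht : (∃ d, G.vert d = t) → ∃ d ∈ G.outer, G.vert d = t) {u : V} {l : List A}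
    (hl : G.IsWalk u l t) (hlC : ∀ a ∈ l, G.tgt a ∉ C) {a : A} (ha : a ∈ l) (b : Bool) :
    G.Outside (G.arcsOf C) (a, b) := by
  induction l generalizing u a b with
  | nil => simp at ha
  | cons c l ih =>
    have hlC' : ∀ a ∈ l, G.tgt a ∉ C := fun a ha => hlC a (by simp [ha])
    have hcC : G.tgt c ∉ C := hlC c (by simp)
    rcases List.mem_cons.1 ha with rfl | ha
    · have outside_false : G.Outside (G.arcsOf C) (a, false) := by
        cases l with
        | nil =>
          have hat : G.tgt a = t := hl.2
          obtain ⟨d, hd, hdt⟩ := ht ⟨(a, false), hat⟩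
          exact (hG.outside_arcsOf_iff_of_vert_eq (d' := (a, false)) hcC
            (hdt.trans hat.symm)).1 (.outer hd)
        | cons c l =>
          exact (hG.outside_arcsOf_iff_of_vert_eq (d := (c, true)) (d' := (a, false)) hcC hl.2.1).1
            (ih hl.2 hlC' (a := c) (by simp) true)
      cases b
      · exact outside_false
      · exact (outside_flip_iff (d := (a, false)) fun h => hcC h.2).2 outside_false
    · exact ih hl.2 hlC' ha b

lemma IsCubicComponent.exists_boundary_of_outside {d : A × Bool} (hC : G.IsCubicComponent C)
    (hd : G.Outside (G.arcsOf C) d) (hdC : d.1 ∉ G.arcsOf C) (hv : G.vert d ∈ C) :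
    ∃ a ∈ G.boundary C, ∃ b ∈ G.boundary C, G.tgt a = G.vert d ∧ G.src b = G.vert d ∧
      ∀ c, G.src c = G.vert d → (c, true) ≠ d → c = b := by
  obtain ⟨a, ha, b, hb, hrs, hr⟩ := hC.exists_rot_of_outside hd hdC hv
  have hva := hC.plane.vert_rot_symm d
  have hvb := hC.plane.vert_rot d
  rw [hrs] at hva
  rw [hr] at hvb
  refine ⟨a, ha, b, hb, hva, hvb, fun c hc hne => ?_⟩
  rcases hC.plane.eq_or_eq_rot_or_eq_rot_symm (d := d) (d' := (c, true)) (hC.isCubicAt _ hv) hc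
    with h | h | h
  · exact absurd h hne
  · exact congrArg Prod.fst (h.trans hr)
  · simp [hrs] at h

end OutsideWalk

namespace IsOutsideComponent

variable [Finite A] {v : V}

lemma exists_arc_of_isEntrance (hC : G.IsOutsideComponent s t C)
    (hN : G.IsNormalNetwork s t) (h : G.IsEntrance s C v) :
    ∃ r ∉ G.arcsOf C, G.tgt r = v ∧ G.Outside (G.arcsOf C) (r, false) := by
  obtain ⟨l, hl, hlC⟩ := h.exists_path
  have hne : l ≠ [] := by
    rintro rfl
    exact hC.source_notMem (isWalk_nil.1 hl.1 ▸ h.1)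
  obtain ⟨l, r, rfl⟩ := (List.eq_nil_or_concat' l).resolve_left hne
  obtain ⟨w, -, hr⟩ := isWalk_append.1 hl.1
  exact ⟨r, fun h => hlC r (by simp) h.1, hr.2,
    hN.plane.outside_of_isWalk_of_inUnboundedFace hC.source_outside hl.1 hlC (by simp) _⟩

lemma exists_arc_of_isWalk (hC : G.IsOutsideComponent s t C)
    (hN : G.IsNormalNetwork s t) (hv : v ∈ C) {l : List A} (hl : G.IsWalk v l t)
    (hlC : ∀ a ∈ l, G.tgt a ∉ C) :
    ∃ r ∈ l, r ∉ G.arcsOf C ∧ G.src r = v ∧ G.Outside (G.arcsOf C) (r, true) := by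
  cases l with
  | nil => exact absurd (isWalk_nil.1 hl ▸ hv) hC.sink_notMem
  | cons r l =>
    exact ⟨r, by simp, fun h => hlC r (by simp) h.2, hl.1,
      hN.plane.outside_of_isWalk_to_outer hN.sink_outer hl hlC (by simp) _⟩

lemma exists_boundary_of_isEntrance (hC : G.IsOutsideComponent s t C)
    (hN : G.IsNormalNetwork s t) (h : G.IsEntrance s C v) :
    ∃ a ∈ G.boundary C, ∃ b ∈ G.boundary C, G.tgt a = v ∧ G.src b = v ∧
      ∀ c, G.src c = v → c = b := by
  obtain ⟨r, hrC, rfl, hro⟩ := hC.exists_arc_of_isEntrance hN h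
  obtain ⟨a, ha, b, hb, hav, hbv, huniq⟩ :=
    (hC.isCubicComponent hN).exists_boundary_of_outside hro hrC h.1
  exact ⟨a, ha, b, hb, hav, hbv, fun c hc => huniq c hc (by simp)⟩

lemma exists_boundary_of_isExit (hC : G.IsOutsideComponent s t C)
    (hN : G.IsNormalNetwork s t) (h : G.IsExit t C v) :
    ∃ b ∈ G.boundary C, G.src b = v ∧ ∀ c ∈ G.arcsOf C, G.src c = v → c = b := by
  obtain ⟨l, hl, hlC⟩ := h.exists_path
  obtain ⟨r, -, hrC, rfl, hro⟩ := hC.exists_arc_of_isWalk hN h.1 hl.1 hlC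
  obtain ⟨-, -, b, hb, -, hbv, huniq⟩ :=
    (hC.isCubicComponent hN).exists_boundary_of_outside hro hrC h.1
  refine ⟨b, hb, hbv, fun c hc hcv => huniq c hcv fun h => hrC ?_⟩
  exact (Prod.mk.inj h).1 ▸ hc

lemma not_isExit_of_isEntrance (hC : G.IsOutsideComponent s t C)
    (hN : G.IsNormalNetwork s t) (h : G.IsEntrance s C v) : ¬ G.IsExit t C v := by
  intro h'
  obtain ⟨-, -, b, hb, -, -, huniq⟩ := hC.exists_boundary_of_isEntrance hN h
  obtain ⟨l, hl, hlC⟩ := h'.exists_path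
  obtain ⟨r, -, hrC, hr, -⟩ := hC.exists_arc_of_isWalk hN h.1 hl.1 hlC
  exact hrC (huniq r hr ▸ hb.1)

lemma disjoint_support (hC : G.IsOutsideComponent s t C) (hN : G.IsNormalNetwork s t) {e x : V}
    (he : G.IsEntrance s C e) (hx : G.IsExit t C x) {l₁ l₂ : List A} (h₁ : G.IsWalk s l₁ e)
    (hC₁ : ∀ a ∈ l₁, G.src a ∉ C) (h₂ : G.IsWalk x l₂ t) (hC₂ : ∀ a ∈ l₂, G.tgt a ∉ C) :
    (G.support s l₁).Disjoint (G.support x l₂) := by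
  intro w hw₁ hw₂
  have hw := hC.scc.mem_of_reachable hx.1 he.1 (h₂.reachable_left hw₂) (h₁.reachable_right hw₁)
  rcases h₁.mem_support_iff.1 hw₁ with rfl | ⟨a, ha, rfl⟩
  · rcases mem_support.1 hw₂ with rfl | ⟨a, ha, rfl⟩
    · exact hC.not_isExit_of_isEntrance hN he hx
    · exact hC₂ a ha hw
  · exact hC₁ a ha hw

end IsOutsideComponent

/-! ### Consequences of planarity -/

section Planarity

variable {φ : A × Bool → ZMod 2} {h : A → ZMod 2}

lemma IsPotential.apply_true_eq_apply_false_iff (hφ : G.IsPotential φ h) {a : A} :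
    φ (a, true) = φ (a, false) ↔ h a = 0 := by
  rw [← CharTwo.add_eq_zero, ← hφ.add_flip (a, true)]
  rfl

lemma IsPotential.apply_eq_of_isWalk (hφ : G.IsPotential φ h) (hG : G.IsPlane) {u v : V}
    {l : List A} (hl : G.IsWalk u l v) (h0 : ∀ a ∈ l, ∀ d, G.vert d = G.tgt a → h d.1 = 0)
    {d : A × Bool} (hd : G.vert d = v) {a : A} (ha : a ∈ l) (b : Bool) : φ (a, b) = φ d := by
  induction l generalizing u a b with
  | nil => simp at ha
  | cons c l ih =>
    have h0' : ∀ a ∈ l, ∀ d, G.vert d = G.tgt a → h d.1 = 0 := fun a ha => h0 a (by simp [ha])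
    rcases List.mem_cons.1 ha with rfl | ha
    · have apply_false : φ (a, false) = φ d := by
        have apply_eq {d : A × Bool} (hd : G.vert d = G.tgt a) : φ (a, false) = φ d :=
          (hφ.apply_eq_of_vert_eq (d' := (a, false)) hG (h0 a (by simp)) hd).symm
        cases l with
        | nil => exact apply_eq (hd.trans (Eq.symm hl.2))
        | cons c l => exact (apply_eq (d := (c, true)) hl.2.1).trans (ih hl.2 h0' (by simp) true)
      cases b
      · exact apply_false
      · exact (hφ.apply_true_eq_apply_false_iff.2 (h0 a (by simp) (a, false) rfl)).trans apply_false
    · exact ih hl.2 h0' ha b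

lemma IsPlane.rot_symm_notMem_of_isPath (hG : G.IsPlane) {u v : V} {P : List A}
    (hP : G.IsPath u P v) {p q : A} (hp : p ∈ P) (hq : q ∈ P) (hpq : G.src q = G.tgt p)
    (hcubic : G.IsCubicAt (G.tgt p)) (hne : G.rot.symm (p, false) ≠ (q, true)) :
    (G.rot.symm (p, false)).1 ∉ P := by
  have hvert : G.vert (G.rot.symm (p, false)) = G.tgt p := hG.vert_rot_symm _
  have hne' := hG.rot_symm_ne_of_isCubicAt (d := (p, false)) hcubic
  obtain ⟨⟨r, i⟩, hr⟩ : ∃ d, G.rot.symm (p, false) = d := ⟨_, rfl⟩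
  rw [hr] at hvert hne hne' ⊢
  intro hrP
  cases i
  · have hrp : r = p := hP.tgt_injOn hrP hp hvert
    exact hne' (hrp ▸ rfl)
  · have hrq : r = q := hP.src_injOn hrP hq (Eq.trans hvert hpq.symm)
    exact hne (hrq ▸ rfl)

variable [Finite A]

namespace IsCubicComponent

lemma rot_symm_notMem_boundary (hC : G.IsCubicComponent C) {p q : A} (hp : p ∈ G.arcsOf C)
    (hq : q ∈ G.arcsOf C) (hpq : G.src q = G.tgt p) (hne : G.rot.symm (p, false) ≠ (q, true)) :
    (G.rot.symm (p, false)).1 ∉ G.boundary C := by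
  have hcubic : G.IsCubicAt (G.vert (p, false)) := hC.isCubicAt _ hp.2
  have hvert : G.vert (G.rot.symm (p, false)) = G.tgt p := hC.plane.vert_rot_symm _
  obtain ⟨⟨r, i⟩, hr⟩ : ∃ d, G.rot.symm (p, false) = d := ⟨_, rfl⟩
  have hrot : G.rot (r, i) = (p, false) := ((Equiv.symm_apply_eq _).1 hr).symm
  rw [hr] at hvert hne ⊢
  intro hrB
  cases i
  · by_cases hpr : p = r
    · subst hpr
      exact hC.plane.rot_ne_of_isCubicAt hcubic hrot
    · have hrot' := hC.rot_of_tgt_eq hrB hp hvert.symm hpr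
      exact hC.plane.rot_symm_ne_rot_of_isCubicAt hcubic (hr.trans hrot'.symm)
  · have hrot' := hC.rot_of_src_eq hrB hq (hpq.trans (Eq.symm hvert)) fun hqr => hne (hqr ▸ rfl)
    simp [hrot] at hrot'

lemma tgt_ne_of_isPotential (hC : G.IsCubicComponent C) (hφ : G.IsPotential φ h) {i p : A}
    (hi : i ∈ G.boundary C) (hhi : h i ≠ 0) (hp : p ∈ G.arcsOf C) (hne : p ≠ i)
    (hpi : φ (p, false) = φ (i, false)) : G.tgt p ≠ G.tgt i := by
  intro htgt
  have hrot := hC.rot_of_tgt_eq hi hp htgt hne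
  refine hhi (hφ.apply_true_eq_apply_false_iff.1 ?_)
  have hrot_symm := hφ.apply_rot_symm (i, false)
  rw [← hrot, Equiv.symm_apply_apply] at hrot_symm
  rw [← hpi, hrot_symm, hrot]
  rfl

lemma notMem_and_apply_eq_of_closed (hC : G.IsCubicComponent C) {z : V} {Z : List A} {c : ZMod 2}
    (hφ : G.IsPotential φ (chain Z)) (hZ : G.IsWalk z Z z) (hnd : Z.Nodup)
    (hZB : ∀ i ∈ Z, i ∈ G.boundary C) (hZφ : ∀ i ∈ Z, φ (i, false) = c) {p q : A}
    (hp : p ∈ G.arcsOf C) (hpq : G.src q = G.tgt p) (hpZ : p ∉ Z) (hpφ : φ (p, false) = c) :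
    q ∉ Z ∧ φ (q, false) = c := by
  have tgt_ne : ∀ i ∈ Z, G.tgt i ≠ G.tgt p := fun i hi =>
    (hC.tgt_ne_of_isPotential hφ (hZB i hi) (by simp [chain_of_mem hnd hi]) hp
      (fun h => hpZ (h ▸ hi)) (hpφ.trans (hZφ i hi).symm)).symm
  have dart_notMem (d : A × Bool) (hd : G.vert d = G.tgt p) : d.1 ∉ Z := by
    obtain ⟨r, _ | _⟩ := d
    · exact fun hr => tgt_ne r hr hd
    · intro hr
      obtain ⟨i, hi, hir⟩ := hZ.exists_pred_of_closed hr
      exact tgt_ne i hi (hir.trans hd)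
  have hqZ : q ∉ Z := dart_notMem (q, true) hpq
  refine ⟨hqZ, ?_⟩
  rw [← hφ.apply_true_eq_apply_false_iff.2 (chain_of_notMem hqZ), ← hpφ]
  exact hφ.apply_eq_of_vert_eq hC.plane
    (fun d hd => chain_of_notMem (dart_notMem d hd)) (d' := (p, false)) hpq

lemma mem_of_mem_boundary (hC : G.IsCubicComponent C) {z : V} {Z : List A}
    (hZ : G.IsWalk z Z z) (hnd : Z.Nodup) (hne : Z ≠ []) (hZB : ∀ a ∈ Z, a ∈ G.boundary C) {b : A}
    (hb : b ∈ G.boundary C) : b ∈ Z := by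
  classical
  have := Fintype.ofFinite A
  by_contra hbZ
  obtain ⟨φ, hφ⟩ := hC.plane.exists_isPotential hZ.divergence_chain_closed
  have boundary_const : ∀ a ∈ G.boundary C, φ (a, false) = φ (b, false) := fun a ha =>
    hφ.apply_eq_of_outside hC.plane
      (fun a ha => chain_of_notMem fun h => ha (hZB a h).1) (hC.outside_false ha)
      (hC.outside_false hb) (hC.connected ha.1.2 hb.1.2)
  obtain ⟨z₀, hz₀⟩ := List.exists_mem_of_ne_nil Z hne
  obtain ⟨R, hR⟩ := hC.scc.reachable hb.1.2 (hZB z₀ hz₀).1.1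
  have hwalk : G.IsWalk (G.src b) (b :: R ++ [z₀]) (G.tgt z₀) :=
    IsWalk.append (v := G.src z₀) ⟨rfl, hR⟩ ⟨rfl, rfl⟩
  have hwalkC : ∀ a ∈ b :: R ++ [z₀], a ∈ G.arcsOf C := fun a =>
    hC.scc.mem_arcsOf hb.1.1 (hZB z₀ hz₀).1.2 hwalk
  have avoids : ∀ p ∈ b :: R ++ [z₀], p ∉ Z ∧ φ (p, false) = φ (b, false) := by
    refine hwalk.forall_mem_of_forall_succ (fun p hp => ?_) fun p hp q _ hpq ⟨hpZ, hpφ⟩ => ?_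
    · obtain rfl : b = p := by simpa using hp
      exact ⟨hbZ, rfl⟩
    · exact hC.notMem_and_apply_eq_of_closed hφ hZ hnd hZB (fun i hi => boundary_const i (hZB i hi))
        (hwalkC p hp) hpq hpZ hpφ
  exact (avoids z₀ (by simp)).1 hz₀

lemma mem_of_mem_path (hC : G.IsCubicComponent C) {e x : V} (he : e ∈ C) (hx : x ∈ C)
    {L P : List A} (hL : G.IsWalk e L x) (hLnd : L.Nodup) (hLB : ∀ a ∈ L, a ∈ G.boundary C)
    (hP : G.IsPath e P x) (hhead : P.head? = L.head?) {a : A} (ha : a ∈ P)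
    (haB : a ∈ G.boundary C) : a ∈ L := by
  classical
  have := Fintype.ofFinite A
  by_contra haL
  obtain ⟨φ, hφ⟩ := hC.plane.exists_isPotential (hP.1.divergence_chain_add_chain hL)
  have hPC : ∀ a ∈ P, a ∈ G.arcsOf C := fun a => hC.scc.mem_arcsOf he hx hP.1
  have boundary_const : ∀ b ∈ G.boundary C, φ (b, false) = φ (a, false) := fun b hb => by
    refine hφ.apply_eq_of_outside hC.plane (fun b hb => ?_) (hC.outside_false hb)
      (hC.outside_false haB) (hC.connected hb.1.2 haB.1.2)
    rw [Pi.add_apply, chain_of_notMem fun h => hb (hPC b h),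
      chain_of_notMem fun h => hb (hLB b h).1, add_zero]
  have path_const : ∀ p ∈ P, φ (p, true) = φ (a, false) := by
    refine hP.1.forall_mem_of_forall_succ (fun p hp => ?_) fun p hp q hq hpq hpφ => ?_
    · have hpP : p ∈ P := List.mem_of_mem_head? hp
      have hpL : p ∈ L := List.mem_of_mem_head? (hhead ▸ hp)
      rw [← boundary_const p (hLB p hpL), hφ.apply_true_eq_apply_false_iff, Pi.add_apply,
        chain_of_mem hP.nodup hpP, chain_of_mem hLnd hpL, CharTwo.add_self_eq_zero]
    · have hcubic := hC.isCubicAt _ (hPC p hp).2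
      rw [← hpφ]
      refine (hφ.apply_true_eq_of_src_eq_tgt hC.plane hpq hcubic fun hne => ?_).symm
      rw [Pi.add_apply, chain_of_notMem fun hL => hC.rot_symm_notMem_boundary (hPC p hp) (hPC q hq)
        hpq hne (hLB _ hL), chain_of_notMem (hC.plane.rot_symm_notMem_of_isPath hP hp hq hpq hcubic
        hne), add_zero]
  have hzero := hφ.apply_true_eq_apply_false_iff.1 (path_const a ha)
  rw [Pi.add_apply, chain_of_mem hP.nodup ha, chain_of_notMem haL, add_zero] at hzero
  exact one_ne_zero hzero

lemma apply_true_eq_of_mem_boundary (hC : G.IsCubicComponent C) (hφ : G.IsPotential φ h)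
    (h0 : ∀ a, ¬ G.Outside (G.arcsOf C) (a, false) → h a = 0) {p q : A} (hp : p ∈ G.boundary C)
    (hq : q ∈ G.boundary C) (hpq : G.src q = G.tgt p) : φ (p, true) = φ (q, true) := by
  refine hφ.apply_true_eq_of_src_eq_tgt hC.plane hpq (hC.isCubicAt _ hp.1.2) fun hne =>
    h0 _ fun hout => ?_
  by_cases hdC : (G.rot.symm (p, false)).1 ∈ G.arcsOf C
  · exact hC.rot_symm_notMem_boundary hp.1 hq.1 hpq hne (hC.mem_boundary_iff.2 ⟨hdC, hout⟩)
  · have hout' : G.Outside (G.arcsOf C) (G.rot.symm (p, false)) := by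
      obtain ⟨⟨r, i⟩, hr⟩ : ∃ d, G.rot.symm (p, false) = d := ⟨_, rfl⟩
      rw [hr] at hout hdC ⊢
      cases i
      exacts [hout, (outside_flip_iff (d := (r, true)) hdC).1 hout]
    obtain ⟨-, -, b, -, -, hrot⟩ := hC.exists_rot_of_outside hout' hdC
      (by rw [hC.plane.vert_rot_symm]; exact hp.1.2)
    simp at hrot

lemma apply_true_eq_of_isBoundaryCycle (hC : G.IsCubicComponent C) (hφ : G.IsPotential φ h)
    (h0 : ∀ a, ¬ G.Outside (G.arcsOf C) (a, false) → h a = 0) {Q : List A}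
    (hQ : G.IsBoundaryCycle C Q) {a b : A} (ha : a ∈ G.boundary C) (hb : b ∈ G.boundary C) :
    φ (a, true) = φ (b, true) := by
  obtain ⟨⟨hne, ⟨u, hu⟩, -⟩, hQB⟩ := hQ
  obtain ⟨c, Q, rfl⟩ := List.exists_cons_of_ne_nil hne
  have head_const : ∀ p ∈ c :: Q, φ (p, true) = φ (c, true) := by
    refine hu.forall_mem_of_forall_succ (fun p hp => ?_) fun p hp q hq hpq hpφ => ?_
    · obtain rfl : c = p := by simpa using hp
      rfl
    · rw [← hpφ]
      exact (hC.apply_true_eq_of_mem_boundary hφ h0 ((hQB p).1 hp) ((hQB q).1 hq) hpq).symm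
  rw [head_const a ((hQB a).2 ha), head_const b ((hQB b).2 hb)]

end IsCubicComponent

namespace IsOutsideComponent

lemma apply_false_eq_of_isWalk (hC : G.IsOutsideComponent s t C) (hN : G.IsNormalNetwork s t)
    (hφ : G.IsPotential φ h) {b : A} (hb : b ∈ G.boundary C) {T : List A}
    (hT : G.IsWalk (G.tgt b) T t) (hTC : ∀ a ∈ T, G.tgt a ∉ C)
    (h0 : ∀ a ∈ T, ∀ d, G.vert d = G.tgt a → h d.1 = 0) {d : A × Bool} (hd : G.vert d = t) :
    φ (b, false) = φ d := by
  have hcubic := hC.isCubicComponent hN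
  obtain ⟨r, hr, hrC, hrb, hro⟩ := hC.exists_arc_of_isWalk hN hb.1.2 hT hTC
  obtain ⟨c, hc, -, -, hrot, -⟩ := hcubic.exists_rot_of_outside hro hrC
    (show G.src r ∈ C by rw [hrb]; exact hb.1.2)
  have hcb : G.tgt c = G.tgt b := by
    rw [← hrb, ← vert_true, ← hN.plane.vert_rot_symm, hrot, vert_false]
  rw [← hcubic.tgt_injOn_boundary hc hb hcb, ← hrot, hφ.apply_rot_symm]
  exact hφ.apply_eq_of_isWalk hN.plane hT h0 hd hr _

lemma notMem_of_vert_eq_tgt (hC : G.IsOutsideComponent s t C) (hN : G.IsNormalNetwork s t)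
    {e x : V} (he : G.IsEntrance s C e) (hx : G.IsExit t C x) {S T : List A}
    (hS : G.IsWalk s S e) (hSC : ∀ a ∈ S, G.src a ∉ C) (hT : G.IsWalk x T t)
    (hTC : ∀ a ∈ T, G.tgt a ∉ C) {a : A} (ha : a ∈ T) {d : A × Bool}
    (hd : G.vert d = G.tgt a) : d.1 ∉ S := fun hdS =>
  hC.disjoint_support hN he hx hS hSC hT hTC (hS.vert_mem_support hdS) (hd ▸ tgt_mem_support ha)

/-- A path to `e'` together with a path to `e` and the boundary from `e` to `e'` is a closed
curve. It would separate `tgt a'` from `tgt a`, although both are joined to the sink without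
crossing it. -/
lemma not_isExit_of_notMem (hC : G.IsOutsideComponent s t C)
    (hN : G.IsNormalNetwork s t) {Q : List A} (hQ : G.IsBoundaryCycle C Q) {e e' : V}
    (he : G.IsEntrance s C e) (he' : G.IsEntrance s C e') {L : List A} (hL : G.IsWalk e L e')
    (hLnd : L.Nodup) (hLB : ∀ a ∈ L, a ∈ G.boundary C) {a a' : A} (ha : a ∈ L)
    (hx : G.IsExit t C (G.tgt a)) (ha' : a' ∈ G.boundary C) (haL : a' ∉ L) :
    ¬ G.IsExit t C (G.tgt a') := by
  classical
  have := Fintype.ofFinite A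
  intro hx'
  have hcubic := hC.isCubicComponent hN
  obtain ⟨S, hS, hSC⟩ := he.exists_path
  obtain ⟨S', hS', hSC'⟩ := he'.exists_path
  obtain ⟨φ, hφ⟩ := hN.plane.exists_isPotential
    ((hS.1.append hL).divergence_chain_add_chain hS'.1)
  have chain_zero {b : A} (hbS : b ∉ S) (hbL : b ∉ L) (hbS' : b ∉ S') :
      (chain (S ++ L) + chain S') b = 0 := by
    rw [Pi.add_apply, chain_of_notMem (by simp [hbS, hbL]), chain_of_notMem hbS', add_zero]
  have notMem_S {b : A} (hb : b ∈ G.arcsOf C) : b ∉ S := fun h => hSC b h hb.1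
  have notMem_S' {b : A} (hb : b ∈ G.arcsOf C) : b ∉ S' := fun h => hSC' b h hb.1
  obtain ⟨T, hT, -⟩ := hx.exists_path
  obtain ⟨c, -, hct⟩ := hT.1.exists_tgt_eq_end fun h => hC.sink_notMem (h ▸ hx.1)
  have outer_const {b : A} (hb : b ∈ G.boundary C) (hx : G.IsExit t C (G.tgt b)) :
      φ (b, false) = φ (c, false) := by
    obtain ⟨T, hT, hTC⟩ := hx.exists_path
    refine hC.apply_false_eq_of_isWalk hN hφ hb hT.1 hTC (fun a ha d hd => ?_) hct
    exact chain_zero (hC.notMem_of_vert_eq_tgt hN he hx hS.1 hSC hT.1 hTC ha hd)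
      (fun hdL => notMem_arcsOf_of_vert_notMem (hd ▸ hTC a ha) (hLB _ hdL).1)
      (hC.notMem_of_vert_eq_tgt hN he' hx hS'.1 hSC' hT.1 hTC ha hd)
  have inner_const : φ (a, true) = φ (a', true) :=
    hcubic.apply_true_eq_of_isBoundaryCycle hφ (fun b hb => chain_zero
      (fun h => hb (hN.plane.outside_of_isWalk_of_inUnboundedFace hC.source_outside hS.1 hSC h _))
      (fun h => hb (hcubic.outside_false (hLB b h)))
      (fun h => hb
        (hN.plane.outside_of_isWalk_of_inUnboundedFace hC.source_outside hS'.1 hSC' h _)))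
      hQ (hLB a ha) ha'
  have hone : (chain (S ++ L) + chain S') a = 1 := by
    have hnd : (S ++ L).Nodup :=
      hS.nodup.append hLnd fun b hbS hbL => notMem_S (hLB b hbL).1 hbS
    rw [Pi.add_apply, chain_of_mem hnd (by simp [ha]), chain_of_notMem (notMem_S' (hLB a ha).1),
      add_zero]
  refine one_ne_zero (hone.symm.trans (hφ.apply_true_eq_apply_false_iff.1 ?_))
  rw [inner_const, outer_const (hLB a ha) hx, ← outer_const ha' hx']
  exact hφ.apply_true_eq_apply_false_iff.2 (chain_zero (notMem_S ha'.1) haL (notMem_S' ha'.1))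

end IsOutsideComponent

end Planarity

/-! ### The boundary cycle and how it splits -/

variable {Q Q₁ Q₂ : List A}

lemma IsBoundaryCycle.nodup (hQ : G.IsBoundaryCycle C Q) : Q.Nodup := hQ.1.2.2.of_map

lemma IsBoundaryCycle.exists_rotation (hQ : G.IsBoundaryCycle C Q) {a : A}
    (ha : a ∈ G.boundary C) : ∃ L, Q ~r a :: L ∧ G.IsWalk (G.src a) (a :: L) (G.src a) := by
  obtain ⟨u, hu⟩ := hQ.1.2.1
  obtain ⟨l₁, l₂, rfl, h₁, h₂⟩ := hu.exists_split_arc ((hQ.2 a).2 ha)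
  exact ⟨l₂ ++ l₁, List.isRotated_append, rfl, h₂.append h₁⟩

lemma exists_closed_walk_of_bijective {B : Set A} [Finite B] {f : B → B} (hf : f.Bijective)
    (hsrc : ∀ b, G.src (f b) = G.tgt b) (b : B) :
    ∃ l ≠ [], G.IsWalk (G.src b) l (G.src b) ∧ l.Nodup ∧ ∀ a ∈ l, a ∈ B := by
  set n := Function.minimalPeriod f b
  have hwalk (k : ℕ) : G.IsWalk (G.src b) ((List.range k).map fun i => (f^[i] b : A))
      (G.src (f^[k] b : A)) := by
    induction k with
    | zero => rfl
    | succ k ih =>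
      rw [List.range_succ, List.map_append, Function.iterate_succ_apply']
      exact ih.append ⟨rfl, (hsrc _).symm⟩
  have hperiod : f^[n] b = b := Function.isPeriodicPt_minimalPeriod f b
  have hpos : 0 < n := Function.minimalPeriod_pos_of_mem_periodicPts (hf.1.mem_periodicPts b)
  refine ⟨(List.range n).map fun i => (f^[i] b : A), by simp [hpos.ne'], ?_, ?_, ?_⟩
  · simpa only [hperiod] using hwalk n
  · exact List.Nodup.map_on (fun i hi j hj hij => Function.iterate_injOn_Iio_minimalPeriod
      (List.mem_range.1 hi) (List.mem_range.1 hj) (Subtype.ext hij)) List.nodup_range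
  · intro a ha
    obtain ⟨i, -, rfl⟩ := List.mem_map.1 ha
    exact Subtype.coe_prop _

namespace IsCubicComponent

variable [Finite A]

lemma exists_isBoundaryCycle (hC : G.IsCubicComponent C) : ∃ Q, G.IsBoundaryCycle C Q := by
  obtain ⟨f, hf, hsrc⟩ := hC.exists_bijective_succ
  obtain ⟨b, hb⟩ := hC.boundary_nonempty
  obtain ⟨Q, hne, hQ, hnd, hQB⟩ := exists_closed_walk_of_bijective hf hsrc ⟨b, hb⟩
  exact ⟨Q, ⟨hne, ⟨_, hQ⟩, hnd.map_on fun a ha c hc => hC.tgt_injOn_boundary (hQB a ha) (hQB c hc)⟩,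
    fun a => ⟨hQB a, hC.mem_of_mem_boundary hQ hnd hne hQB⟩⟩

lemma eq_of_isWalk (hC : G.IsCubicComponent C) {u v v' : V} {l l' : List A} (hl : G.IsWalk u l v)
    (hl' : G.IsWalk u l' v') (hlB : ∀ a ∈ l, a ∈ G.boundary C) (hlB' : ∀ a ∈ l', a ∈ G.boundary C)
    (hlen : l.length = l'.length) : l = l' := by
  induction l generalizing u l' with
  | nil => simpa only [List.length_nil, eq_comm, List.length_eq_zero_iff] using hlen
  | cons a l ih =>
    obtain ⟨a', l', rfl⟩ := List.exists_cons_of_length_eq_add_one hlen.symm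
    simp only [List.forall_mem_cons] at hlB hlB'
    obtain rfl : a = a' := hC.src_injOn_boundary hlB.1 hlB'.1 (hl.1.trans hl'.1.symm)
    rw [ih hl.2 hl'.2 hlB.2 hlB'.2 (Nat.succ_inj.1 hlen)]

lemma isRotated_of_isBoundaryCycle (hC : G.IsCubicComponent C) {Q' : List A}
    (hQ : G.IsBoundaryCycle C Q) (hQ' : G.IsBoundaryCycle C Q') : Q ~r Q' := by
  obtain ⟨a, ha⟩ := hC.boundary_nonempty
  obtain ⟨L, hL, hLw⟩ := hQ.exists_rotation ha
  obtain ⟨L', hL', hLw'⟩ := hQ'.exists_rotation ha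
  have hperm : Q.Perm Q' := (List.perm_ext_iff_of_nodup hQ.nodup hQ'.nodup).2 fun a => by
    rw [hQ.2, hQ'.2]
  have hLL' : a :: L = a :: L' := hC.eq_of_isWalk hLw hLw'
    (fun b hb => (hQ.2 b).1 (hL.perm.mem_iff.2 hb))
    (fun b hb => (hQ'.2 b).1 (hL'.perm.mem_iff.2 hb))
    (by rw [← hL.perm.length_eq, ← hL'.perm.length_eq, hperm.length_eq])
  exact hL.trans (hLL' ▸ hL'.symm)

end IsCubicComponent

lemma IsPath.exists_subpath {l : List A} (hl : G.IsPath s l t) {a : A} (ha : a ∈ l)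
    (haC : a ∈ G.arcsOf C) :
    ∃ e x P, G.IsEntrance s C e ∧ G.IsExit t C x ∧ G.IsPath e P x ∧ a ∈ P := by
  obtain ⟨S, l', e, rfl, hS, hl', he, hSC⟩ :=
    hl.1.exists_split_first (· ∈ C) ⟨_, hl.1.src_mem_support ha, haC.1⟩
  obtain ⟨P, T, x, rfl, hP, hT, hx, hTC⟩ :=
    hl'.exists_split_last (· ∈ C) ⟨e, start_mem_support, he⟩
  refine ⟨e, x, P, isEntrance_of_isWalk he hS hSC, isExit_of_isWalk hx hT hTC,
    (hl.right_of_append hS).left_of_append hP, ?_⟩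
  simp only [List.mem_append] at ha
  exact (ha.resolve_left fun h => hSC a h haC.1).resolve_right fun h => hTC a h haC.2

lemma allUseless_of_not_exists (h : ¬ ((∃ e, G.IsEntrance s C e) ∧ ∃ x, G.IsExit t C x)) :
    G.AllUseless s t C := by
  rintro a haC ⟨l, hl, ha⟩
  obtain ⟨e, x, -, he, hx, -⟩ := hl.exists_subpath ha haC
  exact h ⟨⟨e, he⟩, x, hx⟩

/-- The cycle `Q` consists of a walk `Q₁` from the entrance `e` to the exit `x` and a walk `Q₂` from
`x` back to `e` with no entrance and no exit strictly in between. -/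
structure IsCut (G : EmbeddedDigraph V A) (s t : V) (C : Set V) (Q Q₁ Q₂ : List A) (e x : V) :
    Prop where
  isRotated : Q ~r Q₁ ++ Q₂
  isEntrance : G.IsEntrance s C e
  isExit : G.IsExit t C x
  isWalk_left : G.IsWalk e Q₁ x
  isWalk_right : G.IsWalk x Q₂ e
  not_isExit : ∀ a ∈ Q₂, ¬ G.IsExit t C (G.tgt a)
  eq_of_isEntrance : ∀ a ∈ Q₂, G.IsEntrance s C (G.tgt a) → G.tgt a = e

lemma IsCut.nodup {e x : V} (h : G.IsCut s t C Q Q₁ Q₂ e x) (hQ : G.IsBoundaryCycle C Q) :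
    (Q₁ ++ Q₂).Nodup :=
  h.isRotated.perm.nodup_iff.1 hQ.nodup

lemma IsCut.mem_boundary_iff {e x : V} (h : G.IsCut s t C Q Q₁ Q₂ e x)
    (hQ : G.IsBoundaryCycle C Q) {a : A} : a ∈ G.boundary C ↔ a ∈ Q₁ ∨ a ∈ Q₂ := by
  rw [← hQ.2, h.isRotated.perm.mem_iff, List.mem_append]

lemma isPath_of_closed {u v : V} (h₁ : G.IsWalk u Q₁ v) (h₂ : G.IsWalk v Q₂ u) (hne : u ≠ v)
    (hnd : ((Q₁ ++ Q₂).map G.tgt).Nodup) : G.IsPath u Q₁ v ∧ G.IsPath v Q₂ u := by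
  rw [List.map_append, List.nodup_append'] at hnd
  obtain ⟨hnd₁, hnd₂, hdisj⟩ := hnd
  exact ⟨⟨h₁, List.nodup_cons.2 ⟨fun h => hdisj h
      (List.mem_map.2 (h₂.exists_tgt_eq_end hne.symm)), hnd₁⟩⟩,
    ⟨h₂, List.nodup_cons.2 ⟨hdisj (List.mem_map.2 (h₁.exists_tgt_eq_end hne)), hnd₂⟩⟩⟩

namespace IsOutsideComponent

variable [Finite A]

lemma ne_of_isEntrance_of_isExit (hC : G.IsOutsideComponent s t C) (hN : G.IsNormalNetwork s t)
    {e x : V} (he : G.IsEntrance s C e) (hx : G.IsExit t C x) : e ≠ x := by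
  rintro rfl
  exact hC.not_isExit_of_isEntrance hN he hx

lemma exists_mem_of_isEntrance (hC : G.IsOutsideComponent s t C) (hN : G.IsNormalNetwork s t)
    (hQ : G.IsBoundaryCycle C Q) {e : V} (he : G.IsEntrance s C e) : ∃ a ∈ Q, G.tgt a = e := by
  obtain ⟨a, ha, -, -, hae, -⟩ := hC.exists_boundary_of_isEntrance hN he
  exact ⟨a, (hQ.2 a).2 ha, hae⟩

lemma exists_mem_of_isExit (hC : G.IsOutsideComponent s t C) (hN : G.IsNormalNetwork s t)
    (hQ : G.IsBoundaryCycle C Q) {x : V} (hx : G.IsExit t C x) : ∃ a ∈ Q, G.tgt a = x := by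
  obtain ⟨b, hb, rfl, -⟩ := hC.exists_boundary_of_isExit hN hx
  obtain ⟨a, ha, hab⟩ := (hC.isCubicComponent hN).exists_pred hb
  exact ⟨a, (hQ.2 a).2 ha, hab⟩

lemma exists_isCut (hC : G.IsOutsideComponent s t C) (hN : G.IsNormalNetwork s t)
    (hQ : G.IsBoundaryCycle C Q) (he : ∃ e, G.IsEntrance s C e) (hx : ∃ x, G.IsExit t C x) :
    ∃ Q₁ Q₂ e x, G.IsCut s t C Q Q₁ Q₂ e x := by
  obtain ⟨e₀, he₀⟩ := he
  obtain ⟨x₀, hx₀⟩ := hx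
  obtain ⟨b, hb, rfl, -⟩ := hC.exists_boundary_of_isExit hN hx₀
  obtain ⟨L, hrot, hL⟩ := hQ.exists_rotation hb
  have he₀L : e₀ ∈ G.support (G.src b) (b :: L) := by
    obtain ⟨a, ha, hae⟩ := hC.exists_mem_of_isEntrance hN hQ he₀
    exact mem_support.2 (.inr ⟨a, hrot.perm.mem_iff.1 ha, hae⟩)
  generalize b :: L = L at *
  obtain ⟨W, Z, e, rfl, hW, hZ, he, hWe⟩ := hL.exists_split_first (G.IsEntrance s C)
    ⟨e₀, he₀L, he₀⟩
  obtain ⟨X, Y, x, rfl, hX, hY, hx, hYx⟩ := hW.exists_split_last (G.IsExit t C)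
    ⟨_, start_mem_support, hx₀⟩
  refine ⟨Z ++ X, Y, e, x, ?_, he, hx, hZ.append hX, hY, hYx, fun a ha hae => ?_⟩
  · rw [List.append_assoc]
    exact hrot.trans (List.isRotated_append (l := X ++ Y) (l' := Z))
  · refine (hY.mem_support_iff.1 (tgt_mem_support ha)).resolve_right ?_
    rintro ⟨c, hc, hca⟩
    exact hWe c (by simp [hc]) (hca ▸ hae)

lemma exists_split_of_isCut (hC : G.IsOutsideComponent s t C) (hN : G.IsNormalNetwork s t)
    (hQ : G.IsBoundaryCycle C Q) {e x e' x' : V} (h : G.IsCut s t C Q Q₁ Q₂ e x)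
    (he' : G.IsEntrance s C e') (hx' : G.IsExit t C x') :
    ∃ M₁ L M₂, Q₁ = M₁ ++ (L ++ M₂) ∧ G.IsWalk e M₁ e' ∧ G.IsWalk e' L x' := by
  have hx'Q : x' ∈ G.support e Q₁ := by
    obtain ⟨a, ha, rfl⟩ := hC.exists_mem_of_isExit hN hQ hx'
    exact tgt_mem_support
      (((h.mem_boundary_iff hQ).1 ((hQ.2 a).1 ha)).resolve_right fun ha => h.not_isExit a ha hx')
  have he'Q : e' ∈ G.support e Q₁ := by
    obtain ⟨a, ha, rfl⟩ := hC.exists_mem_of_isEntrance hN hQ he'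
    rcases (h.mem_boundary_iff hQ).1 ((hQ.2 a).1 ha) with ha | ha
    · exact tgt_mem_support ha
    · exact h.eq_of_isEntrance a ha he' ▸ start_mem_support
  obtain ⟨N₁, N₂, rfl, hN₁, hN₂⟩ := h.isWalk_left.exists_split_of_mem hx'Q
  by_cases he'N : e' ∈ G.support e N₁
  · obtain ⟨M, L, rfl, hM, hL⟩ := hN₁.exists_split_of_mem he'N
    exact ⟨M, L, N₂, by simp, hM, hL⟩
  exfalso
  rw [support_append, List.mem_append] at he'Q
  obtain ⟨c, hc, hce⟩ := List.mem_map.1 (he'Q.resolve_left he'N)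
  obtain ⟨M, M', rfl, hM, hM'⟩ := hN₂.exists_split_of_mem (mem_support.2 (.inr ⟨c, hc, hce⟩))
  obtain ⟨a, ha, rfl⟩ :=
    hN₁.exists_tgt_eq_end (hC.ne_of_isEntrance_of_isExit hN h.isEntrance hx')
  obtain ⟨a', ha', rfl⟩ := hM'.exists_tgt_eq_end (hC.ne_of_isEntrance_of_isExit hN he' h.isExit)
  have hnd : ((N₁ ++ M) ++ M').Nodup := by
    rw [List.append_assoc]
    exact (h.nodup hQ).of_append_left
  have hB {b : A} (hb : b ∈ (N₁ ++ M) ++ M') : b ∈ G.boundary C :=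
    (h.mem_boundary_iff hQ).2 (.inl (List.append_assoc _ _ _ ▸ hb))
  exact hC.not_isExit_of_notMem hN hQ h.isEntrance he' (hN₁.append hM) hnd.of_append_left
    (fun b hb => hB (List.mem_append_left _ hb)) (List.mem_append_left _ ha) hx'
    (hB (List.mem_append_right _ ha')) (fun h => (List.nodup_append'.1 hnd).2.2 h ha') h.isExit

lemma usefulPath_of_isPath (hC : G.IsOutsideComponent s t C) (hN : G.IsNormalNetwork s t)
    {e x : V} (he : G.IsEntrance s C e) (hx : G.IsExit t C x) {P : List A} (hP : G.IsPath e P x) :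
    G.UsefulPath s t P := by
  obtain ⟨S, hS, hSC⟩ := he.exists_path
  obtain ⟨T, hT, hTC⟩ := hx.exists_path
  have hPC : ∀ w ∈ G.support e P, w ∈ C := hC.scc.support_subset he.1 hx.1 hP.1
  refine ⟨S ++ (P ++ T), hS.append (hP.append hT fun w hw hwT => ?_) fun w hwS hw => ?_,
    ⟨S, T, by simp⟩⟩
  · rcases mem_support.1 hwT with h | ⟨a, ha, rfl⟩
    exacts [h, absurd (hPC _ hw) (hTC a ha)]
  · rw [support_append, List.mem_append] at hw
    rcases hw with hw | hw
    · rcases hS.1.mem_support_iff.1 hwS with h | ⟨a, ha, rfl⟩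
      exacts [h, absurd (hPC _ hw) (hSC a ha)]
    · exact (hC.disjoint_support hN he hx hS.1 hSC hT.1 hTC hwS (List.mem_cons_of_mem _ hw)).elim

/-- Only one arc of `C` leaves an entrance, so a path through `C` starts along the boundary. -/
lemma head?_eq_of_isWalk (hC : G.IsOutsideComponent s t C) (hN : G.IsNormalNetwork s t)
    {e x : V} (he : G.IsEntrance s C e) (hne : e ≠ x) {P L : List A} (hP : G.IsWalk e P x)
    (hL : G.IsWalk e L x) : P.head? = L.head? := by
  obtain ⟨-, -, b, -, -, -, hb⟩ := hC.exists_boundary_of_isEntrance hN he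
  have head?_eq {l : List A} (hl : G.IsWalk e l x) : l.head? = some b := by
    cases l with
    | nil => exact absurd hl hne
    | cons c l => exact congrArg some (hb c hl.1)
  rw [head?_eq hP, head?_eq hL]

lemma not_usefulArc_of_isCut (hC : G.IsOutsideComponent s t C) (hN : G.IsNormalNetwork s t)
    (hQ : G.IsBoundaryCycle C Q) {e x : V} (h : G.IsCut s t C Q Q₁ Q₂ e x) {a : A} (ha : a ∈ Q₂) :
    ¬ G.UsefulArc s t a := by
  rintro ⟨l, hl, hal⟩
  have haB : a ∈ G.boundary C := (h.mem_boundary_iff hQ).2 (.inr ha)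
  obtain ⟨e', x', P, he', hx', hP, haP⟩ := hl.exists_subpath hal haB.1
  obtain ⟨M₁, L, M₂, rfl, -, hL⟩ := hC.exists_split_of_isCut hN hQ h he' hx'
  have hnd := h.nodup hQ
  have haL : a ∈ L := (hC.isCubicComponent hN).mem_of_mem_path he'.1 hx'.1 hL
    hnd.of_append_left.of_append_right.of_append_left
    (fun b hb => (h.mem_boundary_iff hQ).2 (by simp [hb])) hP
    (hC.head?_eq_of_isWalk hN he' (hC.ne_of_isEntrance_of_isExit hN he' hx') hP.1 hL) haP haB
  exact (List.nodup_append'.1 hnd).2.2 (by simp [haL]) ha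

lemma splits_of_isCut (hC : G.IsOutsideComponent s t C) (hN : G.IsNormalNetwork s t)
    (hQ : G.IsBoundaryCycle C Q) {e x : V} (h : G.IsCut s t C Q Q₁ Q₂ e x) :
    G.Splits s t C Q Q₁ Q₂ := by
  have hex := hC.ne_of_isEntrance_of_isExit hN h.isEntrance h.isExit
  obtain ⟨hQ₁, hQ₂⟩ := isPath_of_closed h.isWalk_left h.isWalk_right hex
    ((h.isRotated.perm.map G.tgt).nodup_iff.1 hQ.1.2.2)
  refine ⟨h.isRotated, ?_, ?_, e, x, h.isEntrance, h.isExit, hQ₁, hQ₂,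
    hC.usefulPath_of_isPath hN h.isEntrance h.isExit hQ₁,
    fun a ha => hC.not_usefulArc_of_isCut hN hQ h ha, fun e' x' he' hx' => ?_⟩
  · rintro rfl
    exact hex hQ₁.1
  · rintro rfl
    exact hex.symm hQ₂.1
  · obtain ⟨M₁, L, M₂, rfl, hM₁, hL⟩ := hC.exists_split_of_isCut hN hQ h he' hx'
    obtain ⟨a, ha, hax⟩ := hL.exists_tgt_eq_end (hC.ne_of_isEntrance_of_isExit hN he' hx')
    rw [support_append]
    exact List.Sublist.append (l₁ := [e']) (r₁ := [x'])
      (List.singleton_sublist.2 hM₁.end_mem_support)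
      (List.singleton_sublist.2 (List.mem_map.2 ⟨a, by simp [ha], hax⟩))

lemma allUseless_or_splits (hC : G.IsOutsideComponent s t C) (hN : G.IsNormalNetwork s t)
    (hQ : G.IsBoundaryCycle C Q) :
    G.AllUseless s t C ∨ ∃ Q₁ Q₂, G.Splits s t C Q Q₁ Q₂ := by
  refine or_iff_not_imp_left.2 fun hall => ?_
  obtain ⟨he, hx⟩ := not_not.1 (mt allUseless_of_not_exists hall)
  obtain ⟨Q₁, Q₂, e, x, h⟩ := hC.exists_isCut hN hQ he hx
  exact ⟨Q₁, Q₂, hC.splits_of_isCut hN hQ h⟩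

end IsOutsideComponent

end EmbeddedDigraph

namespace RAM

/-! ### Reasoning about programs -/

/-- In the state `σ`, the expression `e` respects the word bound and has the value `x`. -/
def HasValue (W : ℕ) (σ : State) (e : Expr) (x : ℕ) : Prop := e.Fits W σ ∧ e.eval σ = x

open Classical in
/-- In the state `σ`, the expression `e` computes the truth value of `P`, as `1` or `0`. -/
def Tests (W : ℕ) (σ : State) (e : Expr) (P : Prop) : Prop :=
  HasValue W σ e (if P then 1 else 0)

/-- With word bound `W`, the program `p` started in `σ` halts within `B` steps in a state that
satisfies `post`. -/
def Runs (W : ℕ) (p : Program) (σ : State) (B : ℕ) (post : State → Prop) : Prop :=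
  ∃ T σ', Exec W p σ T σ' ∧ T ≤ B ∧ post σ'

section Values

variable {W : ℕ} {σ : State} {e e₁ e₂ : Expr} {x y z : ℕ} {P Q : Prop}

lemma hasValue_lit (h : x ≤ W) : HasValue W σ (.lit x) x := ⟨h, rfl⟩

lemma hasValue_reg {i : ℕ} (h : σ.reg i = x) (hx : x ≤ W) : HasValue W σ (.reg i) x :=
  ⟨h.trans_le hx, h⟩

lemma HasValue.mem {k : ℕ} (he : HasValue W σ e x) (h : σ.mem k x = y) (hy : y ≤ W) :
    HasValue W σ (.mem k e) y :=
  ⟨⟨he.1, by rwa [he.2, h]⟩, by rw [Expr.eval, he.2, h]⟩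

lemma HasValue.op {o : Op} (h₁ : HasValue W σ e₁ x) (h₂ : HasValue W σ e₂ y)
    (h : o.eval x y = z) (hz : z ≤ W) : HasValue W σ (.op o e₁ e₂) z :=
  ⟨⟨h₁.1, h₂.1, by rwa [h₁.2, h₂.2, h]⟩, by rw [Expr.eval, h₁.2, h₂.2, h]⟩

lemma HasValue.add (h₁ : HasValue W σ e₁ x) (h₂ : HasValue W σ e₂ y) (h : x + y ≤ W) :
    HasValue W σ (.op .add e₁ e₂) (x + y) :=
  h₁.op h₂ rfl h

lemma HasValue.sub (h₁ : HasValue W σ e₁ x) (h₂ : HasValue W σ e₂ y) (h : x - y ≤ W) :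
    HasValue W σ (.op .sub e₁ e₂) (x - y) :=
  h₁.op h₂ rfl h

lemma HasValue.mul (h₁ : HasValue W σ e₁ x) (h₂ : HasValue W σ e₂ y) (h : x * y ≤ W) :
    HasValue W σ (.op .mul e₁ e₂) (x * y) :=
  h₁.op h₂ rfl h

lemma HasValue.tests_lt (h₁ : HasValue W σ e₁ x) (h₂ : HasValue W σ e₂ y) (hW : 1 ≤ W) :
    Tests W σ (.op .lt e₁ e₂) (x < y) :=
  h₁.op h₂ (by simp only [Op.eval]; congr) (by split <;> omega)

lemma HasValue.tests_eq (h₁ : HasValue W σ e₁ x) (h₂ : HasValue W σ e₂ y) (hW : 1 ≤ W) :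
    Tests W σ (.op .eq e₁ e₂) (x = y) :=
  h₁.op h₂ (by simp only [Op.eval]; congr) (by split <;> omega)

lemma Tests.and (h₁ : Tests W σ e₁ P) (h₂ : Tests W σ e₂ Q) (hW : 1 ≤ W) :
    Tests W σ (.op .mul e₁ e₂) (P ∧ Q) :=
  h₁.op h₂ (by by_cases P <;> by_cases Q <;> simp [Op.eval, *]) (by split <;> omega)

lemma Tests.not (h : Tests W σ e P) (hW : 1 ≤ W) : Tests W σ (.op .eq e (.lit 0)) (¬ P) :=
  h.op (hasValue_lit (Nat.zero_le W)) (by by_cases P <;> simp [Op.eval, *]) (by split <;> omega)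

lemma Tests.congr (h : Tests W σ e P) (hPQ : P ↔ Q) : Tests W σ e Q := propext hPQ ▸ h

end Values

section Rules

variable {W B B₁ B₂ i k x y : ℕ} {σ : State} {p q : Program} {e e₁ e₂ : Expr}
  {P : Prop} {post mid : State → Prop}

lemma Runs.mono {post' : State → Prop} (h : Runs W p σ B₁ post) (hB : B₁ ≤ B)
    (hp : ∀ τ, post τ → post' τ) : Runs W p σ B post' := by
  obtain ⟨T, τ, hexec, hT, hτ⟩ := h
  exact ⟨T, τ, hexec, hT.trans hB, hp τ hτ⟩

lemma Runs.skip (h : post σ) (hB : 1 ≤ B) : Runs W .skip σ B post :=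
  ⟨1, σ, .skip σ, hB, h⟩

lemma Runs.set (he : HasValue W σ e x) (h : post (σ.setReg i x)) (hB : e.cost + 1 ≤ B) :
    Runs W (.set i e) σ B post := by
  obtain ⟨hfits, rfl⟩ := he
  exact ⟨_, _, .set σ i e hfits, hB, h⟩

lemma Runs.store (h₁ : HasValue W σ e₁ x) (h₂ : HasValue W σ e₂ y)
    (h : post (σ.setMem k x y)) (hB : e₁.cost + e₂.cost + 1 ≤ B) :
    Runs W (.store k e₁ e₂) σ B post := by
  obtain ⟨hfits₁, rfl⟩ := h₁
  obtain ⟨hfits₂, rfl⟩ := h₂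
  exact ⟨_, _, .store σ k e₁ e₂ hfits₁ hfits₂, hB, h⟩

lemma Runs.seq (h₁ : Runs W p σ B₁ mid) (h₂ : ∀ τ, mid τ → Runs W q τ B₂ post)
    (hB : B₁ + B₂ + 1 ≤ B) : Runs W (.seq p q) σ B post := by
  obtain ⟨T₁, τ, hexec₁, hT₁, hτ⟩ := h₁
  obtain ⟨T₂, τ', hexec₂, hT₂, hτ'⟩ := h₂ τ hτ
  exact ⟨_, τ', .seq hexec₁ hexec₂, by omega, hτ'⟩

lemma Runs.set_seq (he : HasValue W σ e x) (h : Runs W q (σ.setReg i x) B₂ post)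
    (hB : e.cost + B₂ + 2 ≤ B) : Runs W (.seq (.set i e) q) σ B post :=
  Runs.seq (mid := (· = σ.setReg i x)) (.set he rfl le_rfl) (by rintro _ rfl; exact h) (by omega)

lemma Runs.store_seq (h₁ : HasValue W σ e₁ x) (h₂ : HasValue W σ e₂ y)
    (h : Runs W q (σ.setMem k x y) B₂ post) (hB : e₁.cost + e₂.cost + B₂ + 2 ≤ B) :
    Runs W (.seq (.store k e₁ e₂) q) σ B post :=
  Runs.seq (mid := (· = σ.setMem k x y)) (.store h₁ h₂ rfl le_rfl) (by rintro _ rfl; exact h)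
    (by omega)

lemma Runs.ite (he : Tests W σ e P) (h₁ : P → Runs W p σ B₁ post)
    (h₂ : ¬ P → Runs W q σ B₁ post) (hB : e.cost + B₁ + 1 ≤ B) :
    Runs W (.ite e p q) σ B post := by
  obtain ⟨hfits, heval⟩ := he
  by_cases hP : P
  · obtain ⟨T, τ, hexec, hT, hτ⟩ := h₁ hP
    exact ⟨_, τ, .ite_true hfits (by simp [heval, hP]) hexec, by omega, hτ⟩
  · obtain ⟨T, τ, hexec, hT, hτ⟩ := h₂ hP
    exact ⟨_, τ, .ite_false hfits (by simp [heval, hP]) hexec, by omega, hτ⟩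

/-- The first argument of the invariant `I` bounds the number of rounds that are left. -/
lemma Runs.loop (I : ℕ → State → Prop) {guard : State → Prop} {k : ℕ} (hI : I k σ)
    (hguard : ∀ k τ, I k τ → Tests W τ e (guard τ))
    (hbody : ∀ k τ, I k τ → guard τ → Runs W p τ B₁ fun τ' => ∃ k' < k, I k' τ')
    (hpost : ∀ k τ, I k τ → ¬ guard τ → post τ)
    (hB : k * (e.cost + B₁ + 1) + e.cost + 1 ≤ B) : Runs W (.loop e p) σ B post := by
  induction k using Nat.strong_induction_on generalizing σ B with
  | _ k ih =>
    obtain ⟨hfits, heval⟩ := hguard k σ hI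
    by_cases hg : guard σ
    · obtain ⟨T, τ, hexec, hT, k', hk', hI'⟩ := hbody k σ hI hg
      have hrounds : k' * (e.cost + B₁ + 1) + (e.cost + B₁ + 1) ≤ k * (e.cost + B₁ + 1) := by
        rw [← Nat.succ_mul]
        exact Nat.mul_le_mul_right _ hk'
      obtain ⟨T', τ', hexec', hT', hτ'⟩ :=
        ih k' hk' hI' (B := k' * (e.cost + B₁ + 1) + e.cost + 1) le_rfl
      exact ⟨_, τ', .loop_step hfits (by simp [heval, hg]) hexec hexec', by omega, hτ'⟩
    · exact ⟨_, σ, .loop_done hfits (by simp [heval, hg]), by omega, hpost k σ hI hg⟩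

end Rules

section State

variable (σ : State) (i j k x : ℕ)

@[simp] lemma setReg_reg : (σ.setReg i x).reg j = if j = i then x else σ.reg j := by
  simp [State.setReg, Function.update_apply]

@[simp] lemma setReg_mem : (σ.setReg i x).mem = σ.mem := rfl

@[simp] lemma setMem_reg : (σ.setMem k j x).reg = σ.reg := rfl

lemma setMem_mem_self (j' : ℕ) :
    (σ.setMem k j x).mem k j' = if j' = j then x else σ.mem k j' := by
  simp [State.setMem, Function.update_apply]

lemma setMem_mem_of_ne {k' : ℕ} (h : k' ≠ k) : (σ.setMem k j x).mem k' = σ.mem k' := by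
  simp [State.setMem, Function.update_of_ne h]

end State

/-- The array `k` starts with the entries of `l`. -/
def Stores (τ : State) (k : ℕ) (l : List ℕ) : Prop :=
  ∀ i (hi : i < l.length), τ.mem k i = l[i]

section Stores

variable {τ τ' : State} {k : ℕ} {l : List ℕ}

lemma stores_nil : Stores τ k [] := fun _ hi => absurd hi (Nat.not_lt_zero _)

lemma Stores.concat (h : Stores τ k l) (x : ℕ) :
    Stores (τ.setMem k l.length x) k (l ++ [x]) := by
  intro i hi
  rw [setMem_mem_self]
  split_ifs with h'
  · subst h'
    simp
  · rw [List.length_append, List.length_singleton] at hi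
    rw [List.getElem_append_left (by omega), h i (by omega)]

lemma Stores.congr (h : Stores τ k l) (hmem : τ'.mem k = τ.mem k) : Stores τ' k l :=
  fun i hi => (congrFun hmem i).trans (h i hi)

lemma Stores.holds {m i : ℕ} {l : List (Fin m)} (h : Stores τ k (l.map Fin.val))
    (hi : τ.reg i = l.length) : Holds τ i k l :=
  ⟨hi, fun j hj => (h j (by simpa using hj)).trans (by simp)⟩

end Stores

section DartIndex

variable {m : ℕ}

lemma dartIndex_lt (d : Fin m × Bool) : dartIndex d < 2 * m := by
  have := d.1.2
  unfold dartIndex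
  split <;> omega

lemma dartIndex_div (d : Fin m × Bool) : dartIndex d / 2 = d.1 := by
  unfold dartIndex
  split <;> omega

lemma dartIndex_mod (d : Fin m × Bool) : dartIndex d % 2 = if d.2 then 0 else 1 := by
  unfold dartIndex
  split <;> omega

lemma dartIndex_true (a : Fin m) : dartIndex (a, true) = 2 * (a : ℕ) := by simp [dartIndex]

lemma dartIndex_false (a : Fin m) : dartIndex (a, false) = 2 * (a : ℕ) + 1 := by simp [dartIndex]

lemma dartIndex_injective : Function.Injective (dartIndex (m := m)) := by
  rintro ⟨a, b⟩ ⟨a', b'⟩ h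
  have hdiv := congrArg (· / 2) h
  have hmod := congrArg (· % 2) h
  simp only [dartIndex_div, dartIndex_mod] at hdiv hmod
  obtain rfl := Fin.ext hdiv
  cases b <;> cases b' <;> simp_all

end DartIndex

/-! ### Graph search -/

/-- Mark the dart `e` and append it to the queue unless it is already marked. -/
def push (M : ℕ) (e : Expr) : Program :=
  .seq (.set 13 e) (.ite (.mem M (.reg 13)) .skip
    (.seq (.store M (.reg 13) (.lit 1)) (.seq (.store 11 (.reg 11) (.reg 13))
      (.set 11 (.op .add (.reg 11) (.lit 1))))))

/-- Take the next dart from the queue and push its two successors: the next dart around its vertex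
and the dart given by `e` when it is in register 12. -/
def visit (M : ℕ) (e : Expr) : Program :=
  .seq (.set 12 (.mem 11 (.reg 10))) (.seq (.set 10 (.op .add (.reg 10) (.lit 1)))
    (.seq (push M (.mem 2 (.reg 12))) (push M e)))

/-- Breadth-first search from the dart `start`. The queue is kept in array 11, from the position in
register 10 up to the one in register 11, and the darts that are reached are marked in array
`M`. -/
def search (M : ℕ) (start e : Expr) : Program :=
  .seq (.set 10 (.lit 0)) (.seq (.set 11 (.lit 0)) (.seq (push M start)
    (.loop (.op .lt (.reg 10) (.reg 11)) (visit M e))))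

/-- The states `σ` and `τ` agree except for the arrays in `K` and for the registers from 10 on, on
which the searches work. -/
structure Agree (K : Set ℕ) (σ τ : State) : Prop where
  reg : ∀ i < 10, τ.reg i = σ.reg i
  mem : ∀ k ∉ K, τ.mem k = σ.mem k

section Agree

variable {K K' : Set ℕ} {σ τ υ : State}

lemma Agree.refl (σ : State) : Agree K σ σ := ⟨fun _ _ => rfl, fun _ _ => rfl⟩

lemma Agree.trans (h : Agree K σ τ) (h' : Agree K τ υ) : Agree K σ υ :=
  ⟨fun i hi => (h'.reg i hi).trans (h.reg i hi), fun k hk => (h'.mem k hk).trans (h.mem k hk)⟩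

lemma Agree.mono (h : Agree K σ τ) (hK : K ⊆ K') : Agree K' σ τ :=
  ⟨h.reg, fun k hk => h.mem k fun hk' => hk (hK hk')⟩

lemma Agree.setReg (h : Agree K σ τ) {i : ℕ} (hi : 10 ≤ i) (x : ℕ) :
    Agree K σ (τ.setReg i x) :=
  ⟨fun j hj => by rw [setReg_reg, if_neg (by omega), h.reg j hj], h.mem⟩

lemma Agree.setMem (h : Agree K σ τ) {k : ℕ} (hk : k ∈ K) (j x : ℕ) :
    Agree K σ (τ.setMem k j x) :=
  ⟨h.reg, fun k' hk' => by
    rw [setMem_mem_of_ne _ _ _ _ (ne_of_mem_of_not_mem hk hk').symm, h.mem k' hk']⟩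

end Agree

variable {m W M : ℕ}

open Classical in
/-- The array `M` marks the darts of the set `S`. -/
structure Marks (τ : State) (M : ℕ) (S : Set (Fin m × Bool)) : Prop where
  mark : ∀ d, τ.mem M (dartIndex d) = if d ∈ S then 1 else 0
  mark_eq_zero : ∀ j, 2 * m ≤ j → τ.mem M j = 0

/-- The list `q` is the content of the queue, including the darts already taken from it, and
exactly its elements are marked. -/
structure QueueHolds (M : ℕ) (τ : State) (q : List (Fin m × Bool)) : Prop where
  nodup : q.Nodup
  length : τ.reg 11 = q.length
  stores : Stores τ 11 (q.map dartIndex)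
  marks : Marks τ M {d | d ∈ q}

section Queue

variable {τ τ' : State} {S : Set (Fin m × Bool)} {q : List (Fin m × Bool)} {d : Fin m × Bool}

lemma Marks.congr (h : Marks τ M S) (hmem : τ'.mem M = τ.mem M) : Marks τ' M S :=
  ⟨fun d => by rw [hmem, h.mark], fun j hj => by rw [hmem, h.mark_eq_zero j hj]⟩

lemma Marks.insert (h : Marks τ M S) (d : Fin m × Bool) :
    Marks (τ.setMem M (dartIndex d) 1) M (insert d S) := by
  classical
  refine ⟨fun x => ?_, fun j hj => ?_⟩
  · rw [setMem_mem_self, h.mark]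
    rcases eq_or_ne x d with rfl | hx
    · rw [if_pos rfl, if_pos (Set.mem_insert x S)]
    · rw [if_neg (dartIndex_injective.ne hx)]
      simp [Set.mem_insert_iff, hx]
  · have := dartIndex_lt d
    rw [setMem_mem_self, if_neg (by omega), h.mark_eq_zero j hj]

lemma marks_empty (h : ∀ j, τ.mem M j = 0) : Marks (m := m) τ M ∅ :=
  ⟨fun d => by simp [h], fun j _ => h j⟩

lemma QueueHolds.length_le (h : QueueHolds M τ q) : q.length ≤ 2 * m := by
  simpa [mul_comm] using h.nodup.length_le_card

lemma QueueHolds.congr (h : QueueHolds M τ q) (hreg : τ'.reg 11 = τ.reg 11)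
    (hmem : τ'.mem = τ.mem) : QueueHolds M τ' q :=
  ⟨h.nodup, hreg.trans h.length, h.stores.congr (by rw [hmem]), h.marks.congr (by rw [hmem])⟩

lemma queueHolds_nil (hreg : τ.reg 11 = 0) (hmem : ∀ j, τ.mem M j = 0) :
    QueueHolds (m := m) M τ [] :=
  ⟨List.nodup_nil, hreg, stores_nil, by simpa using marks_empty hmem⟩

lemma QueueHolds.concat (h : QueueHolds M τ q) (hM : M ≠ 11) (hd : d ∉ q) :
    QueueHolds M (((τ.setMem M (dartIndex d) 1).setMem 11 q.length (dartIndex d)).setReg 11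
      (q.length + 1)) (q ++ [d]) where
  nodup := List.nodup_append.2 ⟨h.nodup, List.nodup_singleton d, by
    rintro a ha b hb rfl
    exact hd (List.mem_singleton.1 hb ▸ ha)⟩
  length := by simp
  stores := by
    have hq := (h.stores.congr (setMem_mem_of_ne τ (dartIndex d) M 1 hM.symm)).concat (dartIndex d)
    rw [List.length_map] at hq
    rw [List.map_append]
    exact hq.congr rfl
  marks := by
    have hS : {x | x ∈ q ++ [d]} = insert d {x | x ∈ q} := by
      ext x
      simp [or_comm]
    rw [hS]
    exact (h.marks.insert d).congr (setMem_mem_of_ne _ _ _ _ hM)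

lemma Marks.tests (h : Marks τ M S) {e : Expr} (he : HasValue W τ e (dartIndex d))
    (hW : 1 ≤ W) : Tests W τ (.mem M e) (d ∈ S) :=
  he.mem (h.mark d) (by split <;> omega)

lemma runs_push {e : Expr} (hM : M ≠ 11) (hW : 2 * m + 2 ≤ W) (hq : QueueHolds M τ q)
    (he : HasValue W τ e (dartIndex d)) :
    Runs W (push M e) τ (e.cost + 20) fun τ' => Agree {M, 11} τ τ' ∧ τ'.reg 10 = τ.reg 10 ∧
      τ'.reg 12 = τ.reg 12 ∧ ∃ q', QueueHolds M τ' q' ∧ q <+: q' ∧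
        ∀ x, x ∈ q' ↔ x ∈ q ∨ x = d := by
  have hlen := hq.length_le
  have hlt := dartIndex_lt d
  have hq' : QueueHolds M (τ.setReg 13 (dartIndex d)) q := hq.congr (by simp) rfl
  have hd : HasValue W (τ.setReg 13 (dartIndex d)) (.reg 13) (dartIndex d) :=
    hasValue_reg (by simp) (by omega)
  have hframe : Agree {M, 11} τ (τ.setReg 13 (dartIndex d)) := (Agree.refl τ).setReg (by omega) _
  refine .set_seq he (B₂ := 18) (.ite (B₁ := 15) (hq'.marks.tests hd (by omega))
    (fun hdq => ?_) (fun hdq => ?_) (by simp [Expr.cost])) (by omega)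
  · refine .skip ⟨hframe, by simp, by simp, q, hq', List.prefix_rfl, fun x => ?_⟩ (by omega)
    exact ⟨.inl, fun hx => hx.elim id fun hx => hx ▸ hdq⟩
  · refine .store_seq (x := dartIndex d) hd (hasValue_lit (by omega)) (B₂ := 11)
      (.store_seq (x := q.length) (y := dartIndex d) (hasValue_reg hq'.length (by omega)) hd
        (B₂ := 5) (.set (x := q.length + 1) ?_ ⟨?_, by simp, by simp, q ++ [d],
          hq'.concat hM hdq, List.prefix_append q [d], by simp⟩ (by simp [Expr.cost]))
        (by simp [Expr.cost])) (by simp [Expr.cost])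
    · exact (hasValue_reg hq'.length (by omega)).add (hasValue_lit (by omega)) (by omega)
    · exact ((hframe.setMem (by simp) _ _).setMem (by simp) _ _).setReg (by omega) _

end Queue

section Reachable

variable {α : Type*} {F₁ F₂ : α → α} {x : α}

/-- The set of points that can be reached from `x` by applying `F₁` and `F₂`. -/
def reachable (F₁ F₂ : α → α) (x : α) : Set α :=
  {y | Relation.ReflTransGen (fun y z => z = F₁ y ∨ z = F₂ y) x y}

lemma self_mem_reachable : x ∈ reachable F₁ F₂ x := .refl

lemma left_mem_reachable {y : α} (hy : y ∈ reachable F₁ F₂ x) : F₁ y ∈ reachable F₁ F₂ x :=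
  hy.tail (.inl rfl)

lemma right_mem_reachable {y : α} (hy : y ∈ reachable F₁ F₂ x) : F₂ y ∈ reachable F₁ F₂ x :=
  hy.tail (.inr rfl)

lemma reachable_subset {S : Set α} (hx : x ∈ S) (hS : ∀ y ∈ S, F₁ y ∈ S ∧ F₂ y ∈ S) :
    reachable F₁ F₂ x ⊆ S := by
  intro y hy
  induction hy with
  | refl => exact hx
  | tail _ h ih =>
    rcases h with rfl | rfl
    exacts [(hS _ ih).1, (hS _ ih).2]

end Reachable

section Search

variable {F₁ F₂ : Fin m × Bool → Fin m × Bool} {d₀ : Fin m × Bool} {σ τ : State}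
  {q : List (Fin m × Bool)} {i : ℕ} {start e : Expr}

/-- The invariant of the search: `q` is the queue, and its first `i` darts have been visited. -/
structure SearchInvariant (F₁ F₂ : Fin m × Bool → Fin m × Bool) (d₀ : Fin m × Bool) (M : ℕ)
    (σ τ : State) (q : List (Fin m × Bool)) (i : ℕ) : Prop where
  agree : Agree {M, 11} σ τ
  queue : QueueHolds M τ q
  reg_visited : τ.reg 10 = i
  start_mem : d₀ ∈ q
  mem_reachable : ∀ d ∈ q, d ∈ reachable F₁ F₂ d₀
  visited : ∀ d ∈ q.take i, F₁ d ∈ q ∧ F₂ d ∈ q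

lemma SearchInvariant.reachable_eq (h : SearchInvariant F₁ F₂ d₀ M σ τ q i)
    (hi : q.length ≤ i) : reachable F₁ F₂ d₀ = {d | d ∈ q} := by
  refine (reachable_subset (S := {d | d ∈ q}) h.start_mem fun d hd => ?_).antisymm h.mem_reachable
  exact h.visited d (by rwa [List.take_of_length_le hi])

lemma runs_visit (hM : M ≠ 11) (hM' : M ≠ 2) (hW : 2 * m + 2 ≤ W)
    (hnext : ∀ d, σ.mem 2 (dartIndex d) = dartIndex (F₁ d))
    (hmove : ∀ τ d, Agree {M, 11} σ τ → τ.reg 12 = dartIndex d →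
      HasValue W τ e (dartIndex (F₂ d)))
    (h : SearchInvariant F₁ F₂ d₀ M σ τ q i) (hi : i < q.length) :
    Runs W (visit M e) τ (e.cost + 55) fun τ' =>
      ∃ q', SearchInvariant F₁ F₂ d₀ M σ τ' q' (i + 1) := by
  have hlen := h.queue.length_le
  have hx : q[i] ∈ q := List.getElem_mem hi
  have hlt := dartIndex_lt q[i]
  have hhead : HasValue W τ (.reg 10) i := hasValue_reg h.reg_visited (by omega)
  refine .set_seq (x := dartIndex q[i]) (B₂ := e.cost + 50) (hhead.mem ?_ (by omega))
    (.set_seq (x := i + 1) (B₂ := e.cost + 45) ?_ (.seq (B₁ := 22) (B₂ := e.cost + 20)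
      (runs_push (d := F₁ q[i]) (q := q) hM hW (h.queue.congr (by simp) rfl) ?_)
      ?_ (by omega)) (by simp only [Expr.cost]; omega)) (by simp only [Expr.cost]; omega)
  · rw [h.queue.stores i (by simpa using hi), List.getElem_map]
  · exact (hasValue_reg (by simpa using h.reg_visited) (by omega)).add (hasValue_lit (by omega))
      (by omega)
  · have := dartIndex_lt (F₁ q[i])
    refine (hasValue_reg (x := dartIndex q[i]) (by simp) (by omega)).mem ?_ (by omega)
    rw [setReg_mem, setReg_mem, h.agree.mem 2 (by simp [hM'.symm]), hnext]
  · rintro τ₁ ⟨hagree₁, hhead₁, hcur₁, q₁, hq₁, hpre₁, hmem₁⟩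
    have hagree : Agree {M, 11} σ τ₁ :=
      ((h.agree.setReg (by omega) _).setReg (by omega) _).trans hagree₁
    refine (runs_push hM hW hq₁ (hmove τ₁ q[i] hagree (by simpa using hcur₁))).mono le_rfl ?_
    rintro τ₂ ⟨hagree₂, hhead₂, -, q₂, hq₂, hpre₂, hmem₂⟩
    have hpre := hpre₁.trans hpre₂
    refine ⟨q₂, hagree.trans hagree₂, hq₂, by simp [hhead₂, hhead₁], hpre.mem h.start_mem,
      fun d hd => ?_, fun d hd => ?_⟩
    · rcases (hmem₂ d).1 hd with hd | rfl
      · rcases (hmem₁ d).1 hd with hd | rfl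
        exacts [h.mem_reachable d hd, left_mem_reachable (h.mem_reachable _ hx)]
      · exact right_mem_reachable (h.mem_reachable _ hx)
    · obtain ⟨r, hr⟩ := id hpre
      rw [← hr, List.take_append_of_le_length hi, List.take_add_one,
        List.getElem?_eq_getElem hi] at hd
      rcases List.mem_append.1 hd with hd | hd
      · exact (h.visited d hd).imp (hpre.mem ·) (hpre.mem ·)
      · obtain rfl : d = q[i] := by simpa using hd
        exact ⟨hpre₂.mem ((hmem₁ _).2 (.inr rfl)), (hmem₂ _).2 (.inr rfl)⟩

lemma runs_search (hM : M ≠ 11) (hM' : M ≠ 2) (hW : 2 * m + 2 ≤ W) (hz : ∀ j, σ.mem M j = 0)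
    (hnext : ∀ d, σ.mem 2 (dartIndex d) = dartIndex (F₁ d))
    (hmove : ∀ τ d, Agree {M, 11} σ τ → τ.reg 12 = dartIndex d →
      HasValue W τ e (dartIndex (F₂ d)))
    (hstart : ∀ τ, Agree {M, 11} σ τ → HasValue W τ start (dartIndex d₀)) :
    Runs W (search M start e) σ (2 * m * (e.cost + 60) + start.cost + 40) fun τ =>
      Agree {M, 11} σ τ ∧ Marks τ M (reachable F₁ F₂ d₀) := by
  have hagree₀ : Agree {M, 11} σ ((σ.setReg 10 0).setReg 11 0) :=
    ((Agree.refl σ).setReg le_rfl _).setReg (by omega) _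
  refine .set_seq (hasValue_lit (Nat.zero_le W)) (.set_seq (hasValue_lit (Nat.zero_le W))
    (.seq (runs_push hM hW (queueHolds_nil (by simp) hz) (hstart _ hagree₀))
      (B₂ := 2 * m * (e.cost + 60) + 5) ?_ le_rfl) le_rfl) (by simp only [Expr.cost]; omega)
  rintro τ ⟨hagree, hhead, -, q, hq, -, hmem⟩
  refine .loop (fun k τ => ∃ q, SearchInvariant F₁ F₂ d₀ M σ τ q (τ.reg 10) ∧
      k + τ.reg 10 = 2 * m) (guard := fun τ => τ.reg 10 < τ.reg 11) (k := 2 * m)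
    (B₁ := e.cost + 55) ⟨q, ⟨hagree₀.trans hagree, hq, by simp [hhead], by simp [hmem], ?_,
      by simp [hhead]⟩, by simp [hhead]⟩ ?_ ?_ ?_ ?_
  · intro d hd
    obtain rfl : d = d₀ := by simpa using (hmem d).1 hd
    exact self_mem_reachable
  · rintro k τ ⟨q, h, hk⟩
    have := h.queue.length_le
    have := h.queue.length
    exact (hasValue_reg rfl (by omega)).tests_lt (hasValue_reg rfl (by omega)) (by omega)
  · rintro k τ ⟨q, h, hk⟩ hlt
    have hlen := h.queue.length_le
    rw [h.queue.length] at hlt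
    refine (runs_visit hM hM' hW hnext hmove h hlt).mono le_rfl ?_
    rintro τ' ⟨q', h'⟩
    have hvisited := h'.reg_visited
    exact ⟨k - 1, by omega, q', by rwa [hvisited], by omega⟩
  · rintro k τ ⟨q, h, -⟩ hge
    rw [h.queue.length, not_lt] at hge
    exact ⟨h.agree, h.reachable_eq hge ▸ h.queue.marks⟩
  · have : 2 * m * (1 + 1 + 1 + (e.cost + 55) + 1) ≤ 2 * m * (e.cost + 60) :=
      Nat.mul_le_mul_left _ (by omega)
    simp only [Expr.cost]
    omega

end Search

end RAM

namespace EmbeddedDigraph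

variable {V A : Type*} {G : EmbeddedDigraph V A} {v w : V} {Z : Set V} {a : A}

variable (G) in
/-- The set of vertices that can be reached from `v` without leaving a vertex of `Z`. -/
def reachFrom (v : V) (Z : Set V) : Set V := {w | ∃ l, G.IsWalk v l w ∧ ∀ a ∈ l, G.src a ∉ Z}

variable (G) in
/-- The set of vertices from which `v` can be reached without entering a vertex of `Z`. -/
def reachTo (v : V) (Z : Set V) : Set V := {w | ∃ l, G.IsWalk w l v ∧ ∀ a ∈ l, G.tgt a ∉ Z}

lemma self_mem_reachFrom : v ∈ G.reachFrom v Z := ⟨[], rfl, by simp⟩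

lemma self_mem_reachTo : v ∈ G.reachTo v Z := ⟨[], rfl, by simp⟩

lemma tgt_mem_reachFrom (h : G.src a ∈ G.reachFrom v Z) (ha : G.src a ∉ Z) :
    G.tgt a ∈ G.reachFrom v Z := by
  obtain ⟨l, hl, hZ⟩ := h
  refine ⟨l ++ [a], hl.append ⟨rfl, rfl⟩, ?_⟩
  simpa [or_imp, forall_and] using ⟨hZ, ha⟩

lemma src_mem_reachTo (h : G.tgt a ∈ G.reachTo v Z) (ha : G.tgt a ∉ Z) :
    G.src a ∈ G.reachTo v Z := by
  obtain ⟨l, hl, hZ⟩ := h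
  exact ⟨a :: l, ⟨rfl, hl⟩, by simpa using ⟨ha, hZ⟩⟩

lemma reachFrom_subset_range_vert (hv : v ∈ Set.range G.vert) :
    G.reachFrom v Z ⊆ Set.range G.vert := by
  rintro w ⟨l, hl, -⟩
  rcases eq_or_ne v w with rfl | hne
  · exact hv
  · obtain ⟨a, -, rfl⟩ := hl.exists_tgt_eq_end hne
    exact ⟨(a, false), rfl⟩

lemma reachTo_subset_range_vert (hv : v ∈ Set.range G.vert) :
    G.reachTo v Z ⊆ Set.range G.vert := by
  rintro w ⟨_ | ⟨a, l⟩, hl, -⟩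
  · exact isWalk_nil.1 hl ▸ hv
  · exact ⟨(a, true), hl.1⟩

lemma IsSCC.eq_reachFrom_inter_reachTo {C : Set V} (hC : G.IsSCC C) (hv : v ∈ C) :
    C = G.reachFrom v ∅ ∩ G.reachTo v ∅ := by
  ext w
  rw [hC.eq_of_mem hv]
  simp [reachFrom, reachTo, Reachable]

lemma reachFrom_inter_eq {s : V} {C : Set V} :
    G.reachFrom s C ∩ C = {v | G.IsEntrance s C v} := by
  ext v
  refine ⟨fun ⟨⟨l, hl, hlC⟩, hv⟩ => isEntrance_of_isWalk hv hl hlC, fun hv => ?_⟩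
  obtain ⟨l, hl, hlC⟩ := hv.exists_path
  exact ⟨⟨l, hl.1, hlC⟩, hv.1⟩

lemma reachTo_inter_eq {t : V} {C : Set V} : G.reachTo t C ∩ C = {v | G.IsExit t C v} := by
  ext v
  refine ⟨fun ⟨⟨l, hl, hlC⟩, hv⟩ => isExit_of_isWalk hv hl hlC, fun hv => ?_⟩
  obtain ⟨l, hl, hlC⟩ := hv.exists_path
  exact ⟨⟨l, hl.1, hlC⟩, hv.1⟩

lemma IsExit.sink_mem_range_vert {t : V} {C : Set V} (h : G.IsExit t C v) (ht : t ∉ C) :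
    t ∈ Set.range G.vert := by
  obtain ⟨hv, l, hl, -⟩ := h
  obtain ⟨a, -, rfl⟩ := hl.1.exists_tgt_eq_end (ne_of_mem_of_not_mem hv ht)
  exact ⟨(a, false), rfl⟩

open Classical in
variable (G) in
/-- Go to the other end of an arc, starting from its tail if `b` is true and from its head
otherwise, unless the vertex from which one starts lies in `Z`. -/
noncomputable def move (b : Bool) (Z : Set V) (d : A × Bool) : A × Bool :=
  if d.2 = b ∧ G.vert d ∉ Z then flip d else d

lemma move_of_mem {b : Bool} {d : A × Bool} (hd : G.vert d ∈ Z) : G.move b Z d = d :=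
  if_neg fun h => h.2 hd

lemma move_of_notMem {b : Bool} (ha : G.vert (a, b) ∉ Z) : G.move b Z (a, b) = (a, !b) :=
  if_pos ⟨rfl, ha⟩

lemma move_not (b : Bool) : G.move b Z (a, !b) = (a, !b) :=
  if_neg fun h => Bool.not_ne_self b h.1

open RAM

variable {d d' d₀ : A × Bool}

lemma IsPlane.mem_reachable_of_vert_eq [Finite A] (hG : G.IsPlane) {F : A × Bool → A × Bool}
    (h : d ∈ reachable G.rot F d₀) (hd : G.vert d = G.vert d') :
    d' ∈ reachable G.rot F d₀ := by
  obtain ⟨k, rfl⟩ := ((hG.rot_sameCycle d d').2 hd).exists_nat_pow_eq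
  clear hd
  induction k with
  | zero => exact h
  | succ k ih =>
    rw [pow_succ', Equiv.Perm.mul_apply]
    exact left_mem_reachable ih

lemma IsPlane.reachable_move_true [Finite A] (hG : G.IsPlane) :
    reachable G.rot (G.move true Z) d₀ = G.vert ⁻¹' G.reachFrom (G.vert d₀) Z := by
  refine Set.Subset.antisymm
    (reachable_subset (by exact self_mem_reachFrom) fun d hd => ⟨?_, ?_⟩) ?_
  · rwa [Set.mem_preimage, hG.vert_rot]
  · by_cases hZ : G.vert d ∈ Z
    · rwa [move_of_mem hZ]
    · obtain ⟨a, _ | _⟩ := d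
      · rwa [← Bool.not_true, move_not]
      · rw [move_of_notMem hZ]
        exact tgt_mem_reachFrom hd hZ
  · have follow : ∀ (l : List A) (x : A × Bool), x ∈ reachable G.rot (G.move true Z) d₀ →
        (∀ a ∈ l, G.src a ∉ Z) → ∀ d, G.IsWalk (G.vert x) l (G.vert d) →
          d ∈ reachable G.rot (G.move true Z) d₀ := by
      intro l
      induction l with
      | nil => exact fun x hx _ d hl => hG.mem_reachable_of_vert_eq hx hl
      | cons a l ih =>
        intro x hx hZ d hl
        have hmove := right_mem_reachable (hG.mem_reachable_of_vert_eq (d' := (a, true)) hx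
          hl.1.symm)
        rw [move_of_notMem (hZ a (by simp))] at hmove
        exact ih (a, false) hmove (fun b hb => hZ b (by simp [hb])) d hl.2
    rintro d ⟨l, hl, hZ⟩
    exact follow l d₀ self_mem_reachable hZ d hl

lemma IsPlane.reachable_move_false [Finite A] (hG : G.IsPlane) :
    reachable G.rot (G.move false Z) d₀ = G.vert ⁻¹' G.reachTo (G.vert d₀) Z := by
  refine Set.Subset.antisymm
    (reachable_subset (by exact self_mem_reachTo) fun d hd => ⟨?_, ?_⟩) ?_
  · rwa [Set.mem_preimage, hG.vert_rot]
  · by_cases hZ : G.vert d ∈ Z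
    · rwa [move_of_mem hZ]
    · obtain ⟨a, _ | _⟩ := d
      · rw [move_of_notMem hZ]
        exact src_mem_reachTo hd hZ
      · rwa [← Bool.not_false, move_not]
  · rintro d ⟨l, hl, hZ⟩
    induction l generalizing d with
    | nil => exact hG.mem_reachable_of_vert_eq self_mem_reachable (Eq.symm hl)
    | cons a l ih =>
      have hmove := right_mem_reachable (ih (d := (a, false)) hl.2 fun b hb => hZ b
        (by simp [hb]))
      rw [move_of_notMem (hZ a (by simp))] at hmove
      exact hG.mem_reachable_of_vert_eq hmove hl.1

end EmbeddedDigraph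

namespace RAM

open EmbeddedDigraph

/-- The move along the arc of the dart in register 12 if the dart is at its tail, where `b` tells
which vertices are blocked. -/
def forward (b : Expr → Expr) : Expr :=
  .op .add (.reg 12) (.op .mul (.op .sub (.lit 1) (.op .mod (.reg 12) (.lit 2)))
    (.op .sub (.lit 1) (b (.mem 0 (.op .div (.reg 12) (.lit 2))))))

/-- The move along the arc of the dart in register 12 if the dart is at its head, where `b` tells
which vertices are blocked. -/
def backward (b : Expr → Expr) : Expr :=
  .op .sub (.reg 12) (.op .mul (.op .mod (.reg 12) (.lit 2))
    (.op .sub (.lit 1) (b (.mem 1 (.op .div (.reg 12) (.lit 2))))))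

/-- The search from the vertex in register `i` along the arcs, which does not leave the vertices
that `b` tells. -/
def searchForward (M i : ℕ) (b : Expr → Expr) : Program := search M (.mem 4 (.reg i)) (forward b)

/-- The search from the vertex in register `i` against the arcs, which does not leave the vertices
that `b` tells. -/
def searchBackward (M i : ℕ) (b : Expr → Expr) : Program :=
  search M (.mem 4 (.reg i)) (backward b)

/-- The expression `b` tells which vertices lie in `Z`. -/
def Decides {n : ℕ} (W : ℕ) (τ : State) (b : Expr → Expr) (Z : Set (Fin n)) : Prop :=
  ∀ e (v : Fin n), HasValue W τ e v → Tests W τ (b e) (v ∈ Z)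

/-- The arrays hold the arcs of `G`, the successors of its darts and a dart at every vertex. -/
structure HoldsGraph {n m : ℕ} (G : EmbeddedDigraph (Fin n) (Fin m)) (τ : State) : Prop where
  src : ∀ a : Fin m, τ.mem 0 a = G.src a
  tgt : ∀ a : Fin m, τ.mem 1 a = G.tgt a
  next : ∀ d, τ.mem 2 (dartIndex d) = dartIndex (G.rot d)
  first : ∀ v ∈ Set.range G.vert, ∃ d, G.vert d = v ∧ τ.mem 4 (v : Fin n) = dartIndex d
  first_isolated : ∀ v ∉ Set.range G.vert, τ.mem 4 (v : Fin n) = 2 * m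

open Classical in
/-- The array `M` marks, for every vertex of `S` and for no other vertex, the dart that array `4`
gives. -/
def MarksVertices {n : ℕ} (τ : State) (M : ℕ) (S : Set (Fin n)) : Prop :=
  ∀ v : Fin n, τ.mem M (τ.mem 4 v) = if v ∈ S then 1 else 0

section VertexSearch

variable {n m W M i : ℕ} {G : EmbeddedDigraph (Fin n) (Fin m)} {S Z : Set (Fin n)} {v : Fin n}
  {σ τ τ' : State} {b : Expr → Expr} {e : Expr} {d : Fin m × Bool}

lemma IsInput.holdsGraph {s t c : Fin n} (h : IsInput G s t c σ) : HoldsGraph G σ where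
  src := h.src
  tgt := h.tgt
  next := h.next
  first := h.first
  first_isolated := h.first_isolated

lemma HoldsGraph.congr (h : HoldsGraph G τ) (hmem : ∀ k < 5, τ'.mem k = τ.mem k) :
    HoldsGraph G τ' := by
  obtain ⟨h₁, h₂, h₃, h₄, h₅⟩ := h
  constructor <;> simpa only [hmem 0, hmem 1, hmem 2, hmem 4, Nat.reduceLT]

lemma HoldsGraph.first_lt_iff (h : HoldsGraph G τ) :
    τ.mem 4 v < 2 * m ↔ v ∈ Set.range G.vert := by
  by_cases hv : v ∈ Set.range G.vert
  · obtain ⟨d, -, hd⟩ := h.first v hv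
    simp [hd, hv, dartIndex_lt]
  · simp [h.first_isolated v hv, hv]

lemma HoldsGraph.first_le (h : HoldsGraph G τ) (v : Fin n) : τ.mem 4 v ≤ 2 * m := by
  by_cases hv : v ∈ Set.range G.vert
  · exact (h.first_lt_iff.2 hv).le
  · exact (h.first_isolated v hv).le

lemma MarksVertices.congr (h : MarksVertices τ M S) (hmem₄ : τ'.mem 4 = τ.mem 4)
    (hmem : τ'.mem M = τ.mem M) : MarksVertices τ' M S := by
  simpa only [MarksVertices, hmem₄, hmem] using h

lemma MarksVertices.tests (h : MarksVertices τ M S) (hG : HoldsGraph G τ)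
    (hW : 2 * m + 1 ≤ W) (he : HasValue W τ e v) : Tests W τ (.mem M (.mem 4 e)) (v ∈ S) :=
  (he.mem rfl ((hG.first_le v).trans (by omega))).mem (h v) (by split <;> omega)

lemma Marks.marksVertices (h : Marks τ M (G.vert ⁻¹' S)) (hG : HoldsGraph G τ)
    (hS : S ⊆ Set.range G.vert) : MarksVertices τ M S := by
  intro v
  by_cases hv : v ∈ Set.range G.vert
  · obtain ⟨d, rfl, hd⟩ := hG.first v hv
    rw [hd, h.mark]
    rfl
  · rw [hG.first_isolated v hv, h.mark_eq_zero _ le_rfl, if_neg fun h => hv (hS h)]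

lemma decides_empty : Decides (n := n) W τ (fun _ => .lit 0) ∅ := by
  intro e v _
  simpa [Tests] using hasValue_lit (Nat.zero_le W)

lemma hasValue_forward (hW : n + 2 * m + 2 ≤ W) (hG : HoldsGraph G τ) (hb : Decides W τ b Z)
    (hd : τ.reg 12 = dartIndex d) :
    HasValue W τ (forward b) (dartIndex (G.move true Z d)) := by
  have hlt := dartIndex_lt d
  have hlt' := dartIndex_lt (G.move true Z d)
  have hdart := hasValue_reg (W := W) hd (by omega)
  have htwo : HasValue W τ (.lit 2) 2 := hasValue_lit (by omega)
  have hone : HasValue W τ (.lit 1) 1 := hasValue_lit (by omega)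
  have harc := hdart.op htwo (o := .div) (dartIndex_div d) (by omega)
  have hblocked := hb _ _ (harc.mem (hG.src d.1) (by omega))
  have hend := hdart.op htwo (o := .mod) (dartIndex_mod d) (by split <;> omega)
  refine hdart.op ((hone.sub hend (by omega)).op (hone.sub hblocked (by omega)) (o := .mul) rfl ?_)
    ?_ (by omega)
  · exact (Nat.mul_le_mul (Nat.sub_le 1 _) (Nat.sub_le 1 _)).trans (by omega)
  · obtain ⟨a, _ | _⟩ := d
    · simp [Op.eval, move]
    · by_cases h : G.src a ∈ Z <;> simp [Op.eval, move, h, dartIndex_true, dartIndex_false]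

lemma hasValue_backward (hW : n + 2 * m + 2 ≤ W) (hG : HoldsGraph G τ) (hb : Decides W τ b Z)
    (hd : τ.reg 12 = dartIndex d) :
    HasValue W τ (backward b) (dartIndex (G.move false Z d)) := by
  have hlt := dartIndex_lt d
  have hlt' := dartIndex_lt (G.move false Z d)
  have hdart := hasValue_reg (W := W) hd (by omega)
  have htwo : HasValue W τ (.lit 2) 2 := hasValue_lit (by omega)
  have hone : HasValue W τ (.lit 1) 1 := hasValue_lit (by omega)
  have harc := hdart.op htwo (o := .div) (dartIndex_div d) (by omega)
  have hblocked := hb _ _ (harc.mem (hG.tgt d.1) (by omega))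
  have hend := hdart.op htwo (o := .mod) (dartIndex_mod d) (by split <;> omega)
  refine hdart.op (hend.op (hone.sub hblocked (by omega)) (o := .mul) rfl ?_) ?_ (by omega)
  · exact (Nat.mul_le_mul (n₂ := 1) (by split <;> omega) (Nat.sub_le 1 _)).trans (by omega)
  · obtain ⟨a, _ | _⟩ := d
    · by_cases h : G.tgt a ∈ Z <;> simp [Op.eval, move, h, dartIndex_true, dartIndex_false]
    · simp [Op.eval, move]

lemma runs_search_vertices {F : Fin m × Bool → Fin m × Bool} (hM : 5 ≤ M) (hM' : M ≠ 11)
    (hi : i < 10) (hW : n + 2 * m + 2 ≤ W) (hσ : HoldsGraph G σ) (hz : ∀ j, σ.mem M j = 0)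
    (hreg : σ.reg i = v) (hv : v ∈ Set.range G.vert)
    (hmove : ∀ τ d, Agree {M, 11} σ τ → HoldsGraph G τ → τ.reg 12 = dartIndex d →
      HasValue W τ e (dartIndex (F d)))
    (hreach : ∀ d, G.vert d = v → reachable G.rot F d = G.vert ⁻¹' S)
    (hS : S ⊆ Set.range G.vert) :
    Runs W (search M (.mem 4 (.reg i)) e) σ (2 * m * (e.cost + 60) + 42) fun τ =>
      Agree {M, 11} σ τ ∧ MarksVertices τ M S := by
  obtain ⟨d₀, hd₀, hfirst⟩ := hσ.first v hv
  have holds : ∀ τ, Agree {M, 11} σ τ → HoldsGraph G τ := fun τ h =>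
    hσ.congr fun k hk => h.mem k (by simp; omega)
  refine (runs_search (F₁ := G.rot) (F₂ := F) (d₀ := d₀) hM' (by omega) (by omega) hz hσ.next
    (fun τ d h => hmove τ d h (holds τ h)) fun τ h => ?_).mono le_rfl ?_
  · have := dartIndex_lt d₀
    refine (hasValue_reg ((h.reg i hi).trans hreg) (by omega)).mem ?_ (by omega)
    rw [h.mem 4 (by simp; omega), hfirst]
  · rintro τ ⟨h, hmarks⟩
    rw [hreach d₀ hd₀] at hmarks
    exact ⟨h, hmarks.marksVertices (holds τ h) hS⟩

lemma runs_searchForward (hM : 5 ≤ M) (hM' : M ≠ 11) (hi : i < 10) (hW : n + 2 * m + 2 ≤ W)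
    (hG : G.IsPlane) (hσ : HoldsGraph G σ) (hz : ∀ j, σ.mem M j = 0) (hreg : σ.reg i = v)
    (hv : v ∈ Set.range G.vert) (hb : ∀ τ, Agree {M, 11} σ τ → Decides W τ b Z) :
    Runs W (searchForward M i b) σ (2 * m * ((forward b).cost + 60) + 42) fun τ =>
      Agree {M, 11} σ τ ∧ MarksVertices τ M (G.reachFrom v Z) :=
  runs_search_vertices hM hM' hi hW hσ hz hreg hv
    (fun τ _ h hτ hd => hasValue_forward hW hτ (hb τ h) hd)
    (fun d hd => by rw [hG.reachable_move_true, hd]) (reachFrom_subset_range_vert hv)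

lemma runs_searchBackward (hM : 5 ≤ M) (hM' : M ≠ 11) (hi : i < 10) (hW : n + 2 * m + 2 ≤ W)
    (hG : G.IsPlane) (hσ : HoldsGraph G σ) (hz : ∀ j, σ.mem M j = 0) (hreg : σ.reg i = v)
    (hv : v ∈ Set.range G.vert) (hb : ∀ τ, Agree {M, 11} σ τ → Decides W τ b Z) :
    Runs W (searchBackward M i b) σ (2 * m * ((backward b).cost + 60) + 42) fun τ =>
      Agree {M, 11} σ τ ∧ MarksVertices τ M (G.reachTo v Z) :=
  runs_search_vertices hM hM' hi hW hσ hz hreg hv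
    (fun τ _ h hτ hd => hasValue_backward hW hτ (hb τ h) hd)
    (fun d hd => by rw [hG.reachable_move_false, hd]) (reachTo_subset_range_vert hv)

end VertexSearch

/-! ### The searches of the algorithm -/

/-- Membership of a vertex in the component, when arrays 7 and 8 mark what can be reached from the
component and what can reach it. -/
def inComponent (v : Expr) : Expr := .op .mul (.mem 7 (.mem 4 v)) (.mem 8 (.mem 4 v))

/-- The searches in both directions from the given vertex of the component. -/
def searchComponent : Program :=
  .seq (searchForward 7 4 fun _ => .lit 0) (searchBackward 8 4 fun _ => .lit 0)

/-- The search from the sink backwards to the component, unless the sink is isolated. -/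
def searchFromSink : Program :=
  .ite (.op .lt (.mem 4 (.reg 3)) (.op .mul (.lit 2) (.reg 1))) (searchBackward 10 3 inComponent)
    .skip

/-- The searches that determine the component, its entrances and its exits. -/
def searches : Program :=
  .seq searchComponent (.seq (searchForward 9 2 inComponent) searchFromSink)

section Searches

variable {n m W : ℕ} {G : EmbeddedDigraph (Fin n) (Fin m)} {s t c : Fin n} {C : Set (Fin n)}
  {σ τ τ' : State}

variable (G C) in
/-- The arrays hold `G` and `C`. -/
structure HoldsComponent (τ : State) : Prop extends HoldsGraph G τ where
  component : ∃ S₁ S₂, MarksVertices τ 7 S₁ ∧ MarksVertices τ 8 S₂ ∧ S₁ ∩ S₂ = C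

variable (G s t C) in
/-- The arrays hold `G`, `C`, its entrances and its exits. -/
structure Ready (τ : State) : Prop extends HoldsComponent G C τ where
  entrance : ∃ S, MarksVertices τ 9 S ∧ S ∩ C = {v | G.IsEntrance s C v}
  exit : ∃ S, MarksVertices τ 10 S ∧ S ∩ C = {v | G.IsExit t C v}

lemma HoldsComponent.congr (h : HoldsComponent G C τ) (hmem : ∀ k < 9, k ≠ 5 → k ≠ 6 →
    τ'.mem k = τ.mem k) : HoldsComponent G C τ' := by
  have hmem₄ := hmem 4 (by omega) (by omega) (by omega)
  obtain ⟨hG, S₁, S₂, h₁, h₂, hC⟩ := h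
  exact ⟨hG.congr fun k hk => hmem k (by omega) (by omega) (by omega), S₁, S₂,
    h₁.congr hmem₄ (hmem 7 (by omega) (by omega) (by omega)),
    h₂.congr hmem₄ (hmem 8 (by omega) (by omega) (by omega)), hC⟩

lemma Ready.congr (h : Ready G s t C τ) (hmem : ∀ k, k ≠ 5 → k ≠ 6 → τ'.mem k = τ.mem k) :
    Ready G s t C τ' := by
  have hmem₄ := hmem 4 (by omega) (by omega)
  obtain ⟨hC, ⟨S, hS, hentrance⟩, T, hT, hexit⟩ := h
  exact ⟨hC.congr fun k _ => hmem k, ⟨S, hS.congr hmem₄ (hmem 9 (by omega) (by omega)), hentrance⟩,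
    T, hT.congr hmem₄ (hmem 10 (by omega) (by omega)), hexit⟩

lemma HoldsComponent.decides (h : HoldsComponent G C τ) (hW : 2 * m + 1 ≤ W) :
    Decides W τ inComponent C := by
  obtain ⟨hG, S₁, S₂, h₁, h₂, rfl⟩ := h
  exact fun e v he => (h₁.tests hG hW he).and (h₂.tests hG hW he) (by omega)

lemma runs_searchComponent (hW : n + 2 * m + 2 ≤ W) (hN : G.IsNormalNetwork s t)
    (hC : G.IsOutsideComponent s t C) (hc : c ∈ C) (hσ : IsInput G s t c σ) :
    Runs W searchComponent σ (300 * m + 100) fun τ =>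
      Agree {7, 8, 11} σ τ ∧ HoldsComponent G C τ := by
  have hcrange : c ∈ Set.range G.vert := by
    obtain ⟨a, -, rfl⟩ := (hC.isCubicComponent hN).exists_tgt_eq hc
    exact ⟨(a, false), rfl⟩
  refine .seq (runs_searchForward (by omega) (by omega) (by omega) hW hN.plane hσ.holdsGraph
    (fun j => hσ.mem_zero 7 j (by omega)) hσ.reg_c hcrange fun _ _ => decides_empty)
    (B₂ := 150 * m + 42) ?_ (by simp only [forward, Expr.cost]; omega)
  rintro τ₁ ⟨h₁, hfwd⟩
  refine (runs_searchBackward (by omega) (by omega) (by omega) hW hN.plane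
    (hσ.holdsGraph.congr fun k hk => h₁.mem k (by simp; omega)) (fun j => ?_)
    ((h₁.reg 4 (by omega)).trans hσ.reg_c) hcrange fun _ _ => decides_empty).mono
    (by simp only [backward, Expr.cost]; omega) ?_
  · rw [h₁.mem 8 (by simp), hσ.mem_zero 8 j (by omega)]
  · rintro τ₂ ⟨h₂, hbwd⟩
    have h : Agree {7, 8, 11} σ τ₂ :=
      (h₁.mono (by grind)).trans (h₂.mono (by grind))
    exact ⟨h, hσ.holdsGraph.congr fun k hk => h.mem k (by simp; omega), _, _,
      hfwd.congr (h₂.mem 4 (by simp)) (h₂.mem 7 (by simp)), hbwd,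
      (hC.scc.eq_reachFrom_inter_reachTo hc).symm⟩

lemma runs_searchFromSink (hW : n + 2 * m + 2 ≤ W) (hG : G.IsPlane) (ht : t ∉ C)
    (hσ : HoldsComponent G C σ) (hz : ∀ j, σ.mem 10 j = 0) (hreg_m : σ.reg 1 = m)
    (hreg_t : σ.reg 3 = t) :
    Runs W searchFromSink σ (180 * m + 60) fun τ =>
      Agree {10, 11} σ τ ∧ ∃ S, MarksVertices τ 10 S ∧ S ∩ C = {v | G.IsExit t C v} := by
  have htest : Tests W σ (.op .lt (.mem 4 (.reg 3)) (.op .mul (.lit 2) (.reg 1)))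
      (t ∈ Set.range G.vert) := by
    have hfirst := hσ.first_le t
    exact (((hasValue_reg hreg_t (by omega)).mem rfl (by omega)).tests_lt
      ((hasValue_lit (by omega)).mul (hasValue_reg hreg_m (by omega)) (by omega))
      (by omega)).congr hσ.first_lt_iff
  refine .ite htest (B₁ := 180 * m + 42) (fun htrange => ?_) (fun htrange => ?_)
    (by simp only [Expr.cost]; omega)
  · refine (runs_searchBackward (Z := C) (by omega) (by omega) (by omega) hW hG hσ.toHoldsGraph hz
      hreg_t htrange fun τ h => ?_).mono
      (by simp only [backward, inComponent, Expr.cost]; omega) ?_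
    · exact (hσ.congr fun k _ _ _ => h.mem k (by simp; omega)).decides (by omega)
    · exact fun τ ⟨h, hmarks⟩ => ⟨h, _, hmarks, reachTo_inter_eq⟩
  · refine .skip ⟨Agree.refl σ, ∅, fun v => by simp [hz], ?_⟩ (by omega)
    rw [Set.empty_inter]
    exact (Set.eq_empty_of_forall_notMem fun v hv => htrange (hv.sink_mem_range_vert ht)).symm

lemma runs_searches (hW : n + 2 * m + 2 ≤ W) (hN : G.IsNormalNetwork s t)
    (hC : G.IsOutsideComponent s t C) (hc : c ∈ C) (hσ : IsInput G s t c σ) :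
    Runs W searches σ (700 * m + 300) fun τ =>
      Agree {7, 8, 9, 10, 11} σ τ ∧ Ready G s t C τ := by
  have hsrange : s ∈ Set.range G.vert := by
    obtain ⟨a, rfl, -⟩ := hN.source_out
    exact ⟨(a, true), rfl⟩
  refine .seq (runs_searchComponent hW hN hC hc hσ) (B₂ := 400 * m + 150) ?_ (by omega)
  rintro τ₁ ⟨h₁, hτ₁⟩
  refine .seq (runs_searchForward (by omega) (by omega) (by omega) hW hN.plane hτ₁.toHoldsGraph
    (fun j => ?_) ((h₁.reg 2 (by omega)).trans hσ.reg_s) hsrange (Z := C) fun τ h => ?_)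
    (B₂ := 180 * m + 60) ?_ (by simp only [forward, inComponent, Expr.cost]; omega)
  · rw [h₁.mem 9 (by simp), hσ.mem_zero 9 j (by omega)]
  · exact (hτ₁.congr fun k _ _ _ => h.mem k (by simp; omega)).decides (by omega)
  rintro τ₂ ⟨h₂, hentrance⟩
  have h₁₂ : Agree {7, 8, 9, 11} σ τ₂ := (h₁.mono (by grind)).trans (h₂.mono (by grind))
  refine (runs_searchFromSink hW hN.plane hC.sink_notMem
    (hτ₁.congr fun k _ _ _ => h₂.mem k (by simp; omega)) (fun j => ?_)
    ((h₁₂.reg 1 (by omega)).trans hσ.reg_m) ((h₁₂.reg 3 (by omega)).trans hσ.reg_t)).mono le_rfl ?_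
  · rw [h₁₂.mem 10 (by simp), hσ.mem_zero 10 j (by omega)]
  · rintro τ₃ ⟨h₃, hexit⟩
    refine ⟨(h₁₂.mono (by grind)).trans (h₃.mono (by grind)), hτ₁.congr fun k _ _ _ => ?_,
      ⟨_, hentrance.congr (h₃.mem 4 (by simp)) (h₃.mem 9 (by simp)), reachFrom_inter_eq⟩, hexit⟩
    rw [h₃.mem k (by simp; omega), h₂.mem k (by simp; omega)]

end Searches

/-! ### Following the boundary -/

/-- Whether both ends of an arc lie in the component. -/
def arcInComponent (e : Expr) : Expr := .op .mul (inComponent (.mem 0 e)) (inComponent (.mem 1 e))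

/-- Whether an arc of the component starts at an entrance, when array 9 holds the result of the
search from the source. -/
def startsAtEntrance (e : Expr) : Expr := .op .mul (arcInComponent e) (.mem 9 (.mem 4 (.mem 0 e)))

/-- Whether an arc of the component starts at an exit, when array 10 holds the result of the search
from the sink. -/
def startsAtExit (e : Expr) : Expr := .op .mul (arcInComponent e) (.mem 10 (.mem 4 (.mem 0 e)))

/-- Write to register `i` an arc that passes the test, or the number of arcs if there is none. -/
def findArc (test : Expr → Expr) (i : ℕ) : Program :=
  .seq (.set i (.reg 1)) (.seq (.set 5 (.lit 0))
    (.loop (.op .lt (.reg 5) (.reg 1))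
      (.seq (.ite (test (.reg 5)) (.set i (.reg 5)) .skip) (.set 5 (.op .add (.reg 5) (.lit 1))))))

/-- Replace the boundary arc in register 8 by the next one. -/
def nextArc : Program :=
  .seq (.set 14 (.mem 2 (.op .add (.op .mul (.lit 2) (.reg 8)) (.lit 1))))
    (.seq (.ite (arcInComponent (.op .div (.reg 14) (.lit 2))) .skip (.set 14 (.mem 2 (.reg 14))))
      (.set 8 (.op .div (.reg 14) (.lit 2))))

/-- Append the boundary arc in register 8 to the list that array `k` and register `i` hold, and
replace it by the next one. -/
def collectArc (i k : ℕ) : Program :=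
  .seq (.store k (.reg i) (.reg 8)) (.seq (.set i (.op .add (.reg i) (.lit 1))) nextArc)

section Boundary

variable {n m W i k : ℕ} {G : EmbeddedDigraph (Fin n) (Fin m)} {s t : Fin n} {C : Set (Fin n)}
  {σ τ : State} {e : Expr} {a b b' : Fin m}

lemma HoldsComponent.tests_arcInComponent (h : HoldsComponent G C τ) (hW : n + 2 * m + 2 ≤ W)
    (he : HasValue W τ e a) : Tests W τ (arcInComponent e) (a ∈ G.arcsOf C) :=
  (h.decides (by omega) _ _ (he.mem (h.src a) (by omega))).and
    (h.decides (by omega) _ _ (he.mem (h.tgt a) (by omega))) (by omega)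

lemma HoldsComponent.tests_src (h : HoldsComponent G C τ) (hW : n + 2 * m + 2 ≤ W) {M : ℕ}
    {S : Set (Fin n)} {P : Fin n → Prop} (hM : MarksVertices τ M S) (hS : S ∩ C = {v | P v})
    (he : HasValue W τ e a) :
    Tests W τ (.op .mul (arcInComponent e) (.mem M (.mem 4 (.mem 0 e))))
      (a ∈ G.arcsOf C ∧ P (G.src a)) := by
  refine ((h.tests_arcInComponent hW he).and
    (hM.tests h.toHoldsGraph (by omega) (he.mem (h.src a) (by omega))) (by omega)).congr
      (and_congr_right fun ha => ?_)
  rw [Set.ext_iff] at hS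
  exact ⟨fun h => (hS _).1 ⟨h, ha.1⟩, fun h => ((hS _).2 h).1⟩

lemma Ready.tests_startsAtEntrance (h : Ready G s t C τ) (hW : n + 2 * m + 2 ≤ W)
    (he : HasValue W τ e a) :
    Tests W τ (startsAtEntrance e) (a ∈ G.arcsOf C ∧ G.IsEntrance s C (G.src a)) := by
  obtain ⟨S, hM, hS⟩ := h.entrance
  exact h.tests_src hW hM hS he

lemma Ready.tests_startsAtExit (h : Ready G s t C τ) (hW : n + 2 * m + 2 ≤ W)
    (he : HasValue W τ e a) :
    Tests W τ (startsAtExit e) (a ∈ G.arcsOf C ∧ G.IsExit t C (G.src a)) := by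
  obtain ⟨S, hM, hS⟩ := h.exit
  exact h.tests_src hW hM hS he

/-- The number `x` is that of an arc with the property `P`, or it is `m` and no arc with number less
than `r` has the property. -/
def IsSearchResult (P : Fin m → Prop) (r x : ℕ) : Prop :=
  (x = m ∧ ∀ b : Fin m, (b : ℕ) < r → ¬ P b) ∨ ∃ b, P b ∧ x = b

lemma IsSearchResult.succ {P : Fin m → Prop} {x : ℕ} (h : IsSearchResult P a x) (ha : ¬ P a) :
    IsSearchResult P (a + 1) x := by
  refine h.imp_left fun ⟨hx, hlt⟩ => ⟨hx, fun b hb => ?_⟩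
  rcases Nat.lt_succ_iff_lt_or_eq.1 hb with h | h
  · exact hlt b h
  · exact Fin.ext h ▸ ha

lemma IsSearchResult.le {P : Fin m → Prop} {r x : ℕ} (h : IsSearchResult P r x) : x ≤ m := by
  rcases h with ⟨rfl, -⟩ | ⟨b, -, rfl⟩
  exacts [le_rfl, b.2.le]

lemma IsSearchResult.lt_iff {P : Fin m → Prop} {x : ℕ} (h : IsSearchResult P m x) :
    x < m ↔ ∃ b, P b := by
  rcases h with ⟨rfl, hlt⟩ | ⟨b, hb, rfl⟩
  · simpa using fun b => hlt b b.2
  · simpa using ⟨b, hb⟩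

/-- The effect on the state `σ` of the first `r` rounds of a search for an arc with the property `P`
whose result goes to register `i`. -/
structure FindInvariant (P : Fin m → Prop) (i : ℕ) (σ : State) (r x : ℕ) (τ : State) : Prop where
  mem : τ.mem = σ.mem
  reg : ∀ j, j ≠ i → j ≠ 5 → τ.reg j = σ.reg j
  reg_five : τ.reg 5 = r
  result : IsSearchResult P x (τ.reg i)

lemma FindInvariant.runs_round {test : Expr → Expr} {P : Fin m → Prop} (hi₅ : i ≠ 5)
    (hW : m + 1 ≤ W) (h : FindInvariant P i σ a a τ)
    (htest : Tests W τ (test (.reg 5)) (P a)) :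
    Runs W (.seq (.ite (test (.reg 5)) (.set i (.reg 5)) .skip)
      (.set 5 (.op .add (.reg 5) (.lit 1)))) τ ((test (.reg 5)).cost + 8)
      (FindInvariant P i σ (a + 1) (a + 1)) := by
  refine .seq (mid := FindInvariant P i σ a (a + 1)) (B₂ := 4)
    (.ite htest (B₁ := 2) (fun hP => ?_) (fun hP => ?_) le_rfl) ?_ (by omega)
  · refine .set (hasValue_reg h.reg_five (by omega)) ⟨h.mem, fun j hj => ?_, ?_, ?_⟩ le_rfl
    · simpa [hj] using h.reg j hj
    · simpa [hi₅.symm] using h.reg_five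
    · exact .inr ⟨a, hP, by simp⟩
  · exact .skip ⟨h.mem, h.reg, h.reg_five, h.result.succ hP⟩ (by omega)
  · rintro τ' h'
    refine .set ((hasValue_reg h'.reg_five (by omega)).add (hasValue_lit (by omega)) (by omega))
      ⟨h'.mem, fun j hj hj₅ => ?_, by simp, ?_⟩ le_rfl
    · simpa [hj₅] using h'.reg j hj hj₅
    · simpa [hi₅] using h'.result

lemma runs_findArc {test : Expr → Expr} {P : Fin m → Prop} (hi₁ : i ≠ 1) (hi₅ : i ≠ 5)
    (hW : m + 1 ≤ W) (hreg : σ.reg 1 = m)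
    (htest : ∀ (τ : State) (a : Fin m), τ.mem = σ.mem → τ.reg 5 = a →
      Tests W τ (test (.reg 5)) (P a)) :
    Runs W (findArc test i) σ (m * ((test (.reg 5)).cost + 20) + 20) fun τ =>
      τ.mem = σ.mem ∧ (∀ j, j ≠ i → j ≠ 5 → τ.reg j = σ.reg j) ∧ IsSearchResult P m (τ.reg i) := by
  have hcount (τ : State) {r : ℕ} (h : FindInvariant P i σ r r τ) : τ.reg 1 = m :=
    (h.reg 1 hi₁.symm (by omega)).trans hreg
  refine .set_seq (x := m) (B₂ := m * ((test (.reg 5)).cost + 20) + 10)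
    (hasValue_reg hreg (by omega)) (.set_seq (hasValue_lit (Nat.zero_le W))
    (.loop (fun k τ => ∃ r, r + k = m ∧ FindInvariant P i σ r r τ) (guard := fun τ => τ.reg 5 < m)
      (k := m) (B₁ := (test (.reg 5)).cost + 8) ⟨0, Nat.zero_add m, ?_⟩ ?_ ?_ ?_ le_rfl) ?_) ?_
  · exact ⟨rfl, by simp +contextual, by simp, .inl ⟨by simp [hi₅], by simp⟩⟩
  · rintro k τ ⟨r, hr, h⟩
    exact (hasValue_reg rfl (by rw [h.reg_five]; omega)).tests_lt
      (hasValue_reg (hcount τ h) (by omega)) (by omega)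
  · rintro k τ ⟨r, hr, h⟩ hlt
    obtain ⟨a, rfl⟩ : ∃ a : Fin m, r = a := ⟨⟨r, h.reg_five ▸ hlt⟩, rfl⟩
    exact (h.runs_round hi₅ hW (htest τ a h.mem h.reg_five)).mono le_rfl fun τ' h' =>
      ⟨k - 1, by omega, a + 1, by omega, h'⟩
  · rintro k τ ⟨r, hr, h⟩ hle
    obtain rfl : r = m := by
      have := h.reg_five
      omega
    exact ⟨h.mem, h.reg, h.result⟩
  · simp only [Expr.cost]
    grind
  · simp only [Expr.cost]
    omega

lemma hasValue_div_two {d : Fin m × Bool} (hW : 2 * m + 2 ≤ W) (h : τ.reg i = dartIndex d) :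
    HasValue W τ (.op .div (.reg i) (.lit 2)) d.1 := by
  have := dartIndex_lt d
  exact (hasValue_reg h (by omega)).op (hasValue_lit (by omega)) (dartIndex_div d) (by omega)

lemma runs_nextArc (hW : n + 2 * m + 2 ≤ W) (hC : G.IsCubicComponent C)
    (hτ : HoldsComponent G C τ) (hb : b ∈ G.boundary C) (hb' : b' ∈ G.boundary C)
    (hbb' : G.src b' = G.tgt b) (hreg : τ.reg 8 = b) :
    Runs W nextArc τ 70 fun τ' => τ'.reg 8 = b' ∧
      (∀ i, i ≠ 8 → i ≠ 14 → τ'.reg i = τ.reg i) ∧ τ'.mem = τ.mem := by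
  set d := G.rot (b, false)
  have hlt := dartIndex_lt d
  have hlt_b := dartIndex_lt (b, false)
  have hlt_b' := dartIndex_lt (b', true)
  have hnext : HasValue W τ (.mem 2 (.op .add (.op .mul (.lit 2) (.reg 8)) (.lit 1)))
      (dartIndex d) := by
    rw [dartIndex_false] at hlt_b
    refine ((((hasValue_lit (by omega)).mul (hasValue_reg hreg (by omega)) (by omega)).add
      (hasValue_lit (by omega)) (by omega))).mem ?_ (by omega)
    rw [← dartIndex_false, hτ.next]
  refine .set_seq (B₂ := 60) hnext (.seq (mid := fun τ' => τ'.reg 14 = dartIndex (b', true) ∧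
      (∀ i, i ≠ 8 → i ≠ 14 → τ'.reg i = τ.reg i) ∧ τ'.mem = τ.mem) (B₁ := 50) (B₂ := 5)
    (.ite (B₁ := 5) (HoldsComponent.tests_arcInComponent (hτ.congr fun _ _ _ _ => rfl) hW
      (hasValue_div_two (d := d) (by omega) (by simp))) (fun hdC => ?_) (fun hdC => ?_)
      (by simp [Expr.cost, arcInComponent, inComponent])) ?_ (by omega)) (by simp [Expr.cost])
  · rcases hC.rot_of_src_eq_tgt hb hb' hbb' with hd | ⟨hd, -⟩
    · exact .skip ⟨by simp [d, hd], fun i _ hi => by simp [hi], rfl⟩ (by omega)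
    · exact absurd hdC hd
  · rcases hC.rot_of_src_eq_tgt hb hb' hbb' with hd | ⟨-, hd⟩
    · exact absurd (by simpa only [d, hd] using hb'.1) hdC
    · refine .set (x := dartIndex (b', true)) ?_ ⟨by simp, fun i _ hi => by simp [hi], rfl⟩
        (by simp [Expr.cost])
      refine (hasValue_reg (x := dartIndex d) (by simp) (by omega)).mem ?_ (by omega)
      rw [setReg_mem, hτ.next, hd]
  · rintro τ' ⟨hreg', hother, hmem⟩
    refine .set (hasValue_div_two (by omega) hreg') ⟨by simp, fun i hi hi' => ?_, hmem⟩
      (by simp [Expr.cost])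
    rw [setReg_reg, if_neg hi, hother i hi hi']

lemma runs_collectArc (hi : i ≠ 8) (hi' : i ≠ 14) (hk : k = 5 ∨ k = 6)
    (hW : n + 2 * m + 2 ≤ W) (hC : G.IsCubicComponent C) (hτ : HoldsComponent G C τ)
    (hb : b ∈ G.boundary C) (hb' : b' ∈ G.boundary C) (hbb' : G.src b' = G.tgt b)
    (hreg : τ.reg 8 = b) {l : List (Fin m)} (hl : l.length < m) (hcount : τ.reg i = l.length)
    (hstores : Stores τ k (l.map Fin.val)) :
    Runs W (collectArc i k) τ 90 fun τ' => τ'.reg 8 = b' ∧ τ'.reg i = (l ++ [b]).length ∧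
      Stores τ' k ((l ++ [b]).map Fin.val) ∧
      (∀ j, j ≠ i → j ≠ 8 → j ≠ 14 → τ'.reg j = τ.reg j) ∧ ∀ j ≠ k, τ'.mem j = τ.mem j := by
  refine .store_seq (hasValue_reg hcount (by omega)) (hasValue_reg hreg (by omega))
    (.set_seq ((hasValue_reg hcount (by omega)).add (hasValue_lit (by omega)) (by omega))
      ((runs_nextArc hW hC (hτ.congr fun j _ h₅ h₆ => ?_) hb hb' hbb' ?_).mono le_rfl ?_)
      le_rfl) (by simp [Expr.cost])
  · rw [setReg_mem, setMem_mem_of_ne]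
    omega
  · simpa [hi.symm] using hreg
  · rintro τ' ⟨h₈, hother, hmem⟩
    refine ⟨h₈, ?_, ?_, fun j hj hj₈ hj₁₄ => ?_, fun j hj => ?_⟩
    · rw [hother i hi hi']
      simp
    · rw [List.map_append]
      exact (List.length_map (as := l) Fin.val ▸ hstores.concat (b : ℕ)).congr (by simp [hmem])
    · rw [hother j hj₈ hj₁₄]
      simp [hj]
    · rw [hmem, setReg_mem, setMem_mem_of_ne _ _ _ _ hj]

end Boundary

end RAM

namespace EmbeddedDigraph

section LastExit

variable {V A : Type*} {G : EmbeddedDigraph V A} {s t u v : V} {C : Set V} {Q l X Y Z : List A}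
  {a b z : A}

lemma IsWalk.src_eq_tgt (h : G.IsWalk u (X ++ a :: b :: Y) v) : G.src b = G.tgt a := by
  obtain ⟨w, -, -, h, -⟩ := isWalk_append.1 h
  exact h

/-- The list `l` starts at an exit, and none of its later arcs does. -/
def StartsAtLastExit (G : EmbeddedDigraph V A) (t : V) (C : Set V) (l : List A) : Prop :=
  ∃ a l', l = a :: l' ∧ G.IsExit t C (G.src a) ∧ ∀ b ∈ l', ¬ G.IsExit t C (G.src b)

lemma StartsAtLastExit.concat (h : G.StartsAtLastExit t C l) (ha : ¬ G.IsExit t C (G.src a)) :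
    G.StartsAtLastExit t C (l ++ [a]) := by
  obtain ⟨b, l', rfl, hb, hl'⟩ := h
  refine ⟨b, l' ++ [a], rfl, hb, fun c hc => ?_⟩
  rcases List.mem_append.1 hc with hc | hc
  · exact hl' c hc
  · exact List.mem_singleton.1 hc ▸ ha

lemma IsOutsideComponent.isCut_of_startsAtLastExit [Finite A]
    (hC : G.IsOutsideComponent s t C) (hN : G.IsNormalNetwork s t) (hQ : G.IsBoundaryCycle C Q)
    (hrot : Q ~r X ++ Y ++ z :: Z) (hwalk : G.IsWalk u (X ++ Y ++ z :: Z) u)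
    (hz : G.IsEntrance s C (G.src z)) (hY : G.StartsAtLastExit t C Y)
    (hYe : ∀ a ∈ Y, ¬ G.IsEntrance s C (G.src a)) :
    ∃ x, G.IsCut s t C Q (z :: (Z ++ X)) Y (G.src z) x := by
  obtain ⟨y, Y, rfl, hy, hYx⟩ := hY
  have hrot' : Q ~r z :: (Z ++ X) ++ y :: Y :=
    hrot.trans (by simpa using List.isRotated_append (l := X ++ y :: Y) (l' := z :: Z))
  obtain ⟨_, hXY, rfl, hZ⟩ := isWalk_append.1 hwalk
  obtain ⟨_, hX, rfl, hYw⟩ := isWalk_append.1 hXY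
  have hleft : G.IsWalk (G.src z) (z :: (Z ++ X)) (G.src y) := ⟨rfl, hZ.append hX⟩
  have hright : G.IsWalk (G.src y) (y :: Y) (G.src z) := ⟨rfl, hYw⟩
  have htgt {a : A} (ha : a ∈ y :: Y) : G.tgt a = G.src z ∨ ∃ b ∈ y :: Y, G.src b = G.tgt a :=
    hright.mem_support_iff.1 (tgt_mem_support ha)
  refine ⟨G.src y, hrot', hz, hy, hleft, hright, fun a ha hax => ?_, fun a ha hae => ?_⟩
  · rcases htgt ha with h | ⟨b, hb, hba⟩
    · exact hC.not_isExit_of_isEntrance hN hz (h ▸ hax)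
    rcases List.mem_cons.1 hb with rfl | hb
    · have hnodup : ((z :: (Z ++ X) ++ b :: Y).map G.tgt).Nodup :=
        (hrot'.perm.map G.tgt).nodup_iff.1 hQ.1.2.2
      rw [List.map_append, List.nodup_append] at hnodup
      obtain ⟨c, hc, hcb⟩ := hleft.exists_tgt_eq_end fun h =>
        hC.not_isExit_of_isEntrance hN hz (h ▸ hy)
      exact hnodup.2.2 _ (List.mem_map_of_mem hc) _ (List.mem_map_of_mem ha) (hcb.trans hba)
    · exact hYx b hb (hba ▸ hax)
  · exact (htgt ha).resolve_right fun ⟨b, hb, hba⟩ => hYe b hb (hba ▸ hae)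

end LastExit

end EmbeddedDigraph

namespace RAM

open EmbeddedDigraph

/-! ### The two paths -/

/-- Empty the list in array 6 if the arc in register 8 starts at an exit. -/
def restartAtExit : Program := .ite (startsAtExit (.reg 8)) (.set 9 (.lit 0)) .skip

/-- Follow the boundary to the first entrance; collect the arcs since the last exit in array 6. -/
def collectSecond : Program :=
  .seq (.set 9 (.lit 0)) (.loop (.op .eq (startsAtEntrance (.reg 8)) (.lit 0))
    (.seq restartAtExit (collectArc 9 6)))

/-- Follow the boundary up to the first arc in array 6; collect the arcs in array 5. -/
def collectFirst : Program :=
  .seq (.set 15 (.lit 0))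
    (.loop (.op .eq (.op .eq (.reg 8) (.mem 6 (.lit 0))) (.lit 0)) (collectArc 15 5))

/-- The second part of the algorithm, for a component with an entrance and an exit: split the
boundary, which is entered at an arc that starts at an exit. -/
def collectPaths : Program :=
  .seq collectSecond (.seq collectFirst
    (.seq (.set 0 (.lit 1)) (.seq (.set 1 (.reg 15)) (.set 2 (.reg 9)))))

/-- Write to register 7 an arc that starts at an entrance, and to register 8 one that starts at an
exit. -/
def findArcs : Program := .seq (findArc startsAtEntrance 7) (findArc startsAtExit 8)

/-- The algorithm: it splits the boundary if there are an entrance and an exit; otherwise all arcs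
of the component are useless. -/
def splitBoundary : Program :=
  .seq searches (.seq findArcs
    (.ite (.op .mul (.op .lt (.reg 7) (.reg 1)) (.op .lt (.reg 8) (.reg 1))) collectPaths
      (.set 0 (.lit 0))))

section Collect

variable {n m W : ℕ} {G : EmbeddedDigraph (Fin n) (Fin m)} {s t u : Fin n} {C : Set (Fin n)}
  {σ τ : State} {L X Y Z U V : List (Fin m)} {q v w y z : Fin m}

/-- The progress of `collectSecond` from the state `σ` on the list `L` of boundary arcs: the arcs in
`X` and `Y` have been passed, `Y` is in array 6, and `z` is the next arc. -/
structure CollectSecondInvariant (G : EmbeddedDigraph (Fin n) (Fin m)) (s t : Fin n)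
    (C : Set (Fin n)) (σ : State) (L X Y : List (Fin m)) (z : Fin m) (Z : List (Fin m))
    (τ : State) : Prop where
  mem : ∀ k ≠ 6, τ.mem k = σ.mem k
  split : L = X ++ Y ++ z :: Z
  reg_eight : τ.reg 8 = z
  reg_nine : τ.reg 9 = Y.length
  stores : Stores τ 6 (Y.map Fin.val)
  not_isEntrance : ∀ a ∈ X ++ Y, ¬ G.IsEntrance s C (G.src a)
  exit : G.StartsAtLastExit t C Y ∨ Y = [] ∧ G.IsExit t C (G.src z)

lemma CollectSecondInvariant.startsAtLastExit (hN : G.IsNormalNetwork s t)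
    (hC : G.IsOutsideComponent s t C) (h : CollectSecondInvariant G s t C σ L X Y z Z τ)
    (hz : G.IsEntrance s C (G.src z)) : G.StartsAtLastExit t C Y :=
  h.exit.resolve_right fun hx => hC.not_isExit_of_isEntrance hN hz hx.2

lemma CollectSecondInvariant.ready (h : CollectSecondInvariant G s t C σ L X Y z Z τ)
    (hσ : Ready G s t C σ) : Ready G s t C τ :=
  hσ.congr fun k _ hk => h.mem k hk

lemma CollectSecondInvariant.runs_restartAtExit (hW : n + 2 * m + 2 ≤ W) (hσ : Ready G s t C σ)
    (h : CollectSecondInvariant G s t C σ L X Y z Z τ) (hz : z ∈ G.arcsOf C) :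
    Runs W restartAtExit τ 30 fun τ' => ∃ X' Y', CollectSecondInvariant G s t C σ L X' Y' z Z τ' ∧
      G.StartsAtLastExit t C (Y' ++ [z]) := by
  have htest := ((h.ready hσ).tests_startsAtExit hW
    (hasValue_reg h.reg_eight (by omega))).congr (and_iff_right hz)
  refine .ite htest (B₁ := 2) (fun hzx => ?_) (fun hzx => ?_)
    (by simp [Expr.cost, startsAtExit, arcInComponent, inComponent])
  · refine .set (hasValue_lit (Nat.zero_le W)) ⟨X ++ Y, [], ⟨h.mem, ?_, ?_, ?_, stores_nil, ?_,
      .inr ⟨rfl, hzx⟩⟩, z, [], rfl, hzx, by simp⟩ le_rfl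
    · simpa using h.split
    · simpa using h.reg_eight
    · simp
    · simpa using h.not_isEntrance
  · exact .skip ⟨X, Y, h, (h.exit.resolve_right fun hx => hzx hx.2).concat hzx⟩ (by omega)

lemma CollectSecondInvariant.runs_round (hW : n + 2 * m + 2 ≤ W) (hC : G.IsCubicComponent C)
    (hσ : Ready G s t C σ) (hL : G.IsWalk u L u) (hnodup : L.Nodup)
    (hLB : ∀ a ∈ L, a ∈ G.boundary C) (h : CollectSecondInvariant G s t C σ L X Y z (w :: Z) τ)
    (hz : ¬ G.IsEntrance s C (G.src z)) :
    Runs W (.seq restartAtExit (collectArc 9 6)) τ 130 fun τ' =>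
      ∃ X' Y', CollectSecondInvariant G s t C σ L X' Y' w Z τ' := by
  have hzB : z ∈ G.boundary C := hLB z (by simp [h.split])
  refine .seq (h.runs_restartAtExit hW hσ hzB.1) (B₂ := 90) ?_ (by omega)
  rintro τ₁ ⟨X₁, Y₁, h₁, hexit⟩
  have hlen := hnodup.length_le_card
  rw [h₁.split] at hL hlen
  simp only [List.length_append, List.length_cons, Fintype.card_fin] at hlen
  refine (runs_collectArc (by omega) (by omega) (.inr rfl) hW hC (h₁.ready hσ).toHoldsComponent hzB
    (hLB w (by simp [h.split])) hL.src_eq_tgt h₁.reg_eight (by omega) h₁.reg_nine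
    h₁.stores).mono le_rfl ?_
  rintro τ₂ ⟨h₈, h₉, hstores, -, hmem⟩
  refine ⟨X₁, Y₁ ++ [z], fun k hk => (hmem k hk).trans (h₁.mem k hk), by simpa using h₁.split, h₈,
    h₉, hstores, ?_, .inl hexit⟩
  rw [← List.append_assoc, List.forall_mem_append]
  exact ⟨h₁.not_isEntrance, by simpa using hz⟩

lemma runs_collectSecond (hW : n + 2 * m + 2 ≤ W) (hC : G.IsCubicComponent C)
    (hσ : Ready G s t C σ) (hL : G.IsWalk u (q :: L) u) (hnodup : (q :: L).Nodup)
    (hLB : ∀ a ∈ q :: L, a ∈ G.boundary C) (hq : G.IsExit t C (G.src q))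
    (hentrance : ∃ a ∈ q :: L, G.IsEntrance s C (G.src a)) (hreg : σ.reg 8 = q) :
    Runs W collectSecond σ (200 * m + 40) fun τ => ∃ X Y z Z,
      CollectSecondInvariant G s t C σ (q :: L) X Y z Z τ ∧ G.IsEntrance s C (G.src z) := by
  have hlen := hnodup.length_le_card
  rw [Fintype.card_fin] at hlen
  let I (k : ℕ) (τ : State) : Prop :=
    ∃ X Y z Z, CollectSecondInvariant G s t C σ (q :: L) X Y z Z τ ∧ k = Z.length
  refine .set_seq (hasValue_lit (Nat.zero_le W)) (B₂ := 200 * m + 35) (.loop I (k := L.length)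
    (guard := fun τ => ∃ z : Fin m, τ.reg 8 = z ∧ ¬ G.IsEntrance s C (G.src z)) (B₁ := 130)
    ?_ ?_ ?_ ?_ ?_) (by simp only [Expr.cost]; omega)
  · exact ⟨[], [], q, L, ⟨fun _ _ => rfl, rfl, by simpa using hreg, by simp, stores_nil, by simp,
      .inr ⟨rfl, hq⟩⟩, rfl⟩
  · rintro k τ ⟨X, Y, z, Z, h, -⟩
    have hz : z ∈ G.boundary C := hLB z (by simp [h.split])
    refine (((h.ready hσ).tests_startsAtEntrance hW (hasValue_reg h.reg_eight (by omega))).not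
      (by omega)).congr ?_
    simp [h.reg_eight, Fin.val_inj, hz.1]
  · rintro k τ ⟨X, Y, z, Z, h, rfl⟩ ⟨z', hz', hze⟩
    obtain rfl : z = z' := Fin.ext (h.reg_eight.symm.trans hz')
    cases Z with
    | nil =>
      obtain ⟨a, ha, hae⟩ := hentrance
      rw [h.split, List.mem_append, List.mem_singleton] at ha
      rcases ha with ha | rfl
      exacts [absurd hae (h.not_isEntrance a ha), absurd hae hze]
    | cons w Z =>
      exact (h.runs_round hW hC hσ hL hnodup hLB hze).mono le_rfl fun τ' ⟨X', Y', h'⟩ =>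
        ⟨Z.length, by simp, X', Y', w, Z, h', rfl⟩
  · rintro k τ ⟨X, Y, z, Z, h, -⟩ hze
    exact ⟨X, Y, z, Z, h, by_contra fun hz => hze ⟨z, h.reg_eight, hz⟩⟩
  · simp only [List.length_cons] at hlen
    simp only [Expr.cost, startsAtEntrance, arcInComponent, inComponent]
    omega

/-- The progress of `collectFirst` from the state `σ` on the list `U ++ V` of boundary arcs: `U` is
in array 5, and `v` is the first arc of `V`, or `y` if `V` is empty. -/
structure CollectFirstInvariant (σ : State) (U V : List (Fin m)) (v y : Fin m) (τ : State) :
    Prop where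
  mem : ∀ k ≠ 5, τ.mem k = σ.mem k
  reg_nine : τ.reg 9 = σ.reg 9
  head : (V ++ [y]).head? = some v
  reg_eight : τ.reg 8 = v
  reg_fifteen : τ.reg 15 = U.length
  stores : Stores τ 5 (U.map Fin.val)

lemma CollectFirstInvariant.runs_round (hW : n + 2 * m + 2 ≤ W) (hC : G.IsCubicComponent C)
    (hσ : HoldsComponent G C σ) (hL : G.IsWalk u (U ++ v :: V ++ y :: Y) u)
    (hnodup : (U ++ v :: V ++ y :: Y).Nodup)
    (hLB : ∀ a ∈ U ++ v :: V ++ y :: Y, a ∈ G.boundary C)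
    (h : CollectFirstInvariant σ U (v :: V) v y τ) :
    Runs W (collectArc 15 5) τ 90 fun τ' => ∃ w, CollectFirstInvariant σ (U ++ [v]) V w y τ' := by
  have hlen := hnodup.length_le_card
  simp only [List.length_append, List.length_cons, Fintype.card_fin] at hlen
  obtain ⟨w, R, hR⟩ : ∃ w R, V ++ y :: Y = w :: R := List.exists_cons_of_ne_nil (by simp)
  have hw : (V ++ [y]).head? = some w := by
    cases V <;> simp_all
  rw [List.append_assoc, List.cons_append, hR] at hL hLB
  refine (runs_collectArc (by omega) (by omega) (.inl rfl) hW hC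
    (hσ.congr fun k _ hk _ => h.mem k hk) (hLB v (by simp)) (hLB w (by simp)) hL.src_eq_tgt
    h.reg_eight (by omega) h.reg_fifteen h.stores).mono le_rfl ?_
  rintro τ' ⟨h₈, h₁₅, hstores, hreg, hmem⟩
  exact ⟨w, fun k hk => (hmem k hk).trans (h.mem k hk),
    (hreg 9 (by omega) (by omega) (by omega)).trans h.reg_nine, hw, h₈, h₁₅, hstores⟩

lemma runs_collectFirst (hW : n + 2 * m + 2 ≤ W) (hC : G.IsCubicComponent C)
    (hσ : HoldsComponent G C σ) (hL : G.IsWalk u (z :: Z ++ y :: Y) u)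
    (hnodup : (z :: Z ++ y :: Y).Nodup) (hLB : ∀ a ∈ z :: Z ++ y :: Y, a ∈ G.boundary C)
    (hreg : σ.reg 8 = z) (hy : σ.mem 6 0 = y) :
    Runs W collectFirst σ (200 * m + 40) fun τ => (∀ k ≠ 5, τ.mem k = σ.mem k) ∧
      τ.reg 9 = σ.reg 9 ∧ τ.reg 15 = (z :: Z).length ∧ Stores τ 5 ((z :: Z).map Fin.val) := by
  have hlen := hnodup.length_le_card
  simp only [List.length_append, List.length_cons, Fintype.card_fin] at hlen
  let I (k : ℕ) (τ : State) : Prop :=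
    ∃ U V v, CollectFirstInvariant σ U V v y τ ∧ z :: Z = U ++ V ∧ k = V.length
  refine .set_seq (hasValue_lit (Nat.zero_le W)) (B₂ := 200 * m + 35)
    (.loop I (k := (z :: Z).length) (guard := fun τ => ¬ τ.reg 8 = y) (B₁ := 90) ?_ ?_ ?_ ?_ ?_)
    (by simp only [Expr.cost]; omega)
  · exact ⟨[], z :: Z, z, ⟨fun _ _ => rfl, by simp, rfl, by simpa using hreg, by simp,
      stores_nil⟩, rfl, rfl⟩
  · rintro k τ ⟨U, V, v, h, -, -⟩
    exact ((hasValue_reg rfl (by rw [h.reg_eight]; omega)).tests_eq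
      ((hasValue_lit (Nat.zero_le W)).mem ((congrFun (h.mem 6 (by omega)) 0).trans hy) (by omega))
      (by omega)).not (by omega)
  · rintro k τ ⟨U, V, v, h, hUV, rfl⟩ hvy
    have hhead := h.head
    cases V with
    | nil => simp_all [h.reg_eight]
    | cons v' V =>
      obtain rfl : v' = v := by simpa using hhead
      rw [hUV] at hL hnodup hLB
      exact (h.runs_round hW hC hσ hL hnodup hLB).mono le_rfl fun τ' ⟨w, h'⟩ =>
        ⟨V.length, by simp, U ++ [v'], V, w, h', by simpa using hUV, rfl⟩
  · rintro k τ ⟨U, V, v, h, hUV, -⟩ hvy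
    have hhead := h.head
    cases V with
    | nil =>
      rw [List.append_nil] at hUV
      exact ⟨h.mem, h.reg_nine, hUV ▸ h.reg_fifteen, hUV ▸ h.stores⟩
    | cons v' V =>
      obtain rfl : v' = v := by simpa using hhead
      obtain rfl : v' = y := Fin.ext (h.reg_eight.symm.trans (not_not.1 hvy))
      rw [hUV] at hnodup
      exact absurd rfl ((List.nodup_append.1 hnodup).2.2 v' (by simp) v' (by simp))
  · simp only [Expr.cost, List.length_cons]
    omega

end Collect

section Split

variable {n m W : ℕ} {G : EmbeddedDigraph (Fin n) (Fin m)} {s t c : Fin n} {C : Set (Fin n)}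
  {σ : State} {q : Fin m}

lemma runs_collectPaths (hW : n + 2 * m + 2 ≤ W) (hN : G.IsNormalNetwork s t)
    (hC : G.IsOutsideComponent s t C) (hσ : Ready G s t C σ) (he : ∃ e, G.IsEntrance s C e)
    (hqC : q ∈ G.arcsOf C) (hq : G.IsExit t C (G.src q)) (hreg : σ.reg 8 = q) :
    Runs W collectPaths σ (400 * m + 100) fun τ => τ.reg 0 = 1 ∧ ∃ Q₁ Q₂, Holds τ 1 5 Q₁ ∧
      Holds τ 2 6 Q₂ ∧ ∀ Q, G.IsBoundaryCycle C Q → G.Splits s t C Q Q₁ Q₂ := by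
  have hcubic := hC.isCubicComponent hN
  obtain ⟨Q, hQ⟩ := hcubic.exists_isBoundaryCycle
  have hqB : q ∈ G.boundary C := by
    obtain ⟨b, hb, -, huniq⟩ := hC.exists_boundary_of_isExit hN hq
    exact huniq q hqC rfl ▸ hb
  obtain ⟨L, hrot, hL⟩ := hQ.exists_rotation hqB
  have hentrance : ∃ a ∈ q :: L, G.IsEntrance s C (G.src a) := by
    obtain ⟨_, he⟩ := he
    obtain ⟨-, -, b, hb, -, rfl, -⟩ := hC.exists_boundary_of_isEntrance hN he
    exact ⟨b, hrot.perm.mem_iff.1 ((hQ.2 b).2 hb), he⟩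
  refine .seq (runs_collectSecond hW hcubic hσ hL (hrot.perm.nodup_iff.1 hQ.nodup)
    (fun a ha => (hQ.2 a).1 (hrot.perm.mem_iff.2 ha)) hq hentrance hreg) (B₂ := 200 * m + 55) ?_
    (by omega)
  rintro τ ⟨X, Y, z, Z, hτ, hz⟩
  have exists_isCut {Q' : List (Fin m)} (hQ' : G.IsBoundaryCycle C Q') :
      ∃ x, G.IsCut s t C Q' (z :: (Z ++ X)) Y (G.src z) x :=
    hC.isCut_of_startsAtLastExit hN hQ'
      (hτ.split ▸ (hcubic.isRotated_of_isBoundaryCycle hQ' hQ).trans hrot) (hτ.split ▸ hL) hz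
      (hτ.startsAtLastExit hN hC hz) fun a ha => hτ.not_isEntrance a (List.mem_append_right X ha)
  obtain ⟨x, hcut⟩ := exists_isCut hQ
  obtain ⟨y, Y, rfl, -⟩ := hτ.startsAtLastExit hN hC hz
  have hlen := (hcut.nodup hQ).length_le_card
  rw [List.length_append, Fintype.card_fin] at hlen
  refine .seq (runs_collectFirst hW hcubic (hτ.ready hσ).toHoldsComponent
    (hcut.isWalk_left.append hcut.isWalk_right) (hcut.nodup hQ)
    (fun a ha => (hcut.mem_boundary_iff hQ).2 (List.mem_append.1 ha)) hτ.reg_eight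
    (hτ.stores 0 (by simp))) (B₂ := 10) ?_ (by omega)
  rintro τ' ⟨hmem, h₉, h₁₅, hstores⟩
  rw [hτ.reg_nine] at h₉
  refine .set_seq (B₂ := 5) (hasValue_lit (by omega)) (.set_seq (B₂ := 2)
    (hasValue_reg (x := (z :: (Z ++ X)).length) (by simpa using h₁₅) (by omega))
    (.set (hasValue_reg (x := (y :: Y).length) (by simpa using h₉) (by omega)) ⟨by simp,
      z :: (Z ++ X), y :: Y, Stores.holds (hstores.congr rfl) (by simp),
      Stores.holds (hτ.stores.congr (hmem 6 (by omega))) (by simp), fun Q' hQ' => ?_⟩ le_rfl)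
    le_rfl) (by simp only [Expr.cost]; omega)
  obtain ⟨x', hcut'⟩ := exists_isCut hQ'
  exact hC.splits_of_isCut hN hQ' hcut'

lemma runs_findArcs (hW : n + 2 * m + 2 ≤ W) (hσ : Ready G s t C σ) (hreg : σ.reg 1 = m) :
    Runs W findArcs σ (88 * m + 50) fun τ => Ready G s t C τ ∧ τ.reg 1 = m ∧
      IsSearchResult (fun a => a ∈ G.arcsOf C ∧ G.IsEntrance s C (G.src a)) m (τ.reg 7) ∧
      IsSearchResult (fun a => a ∈ G.arcsOf C ∧ G.IsExit t C (G.src a)) m (τ.reg 8) := by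
  have cost_entrance : (startsAtEntrance (.reg 5)).cost = 24 := rfl
  have cost_exit : (startsAtExit (.reg 5)).cost = 24 := rfl
  refine .seq (runs_findArc (by omega) (by omega) (by omega) hreg fun τ a hmem hτ =>
    (hσ.congr fun k _ _ => congrFun hmem k).tests_startsAtEntrance hW
      (hasValue_reg hτ (by omega))) (B₂ := m * 44 + 20) ?_ (by rw [cost_entrance]; omega)
  rintro τ ⟨hmem, hother, hentrance⟩
  have hτ : Ready G s t C τ := hσ.congr fun k _ _ => congrFun hmem k
  have hreg' : τ.reg 1 = m := (hother 1 (by omega) (by omega)).trans hreg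
  refine (runs_findArc (by omega) (by omega) (by omega) hreg' fun τ' a hmem' hτ' =>
    (hτ.congr fun k _ _ => congrFun hmem' k).tests_startsAtExit hW
      (hasValue_reg hτ' (by omega))).mono (by rw [cost_exit]) ?_
  rintro τ' ⟨hmem', hother', hexit⟩
  exact ⟨hτ.congr fun k _ _ => congrFun hmem' k, (hother' 1 (by omega) (by omega)).trans hreg',
    hother' 7 (by omega) (by omega) ▸ hentrance, hexit⟩

lemma runs_splitBoundary (hW : 2000 * (n + m) ≤ W) (hN : G.IsNormalNetwork s t)
    (hC : G.IsOutsideComponent s t C) (hc : c ∈ C) (hσ : IsInput G s t c σ) :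
    Runs W splitBoundary σ (2000 * (n + m)) fun τ => (τ.reg 0 = 0 ∧ G.AllUseless s t C) ∨
      (τ.reg 0 = 1 ∧ ∃ Q₁ Q₂, Holds τ 1 5 Q₁ ∧ Holds τ 2 6 Q₂ ∧
        ∀ Q, G.IsBoundaryCycle C Q → G.Splits s t C Q Q₁ Q₂) := by
  have hn : 0 < n := c.pos
  have hcubic := hC.isCubicComponent hN
  refine .seq (runs_searches (by omega) hN hC hc hσ) (B₂ := 500 * m + 300) ?_ (by omega)
  rintro τ₁ ⟨hagree, hτ₁⟩
  refine .seq (runs_findArcs (by omega) hτ₁ ((hagree.reg 1 (by omega)).trans hσ.reg_m))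
    (B₂ := 400 * m + 150) ?_ (by omega)
  rintro τ₂ ⟨hτ₂, hreg, hentrance, hexit⟩
  have hlt_entrance := hentrance.lt_iff.trans (hcubic.exists_src_iff fun _ h => h.1)
  have hlt_exit := hexit.lt_iff.trans (hcubic.exists_src_iff fun _ h => h.1)
  refine .ite ((((hasValue_reg rfl ?_).tests_lt (hasValue_reg hreg (by omega)) (by omega)).and
    ((hasValue_reg rfl ?_).tests_lt (hasValue_reg hreg (by omega)) (by omega)) (by omega)).congr
      (and_congr hlt_entrance hlt_exit)) (B₁ := 400 * m + 100) ?_ ?_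
      (by simp only [Expr.cost]; omega)
  · exact hentrance.le.trans (by omega)
  · exact hexit.le.trans (by omega)
  · rintro ⟨he, hx⟩
    obtain ⟨q, ⟨hqC, hqx⟩, hq⟩ := hexit.resolve_left fun h => (hlt_exit.2 hx).ne h.1
    exact (runs_collectPaths (by omega) hN hC hτ₂ he hqC hqx hq).mono le_rfl fun _ => .inr
  · intro h
    exact .set (hasValue_lit (Nat.zero_le W)) (.inl ⟨by simp, allUseless_of_not_exists h⟩)
      (by simp only [Expr.cost]; omega)

end Split

end RAM

theorem mainTheorem6 :
    -- the structure of the boundary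
    (∀ (V A : Type*) [Finite V] [Finite A] (G : EmbeddedDigraph V A) (s t : V) (C : Set V),
      G.IsNormalNetwork s t → G.IsOutsideComponent s t C →
        (∃ Q, G.IsBoundaryCycle C Q) ∧
        ∀ Q, G.IsBoundaryCycle C Q →
          G.AllUseless s t C ∨ ∃ Q₁ Q₂, G.Splits s t C Q Q₁ Q₂) ∧
    -- the linear-time algorithm: it reports in register 0 which case holds, and in the second case
    -- it returns the two paths
    (∃ (P : RAM.Program) (K : ℕ), ∀ (n m : ℕ) (G : EmbeddedDigraph (Fin n) (Fin m))
      (s t c : Fin n) (C : Set (Fin n)) (σ : RAM.State),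
      G.IsNormalNetwork s t → G.IsOutsideComponent s t C → c ∈ C → RAM.IsInput G s t c σ →
        ∃ (T : ℕ) (σ' : RAM.State), RAM.Exec (K * (n + m)) P σ T σ' ∧ T ≤ K * (n + m) ∧
          ((σ'.reg 0 = 0 ∧ G.AllUseless s t C) ∨
            (σ'.reg 0 = 1 ∧ ∃ Q₁ Q₂, RAM.Holds σ' 1 5 Q₁ ∧ RAM.Holds σ' 2 6 Q₂ ∧
              ∀ Q, G.IsBoundaryCycle C Q → G.Splits s t C Q Q₁ Q₂))) := by
  refine ⟨fun V A _ _ G s t C hN hC => ⟨(hC.isCubicComponent hN).exists_isBoundaryCycle,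
    fun Q hQ => hC.allUseless_or_splits hN hQ⟩, RAM.splitBoundary, 2000, ?_⟩
  intro n m G s t c C σ hN hC hc hσ
  exact RAM.runs_splitBoundary le_rfl hN hC hc hσ
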